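/- Let $T>0$, $m>0$, $e\in\mathbb R$, and let $\theta\in C^1(\mathbb R)$ be $T$-periodic, with averages $\langle\theta\rangle=\frac1T\int_0^T\theta\,ds$ and $\langle\theta^2\rangle=\frac1T\int_0^T\theta^2\,ds$. Let $E\in L^1_{\mathrm{loc}}(\mathbb R_+;L^\infty(\mathbb R^3))^3$ and $f^{\mathrm{in}}\in L^2(\mathbb R^3\times\mathbb R^3)$. Let $B(x)>0$ be a scalar field and $b(x)$ a field of unit vectors on $\mathbb R^3$ such that $Bb=\operatorname{curl}A$, $\operatorname{div}A=0$ a.e. for some $A\in W^{1,\infty}(\mathbb R^3)^3$, with Jacobian matrix $\partial_xA=(\partial_{x_j}A_i)_{ij}$, and put $\omega_c=eB/m$. For every $\varepsilon>0$ let $f^\varepsilon\in L^\infty(\mathbb R_+;L^2(\mathbb R^3\times\mathbb R^3))$ be a weak solution of $$\partial_tf^\varepsilon+\frac pm\cdot\nabla_xf^\varepsilon+\Big(eE(t,x)-\frac{e\,\theta'(t/\varepsilon)}{\varepsilon}A(x)+\omega_c(x)\,\theta(t/\varepsilon)\,p\wedge b(x)\Big)\cdot\nabla_pf^\varepsilon=0,\qquad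 f^\varepsilon(0,x,p)=f^{\mathrm{in}}(x,p),$$ and assume that the family $(f^\varepsilon)_{\varepsilon>0}$ is bounded in $L^\infty(\mathbb R_+;L^2(\mathbb R^3\times\mathbb R^3))$. Then there are a sequence $\varepsilon_n\searrow0$ and a function $f^0=f^0(t,s,x,p)$, $T$-periodic in $s$, $f^0\in L^\infty(\mathbb R_+;L^2_\#(\mathbb R_s;L^2(\mathbb R^3\times\mathbb R^3)))$, such that $(f^{\varepsilon_n})_n$ two-scale converges to $f^0$ on $[0,I]$ for every $I>0$, that is, $$\lim_{n\to\infty}\int_0^I\!\!\iint f^{\varepsilon_n}(t,x,p)\,\varphi(t,t/\varepsilon_n,x,p)\,dp\,dx\,dt=\int_0^I\frac1T\int_0^T\!\!\iint (f^0\varphi)(t,s,x,p)\,dp\,dx\,ds\,dt$$ for all $\varphi\in L^2([0,I];C^0_\#(\mathbb R_s;L^2(\mathbb R^3\times\mathbb R^3)))$ (the subscript $\#$ means $T$-periodic), and $f^0$ is a weak solution of $$\partial_tf^0+\frac{p+e(\theta(s)-\langle\theta\rangle)A(x)}{m}\cdot\nabla_xf^0+\Big[eE+\frac em\big(\langle\theta\rangle\,{}^t\partial_xA-\theta(s)\,\partial_xA\big)p+\frac{e^2}{m}\big(\theta(s)\langle\theta\rangle-\langle\theta^2\rangle\big)\,{}^t\partial_xA\,A+\frac{e^2}{m}\big(\langle\theta\rangle-\theta(s)\big)\theta(s)\,\partial_xA\,A\Big]\cdot\nabla_pf^0=0,$$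 $$f^0(0,s,x,p)=f^{\mathrm{in}}\big(x,\,p+e(\theta(s)-\theta(0))A(x)\big).$$ Weak solutions are understood against $C^1$ test functions, compactly supported in $(t,x,p)\in[0,\infty)\times\mathbb R^3\times\mathbb R^3$ and, for the limit problem, also depending $T$-periodically on $s$. -/

import Mathlib

open MeasureTheory Set Filter Topology

noncomputable section

/-- Euclidean space `ℝ³`. -/
abbrev E3 : Type := EuclideanSpace ℝ (Fin 3)

/-- The phase space `ℝ³ × ℝ³` of pairs `(x, p)`; its measure is the Lebesgue measure. -/
abbrev Phase : Type := E3 × E3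

/-- `L²(ℝ³ × ℝ³)`. -/
abbrev L2Phase : Type := Lp ℝ 2 (volume : Measure Phase)

/-- The space of `T`-periodic functions of `s` with values in `L²(ℝ³ × ℝ³)` that are square
integrable over a period. (The measure on `AddCircle T` has total mass `T`.) -/
abbrev L2Per (T : ℝ) [Fact (0 < T)] : Type := Lp L2Phase 2 (volume : Measure (AddCircle T))

/-- The space of continuous `T`-periodic functions of `s` with values in `L²(ℝ³ × ℝ³)`, with the
sup norm. -/
abbrev CPer (T : ℝ) [Fact (0 < T)] : Type := C(AddCircle T, L2Phase)

/-- The vector product `u ∧ v` in `ℝ³`. -/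
def cross (u v : E3) : E3 := WithLp.toLp 2 (crossProduct u.ofLp v.ofLp)

/-- `(∂ⱼ Fᵢ)(x)`, read off from the Jacobian `D` of `F` at `x`. -/
def partialD (D : E3 →L[ℝ] E3) (j i : Fin 3) : ℝ := D (EuclideanSpace.single j 1) i

/-- The curl of a field with Jacobian `D`. -/
def curlOf (D : E3 →L[ℝ] E3) : E3 :=
  !₂[partialD D 1 2 - partialD D 2 1,
     partialD D 2 0 - partialD D 0 2,
     partialD D 0 1 - partialD D 1 0]

/-- The divergence of a field with Jacobian `D`. -/
def divOf (D : E3 →L[ℝ] E3) : ℝ := ∑ i, partialD D i i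

/-- `DA` is the Jacobian `∂ₓA` of `A` in the sense of distributions: `DA x v` is the weak
derivative of `A` in the direction `v`. -/
def IsWeakJacobian (A : E3 → E3) (DA : E3 → E3 →L[ℝ] E3) : Prop :=
  ∀ ψ : E3 → ℝ, ContDiff ℝ (⊤ : ℕ∞) ψ → HasCompactSupport ψ → ∀ v : E3,
    ∫ x, (fderiv ℝ ψ x v) • A x = - ∫ x, ψ x • DA x v

/-- `A` belongs to `W^{1,∞}(ℝ³)³` and its weak Jacobian is `DA`. -/
structure IsW1inf (A : E3 → E3) (DA : E3 → E3 →L[ℝ] E3) : Prop where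
  bounded : MemLp A ⊤ (volume : Measure E3)
  bounded_deriv : MemLp DA ⊤ (volume : Measure E3)
  weak_deriv : IsWeakJacobian A DA

/-- `E` belongs to `L¹_loc(ℝ₊; L^∞(ℝ³))³`. -/
structure IsL1locLinf (E : ℝ → E3 → E3) : Prop where
  measurable : AEStronglyMeasurable (fun z : ℝ × E3 => E z.1 z.2)
    ((volume.restrict (Ici (0 : ℝ))).prod (volume : Measure E3))
  locally_integrable : ∀ I : ℝ,
    ∫⁻ t in Icc 0 I, eLpNorm (E t) ⊤ (volume : Measure E3) < ⊤

/-- The average `(1/T) ∫₀ᵀ u(τ) dτ` of a `T`-periodic function. -/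
def mean (T : ℝ) (u : ℝ → ℝ) : ℝ := (1 / T) * ∫ τ in (0 : ℝ)..T, u τ

/-- The force field
`e E(t,x) - (e θ'(t/ε) / ε) A(x) + ω_c(x) θ(t/ε) p ∧ b(x)`, `ω_c(x) = e B(x) / m`. -/
def vlasovForce (m e : ℝ) (θ : ℝ → ℝ) (E : ℝ → E3 → E3) (A : E3 → E3) (B : E3 → ℝ)
    (b : E3 → E3) (ε t : ℝ) (x p : E3) : E3 :=
  e • E t x - (e * deriv θ (t / ε) / ε) • A x + (e * B x / m * θ (t / ε)) • cross p (b x)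

/-- `f` is a weak solution of
`∂ₜ f + (p/m) · ∇ₓ f + F^ε(t,x,p) · ∇ₚ f = 0`, `f(0,·,·) = fin`,
where `F^ε` is `vlasovForce`. The test functions are `C¹` with compact support in
`[0,∞) × ℝ³ × ℝ³`. -/
def IsWeakVlasovSolution (m e : ℝ) (θ : ℝ → ℝ) (E : ℝ → E3 → E3) (A : E3 → E3) (B : E3 → ℝ)
    (b : E3 → E3) (ε : ℝ) (fin : Phase → ℝ) (f : ℝ → L2Phase) : Prop :=
  ∀ φ : ℝ × E3 × E3 → ℝ, ContDiff ℝ 1 φ → HasCompactSupport φ →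
    - (∫ z : Phase, fin z * φ (0, z.1, z.2))
      - (∫ t in Ioi (0 : ℝ), ∫ z : Phase, f t z *
          fderiv ℝ φ (t, z.1, z.2)
            (1, (1 / m) • z.2, vlasovForce m e θ E A B b ε t z.1 z.2)) = 0

/-- The velocity field of the limit equation, `(p + e (θ(s) - ⟨θ⟩) A(x)) / m`. -/
def limitVelocity (T m e : ℝ) (θ : ℝ → ℝ) (A : E3 → E3) (s : ℝ) (x p : E3) : E3 :=
  (1 / m) • (p + (e * (θ s - mean T θ)) • A x)

/-- The force field of the limit equation,
`e E + (e/m) (⟨θ⟩ ᵗ∂ₓA - θ ∂ₓA) p + (e²/m) (θ⟨θ⟩ - ⟨θ²⟩) ᵗ∂ₓA A + (e²/m) (⟨θ⟩ - θ) θ ∂ₓA A`. -/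
def limitForce (T m e : ℝ) (θ : ℝ → ℝ) (E : ℝ → E3 → E3) (A : E3 → E3)
    (DA : E3 → E3 →L[ℝ] E3) (t s : ℝ) (x p : E3) : E3 :=
  e • E t x
    + (e / m) • (mean T θ • ContinuousLinearMap.adjoint (DA x) p - θ s • DA x p)
    + (e ^ 2 / m * (θ s * mean T θ - mean T (fun τ => θ τ ^ 2))) •
        ContinuousLinearMap.adjoint (DA x) (A x)
    + (e ^ 2 / m * ((mean T θ - θ s) * θ s)) • DA x (A x)

/-- `f` is a weak solution of the limit equation
`∂ₜ f + V(s,x,p) · ∇ₓ f + F(t,s,x,p) · ∇ₚ f = 0`,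
`f(0,s,x,p) = fin (x, p + e (θ(s) - θ(0)) A(x))`,
where `V` is `limitVelocity` and `F` is `limitForce`. The test functions `φ(t,s,x,p)` are `C¹`,
`T`-periodic in `s` and compactly supported in `(t,x,p) ∈ [0,∞) × ℝ³ × ℝ³`. -/
def IsWeakLimitSolution (T : ℝ) [Fact (0 < T)] (m e : ℝ) (θ : ℝ → ℝ) (E : ℝ → E3 → E3)
    (A : E3 → E3) (DA : E3 → E3 →L[ℝ] E3) (fin : Phase → ℝ) (f : ℝ → L2Per T) : Prop :=
  ∀ φ : ℝ × ℝ × E3 × E3 → ℝ, ContDiff ℝ 1 φ →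
    (∀ t s x p, φ (t, s + T, x, p) = φ (t, s, x, p)) →
    (∃ K : Set (ℝ × E3 × E3), IsCompact K ∧
      ∀ t s x p, (t, x, p) ∉ K → φ (t, s, x, p) = 0) →
    - (∫ s in (0 : ℝ)..T, ∫ z : Phase,
          fin (z.1, z.2 + (e * (θ s - θ 0)) • A z.1) * φ (0, s, z.1, z.2))
      - (∫ t in Ioi (0 : ℝ), ∫ s in (0 : ℝ)..T, ∫ z : Phase,
          f t (s : AddCircle T) z *
            fderiv ℝ φ (t, s, z.1, z.2)
              (1, 0, limitVelocity T m e θ A s z.1 z.2,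
                limitForce T m e θ E A DA t s z.1 z.2)) = 0

/-- Two-scale convergence on `[0,I]` of `fₙ` towards `f₀`, at the scales `εₙ`, tested against all
`φ ∈ L²([0,I]; C_per(ℝ; L²(ℝ³ × ℝ³)))`:
`∫₀ᴵ ∫∫ fₙ(t,x,p) φ(t,t/εₙ,x,p) dp dx dt → ∫₀ᴵ (1/T) ∫₀ᵀ ∫∫ f₀ φ (t,s,x,p) dp dx ds dt`. -/
def TwoScaleConverges (T : ℝ) [Fact (0 < T)] (I : ℝ) (εs : ℕ → ℝ) (f : ℕ → ℝ → L2Phase)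
    (f₀ : ℝ → L2Per T) : Prop :=
  ∀ φ : ℝ → CPer T, MemLp φ 2 (volume.restrict (Icc 0 I)) →
    Tendsto
      (fun n => ∫ t in Icc 0 I, inner ℝ (f n t) (φ t ((t / εs n : ℝ) : AddCircle T)))
      atTop
      (𝓝 (∫ t in Icc 0 I, (1 / T) * ∫ s in (0 : ℝ)..T,
        inner ℝ (f₀ t (s : AddCircle T)) (φ t (s : AddCircle T))))

end

noncomputable section

/-! The singular force `-e θ'(t/ε)/ε A` is minus the time derivative of `e θ(t/ε) A(x)`, so it
disappears once the momentum is replaced by `p + e θ(t/ε) A(x)`. In these variables the density is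
`F^ε(t,x,p) = f^ε(t, x, p - e θ(t/ε) A(x))`. Since `p ∧ curl A = (ᵗ∂A - ∂A) p`, the magnetic force
also loses its `∂A` part, which cancels against the derivative of `A` along the velocity. What
remains is transport by `V₀ + θ(t/ε) V₁ + θ(t/ε)² V₂`, with fields independent of `ε` and bounded on
bounded sets by a locally integrable function of time; see `shearField_vlasov` and
`IsTransportSolution.shear_vlasov`.

The moments of `F^ε` against a fixed test function therefore have a modulus of continuity in time
that does not depend on `ε`. A diagonal extraction gives a subsequence and a limit `F₀` with `F^ε(t)
⇀ F₀(t)` for almost every `t > 0` (`exists_subseq_weak_tendsto`). Convergence at fixed times makes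
each pairing of `F^ε` with a density converge strongly as a function of `t`, so it may be multiplied
by the weakly convergent factors `θ(t/ε)` and `θ(t/ε)²`. Hence `F₀` is transported by `V₀ + ⟨θ⟩ V₁ +
⟨θ²⟩ V₂` (`isTransportSolution_average`).

Undoing the shear, `f^ε(t,x,p) = F^ε(t, x, p + e θ(t/ε) A(x))`, whose two-scale limit is
`f⁰(t,s,x,p) = F₀(t, x, p + e θ(s) A(x))` (`twoScaleConverges_of_weak`). This uses that weak
convergence is uniform on the compact curve traced by the sheared test function as `s` runs over a
period. For each fixed `s` the shear by `e θ(s) A` turns the averaged equation into the limit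
equation, in which `s` is only a parameter (`IsTransportSolution.shear_average`); integration over
`s` gives the weak formulation.

The potential is only Lipschitz, so a sheared test function need not be `C¹`. The shears are
justified by mollifying `A` and passing to the limit in the weak formulation by dominated
convergence (`IsTransportSolution.integral_shear`). -/

instance secondCountableTopology_L2Phase : SecondCountableTopology L2Phase :=
  haveI : Fact ((2 : ENNReal) ≠ ⊤) := ⟨by simp⟩
  haveI : IsSeparable (volume : Measure Phase) :=
    isSeparable_of_sigmaFinite (volume : Measure Phase)
  Lp.SecondCountableTopology

/-- A sequence that is approximated, uniformly in the index, by convergent sequences converges. -/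
lemma tendsto_of_forall_exists_approx {V : Type*} [SeminormedAddCommGroup V] {u : ℕ → V} {a : V}
    (h : ∀ δ > 0, ∃ u' : ℕ → V, ∃ a' : V, Tendsto u' atTop (𝓝 a') ∧
      (∀ n, ‖u n - u' n‖ ≤ δ) ∧ ‖a - a'‖ ≤ δ) : Tendsto u atTop (𝓝 a) := by
  rw [Metric.tendsto_atTop]
  intro δ hδ
  obtain ⟨u', a', hu, h1, h2⟩ := h (δ / 4) (by linarith)
  obtain ⟨N, hN⟩ := Metric.tendsto_atTop.1 hu (δ / 4) (by linarith)
  refine ⟨N, fun n hn => ?_⟩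
  have h3 := hN n hn
  rw [dist_eq_norm] at h3 ⊢
  have : u n - a = (u n - u' n) + (u' n - a') - (a - a') := by abel
  rw [this]
  have h4 := norm_sub_le ((u n - u' n) + (u' n - a')) (a - a')
  have h5 := norm_add_le (u n - u' n) (u' n - a')
  linarith [h1 n]

/-! ### Measurability of time-dependent `L²` pairings. -/

section Pairing

variable {α X : Type*} [MeasurableSpace α] [MeasurableSpace X] {ν : Measure X}

lemma integral_mul_eq_inner (f : Lp ℝ 2 ν) {g : X → ℝ} (hg : MemLp g 2 ν) :
    ∫ z, f z * g z ∂ν = inner ℝ f hg.toLp := by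
  rw [L2.inner_def]
  refine integral_congr_ae ?_
  filter_upwards [hg.coeFn_toLp] with z hz
  rw [hz]; simp [mul_comm]

/-- The pairing of an `L²`-valued strongly measurable function with a jointly measurable function is
strongly measurable. -/
lemma stronglyMeasurable_integral_mul [SFinite ν] {F : α → Lp ℝ 2 ν} (hF : StronglyMeasurable F)
    {G : α → X → ℝ} (hG : Measurable (Function.uncurry G)) (hG2 : ∀ a, MemLp (G a) 2 ν) :
    StronglyMeasurable fun a => ∫ z, F a z * G a z ∂ν := by
  refine stronglyMeasurable_of_tendsto (u := atTop)
    (f := fun n a => ∫ z, hF.approx n a z * G a z ∂ν) (fun n => ?_) ?_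
  · refine Measurable.stronglyMeasurable ?_
    -- On each piece of a simple approximation of `F` the `L²` class is a constant `c`, so one
    -- representative serves for all `a` and Fubini measurability applies.
    refine SimpleFunc.measurable_bind (hF.approx n) (fun c a => ∫ z, c z * G a z ∂ν) fun c => ?_
    refine (StronglyMeasurable.integral_prod_right' (f := fun p : α × X => c p.2 * G p.1 p.2)
      ?_).measurable
    exact (((Lp.stronglyMeasurable c).measurable.comp measurable_snd).mul hG).stronglyMeasurable
  · rw [tendsto_pi_nhds]
    intro a
    simp only [integral_mul_eq_inner _ (hG2 a)]
    exact (hF.tendsto_approx a).inner tendsto_const_nhds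

end Pairing

/-! ### Weak measurability and weak convergence in Hilbert spaces. -/

section Hilbert

variable {H : Type*} [NormedAddCommGroup H] [InnerProductSpace ℝ H]

/-- By continuity the test vectors may be taken everywhere, in particular equal to `y`. With `D`
countable, this makes a norm bound a countable family of scalar conditions. -/
lemma norm_le_iff_forall_dense {D : Set H} (hD : Dense D) (y : H) {r : ℝ} (hr : 0 ≤ r) :
    ‖y‖ ≤ r ↔ ∀ d ∈ D, inner ℝ y d ≤ r * ‖d‖ := by
  refine ⟨fun h d _ => (real_inner_le_norm y d).trans (by gcongr), fun h => ?_⟩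
  have hc : IsClosed {x : H | inner ℝ y x ≤ r * ‖x‖} :=
    isClosed_le (by fun_prop) (by fun_prop)
  have hy : y ∈ {x : H | inner ℝ y x ≤ r * ‖x‖} := by
    have := hc.closure_subset_iff.2 h
    rw [hD.closure_eq] at this
    exact this (mem_univ y)
  simp only [mem_ofPred_eq, real_inner_self_eq_norm_mul_norm] at hy
  by_contra hlt
  push Not at hlt
  have : 0 < ‖y‖ := hr.trans_lt hlt
  nlinarith

/-- A weakly measurable function with values in a separable Hilbert space is strongly measurable. -/
lemma stronglyMeasurable_of_inner [SecondCountableTopology H] {α : Type*} [MeasurableSpace α]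
    {f : α → H} (hf : ∀ x, Measurable fun a => (inner ℝ (f a) x : ℝ)) : StronglyMeasurable f := by
  borelize H
  refine Measurable.stronglyMeasurable ?_
  have hn : ∀ c, Measurable fun a => ‖f a - c‖ := by
    intro c
    refine measurable_of_Iic fun r => ?_
    by_cases hr : 0 ≤ r
    · have : (fun a => ‖f a - c‖) ⁻¹' Iic r =
          ⋂ n : ℕ, {a | inner ℝ (f a) (TopologicalSpace.denseSeq H n) -
            inner ℝ c (TopologicalSpace.denseSeq H n) ≤
            r * ‖TopologicalSpace.denseSeq H n‖} := by
        ext a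
        simp only [mem_preimage, mem_Iic, mem_iInter, mem_ofPred_eq, ← inner_sub_left]
        rw [norm_le_iff_forall_dense (TopologicalSpace.denseRange_denseSeq H) _ hr]
        simp
      rw [this]
      exact MeasurableSet.iInter fun n =>
        measurableSet_le ((hf _).sub measurable_const) measurable_const
    · convert MeasurableSet.empty
      ext a
      simp only [mem_preimage, mem_Iic, mem_empty_iff_false, iff_false, not_le]
      exact (not_le.1 hr).trans_le (norm_nonneg _)
  -- Second countability makes every open set a countable union of balls, whose preimages are
  -- controlled by `hn`.
  refine measurable_of_isOpen fun U hU => ?_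
  choose! r hr using fun x hx => Metric.isOpen_iff.1 hU x hx
  obtain ⟨s, hs, hsU⟩ := TopologicalSpace.isOpen_iUnion_countable
    (fun x : U => Metric.ball (x : H) (r x)) (fun _ => Metric.isOpen_ball)
  have hU' : U = ⋃ x ∈ s, Metric.ball (x : H) (r x) := by
    rw [hsU]
    refine Subset.antisymm (fun x hx => ?_) (iUnion_subset fun x => (hr x x.2).2)
    exact mem_iUnion.2 ⟨⟨x, hx⟩, Metric.mem_ball_self (hr x hx).1⟩
  rw [hU', preimage_iUnion₂]
  refine MeasurableSet.biUnion hs fun x _ => ?_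
  have : f ⁻¹' Metric.ball (x : H) (r x) = {a | ‖f a - x‖ < r x} := by
    ext a; simp [dist_eq_norm]
  rw [this]
  exact measurableSet_lt (hn _) measurable_const

/-- A bounded sequence whose inner products with a dense set of vectors converge is weakly
convergent. -/
lemma exists_weakLimit [CompleteSpace H] {D : Set H} (hD : Dense D) {v : ℕ → H} {C : ℝ}
    (hv : ∀ n, ‖v n‖ ≤ C) (h : ∀ d ∈ D, ∃ a, Tendsto (fun n => (inner ℝ (v n) d : ℝ)) atTop (𝓝 a)) :
    ∃ w : H, ‖w‖ ≤ C ∧ ∀ x, Tendsto (fun n => (inner ℝ (v n) x : ℝ)) atTop (𝓝 (inner ℝ w x)) := by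
  have hC : 0 ≤ C := (norm_nonneg _).trans (hv 0)
  have h1 : ∀ x, ∃ a, Tendsto (fun n => (inner ℝ (v n) x : ℝ)) atTop (𝓝 a) := by
    intro x
    refine cauchySeq_tendsto_of_complete ?_
    rw [Metric.cauchySeq_iff']
    intro δ hδ
    obtain ⟨d, hd, hdx⟩ := Metric.dense_iff.1 hD x (δ / (4 * (C + 1))) (by positivity)
    rw [Metric.mem_ball, dist_comm, dist_eq_norm] at hd
    obtain ⟨a, ha⟩ := h d hdx
    obtain ⟨N, hN⟩ := Metric.cauchySeq_iff'.1 ha.cauchySeq (δ / 4) (by linarith)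
    have hb : ∀ n, |inner ℝ (v n) (x - d)| ≤ δ / 4 := by
      intro n
      calc |inner ℝ (v n) (x - d)| ≤ ‖v n‖ * ‖x - d‖ := abs_real_inner_le_norm _ _
        _ ≤ (C + 1) * (δ / (4 * (C + 1))) := by
          gcongr
          linarith [hv n]
        _ = δ / 4 := by field_simp
    refine ⟨N, fun n hn => ?_⟩
    have h2 := hN n hn
    rw [Real.dist_eq] at h2 ⊢
    have h3 := hb n
    have h4 := hb N
    rw [inner_sub_right, abs_le] at h3 h4
    rw [abs_lt] at h2 ⊢
    constructor <;> linarith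
  choose g hg using h1
  -- The pointwise limit of the functionals is continuous by Banach–Steinhaus, and Riesz
  -- representation turns it into the vector `w`.
  let L : H →L[ℝ] ℝ := continuousLinearMapOfTendsto (l := atTop) (fun n => innerSL ℝ (v n))
    (f := g) (tendsto_pi_nhds.2 fun x => by simpa using hg x)
  have hL : ∀ x, L x = g x := fun x => rfl
  refine ⟨(InnerProductSpace.toDual ℝ H).symm L, ?_, fun x => ?_⟩
  · rw [norm_le_iff_forall_dense dense_univ _ hC]
    intro d _
    rw [InnerProductSpace.toDual_symm_apply, hL]
    exact le_of_tendsto' (hg d) fun n => (real_inner_le_norm _ _).trans (by gcongr; exact hv n)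
  · rw [InnerProductSpace.toDual_symm_apply, hL]
    exact hg x

/-- Weak convergence of a bounded sequence is uniform on compact sets. -/
lemma tendsto_inner_of_mem_compact {v : ℕ → H} {w : H} {C : ℝ} (hv : ∀ n, ‖v n‖ ≤ C)
    (h : ∀ x, Tendsto (fun n => (inner ℝ (v n) x : ℝ)) atTop (𝓝 (inner ℝ w x)))
    {K : Set H} (hK : IsCompact K) {k : ℕ → H} (hk : ∀ n, k n ∈ K) :
    Tendsto (fun n => (inner ℝ (v n) (k n) - inner ℝ w (k n) : ℝ)) atTop (𝓝 0) := by
  -- Along a subsequence `k n → x` in norm. Then `⟨v - w, k⟩ = ⟨v - w, x⟩ + ⟨v - w, k - x⟩`, where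
  -- the first term tends to zero weakly and the second by the norm bound.
  refine tendsto_of_subseq_tendsto fun ns hns => ?_
  obtain ⟨x, -, φ, hφ, hx⟩ := hK.tendsto_subseq (x := fun n => k (ns n)) (fun n => hk _)
  refine ⟨φ, ?_⟩
  have h1 : Tendsto (fun n => ns (φ n)) atTop atTop := hns.comp hφ.tendsto_atTop
  have h2 : Tendsto (fun n => (inner ℝ (v (ns (φ n))) x - inner ℝ w x : ℝ)) atTop (𝓝 0) := by
    simpa using ((h x).comp h1).sub_const (inner ℝ w x)
  have h3 : Tendsto (fun n => (inner ℝ (v (ns (φ n)) - w) (k (ns (φ n)) - x) : ℝ)) atTop (𝓝 0) := by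
    refine squeeze_zero_norm (a := fun n => (C + ‖w‖) * ‖k (ns (φ n)) - x‖) (fun n => ?_) ?_
    · refine (norm_inner_le_norm _ _).trans ?_
      gcongr
      exact (norm_sub_le _ _).trans (by gcongr; exact hv _)
    · have := (tendsto_iff_norm_sub_tendsto_zero.1 hx).const_mul (C + ‖w‖)
      simpa using this
  have := h2.add h3
  rw [add_zero] at this
  refine this.congr fun n => ?_
  simp only [inner_sub_left, inner_sub_right]
  ring

end Hilbert

/-! ### Weak limits of rapidly oscillating periodic functions. -/

section Oscillation

variable {T : ℝ} [hT : Fact (0 < T)]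

lemma tendsto_cocompact_mul_div {a : ℝ} (ha : a ≠ 0) {εs : ℕ → ℝ} (hpos : ∀ n, 0 < εs n)
    (hlim : Tendsto εs atTop (𝓝 0)) : Tendsto (fun n => a / εs n) atTop (cocompact ℝ) := by
  have h1 : Tendsto (fun n => (εs n)⁻¹) atTop atTop :=
    tendsto_inv_nhdsGT_zero.comp (tendsto_nhdsWithin_iff.2 ⟨hlim, Eventually.of_forall hpos⟩)
  rw [Metric.cobounded_eq_cocompact.symm, ← tendsto_norm_atTop_iff_cobounded]
  have := h1.const_mul_atTop (abs_pos.2 ha)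
  refine this.congr fun n => ?_
  rw [norm_div, Real.norm_eq_abs, Real.norm_eq_abs, abs_of_pos (hpos n), div_eq_mul_inv]

/-- This is the Riemann–Lebesgue lemma: the integral is the Fourier transform of `v` at the
frequency `-k/(T ε)`, which escapes to infinity. -/
lemma tendsto_integral_mul_fourier {εs : ℕ → ℝ} (hpos : ∀ n, 0 < εs n)
    (hlim : Tendsto εs atTop (𝓝 0)) (v : ℝ → ℂ) {k : ℤ} (hk : k ≠ 0) :
    Tendsto (fun n => ∫ t, v t * fourier k ((t / εs n : ℝ) : AddCircle T)) atTop (𝓝 0) := by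
  have h := (Real.tendsto_integral_exp_smul_cocompact v).comp
    (tendsto_cocompact_mul_div (a := -(k / T)) (by
      have := hT.out.ne'
      simp [hk, this]) hpos hlim)
  refine h.congr fun n => integral_congr_ae (Eventually.of_forall fun t => ?_)
  simp only [fourier_coe_apply, Circle.smul_def, Real.fourierChar_apply, smul_eq_mul]
  rw [mul_comm]
  congr 2
  push_cast
  have := hT.out.ne'
  have := (hpos n).ne'
  field_simp

lemma integral_fourier {k : ℤ} (hk : k ≠ 0) :
    ∫ s, fourier k s ∂(AddCircle.haarAddCircle (T := T)) = 0 := by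
  have h := (orthonormal_iff_ite.1 (orthonormal_fourier (T := T))) 0 k
  rw [ContinuousMap.inner_toLp, if_neg (Ne.symm hk)] at h
  simpa using h

lemma integrable_mul_eval (v : ℝ → ℂ) (hv : Integrable v) (η : C(AddCircle T, ℂ)) (ε : ℝ) :
    Integrable fun t => v t * η ((t / ε : ℝ) : AddCircle T) := by
  refine hv.mul_bdd (c := ‖η‖) ?_ (Eventually.of_forall fun t => η.norm_coe_le_norm _)
  exact (η.continuous.comp (AddCircle.continuous_mk' T |>.comp (by fun_prop))).aestronglyMeasurable

/-- Nonconstant Fourier modes have mean zero and contribute nothing in the limit, while the constant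
mode gives the average. Trigonometric polynomials are uniformly dense, and both sides are Lipschitz
in `η` with constant `‖v‖₁`, uniformly in `n`. -/
lemma tendsto_integral_mul_eval_complex {εs : ℕ → ℝ} (hpos : ∀ n, 0 < εs n)
    (hlim : Tendsto εs atTop (𝓝 0)) (v : ℝ → ℂ) (hv : Integrable v) (η : C(AddCircle T, ℂ)) :
    Tendsto (fun n => ∫ t, v t * η ((t / εs n : ℝ) : AddCircle T)) atTop
      (𝓝 ((∫ t, v t) * ∫ s, η s ∂AddCircle.haarAddCircle)) := by
  have hi : ∀ η : C(AddCircle T, ℂ), Integrable η (AddCircle.haarAddCircle (T := T)) :=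
    fun η => η.continuous.integrable_of_hasCompactSupport (HasCompactSupport.of_compactSpace _)
  have hspan : ∀ η ∈ Submodule.span ℂ (range (fourier (T := T))),
      Tendsto (fun n => ∫ t, v t * η ((t / εs n : ℝ) : AddCircle T)) atTop
      (𝓝 ((∫ t, v t) * ∫ s, η s ∂AddCircle.haarAddCircle)) := by
    intro η hη
    induction hη using Submodule.span_induction with
    | mem x hx =>
      obtain ⟨k, rfl⟩ := hx
      by_cases hk : k = 0
      · subst hk
        simp
      · rw [integral_fourier hk, mul_zero]
        exact tendsto_integral_mul_fourier hpos hlim v hk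
    | zero => simp
    | add x y _ _ hx hy =>
      have := hx.add hy
      rw [← mul_add, ← integral_add (hi x) (hi y)] at this
      refine this.congr fun n => ?_
      rw [← integral_add (integrable_mul_eval v hv x _) (integrable_mul_eval v hv y _)]
      simp [mul_add]
    | smul a x _ hx =>
      have := hx.const_mul a
      simp only [ContinuousMap.coe_smul, Pi.smul_apply, smul_eq_mul]
      rw [integral_const_mul, mul_left_comm]
      refine this.congr fun n => ?_
      rw [← integral_const_mul]
      congr 1; ext t; ring
  refine tendsto_of_forall_exists_approx fun δ hδ => ?_
  have hd : η ∈ closure (Submodule.span ℂ (range (fourier (T := T))) : Set C(AddCircle T, ℂ)) := by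
    rw [← Submodule.topologicalClosure_coe, span_fourier_closure_eq_top]; trivial
  set K := ∫ t, ‖v t‖ with hK
  have hK0 : 0 ≤ K := integral_nonneg fun _ => norm_nonneg _
  obtain ⟨η', hη', hdist⟩ := Metric.mem_closure_iff.1 hd (δ / (K + 1)) (by positivity)
  rw [dist_eq_norm] at hdist
  have hb : ∀ s, ‖η s - η' s‖ ≤ δ / (K + 1) := fun s =>
    ((η - η').norm_coe_le_norm s).trans hdist.le
  have hKδ : K * (δ / (K + 1)) ≤ δ := by
    rw [mul_div_assoc', div_le_iff₀ (by positivity)]; nlinarith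
  refine ⟨_, _, hspan η' hη', fun n => ?_, ?_⟩
  · rw [← integral_sub (integrable_mul_eval v hv η _) (integrable_mul_eval v hv η' _)]
    calc _ ≤ ∫ t, ‖v t‖ * (δ / (K + 1)) := by
          refine norm_integral_le_of_norm_le (hv.norm.mul_const _) (Eventually.of_forall fun t => ?_)
          rw [← mul_sub, norm_mul]
          gcongr
          exact hb _
      _ = K * (δ / (K + 1)) := by rw [integral_mul_const]
      _ ≤ δ := hKδ
  · rw [← mul_sub, norm_mul, ← integral_sub (hi η) (hi η')]
    calc _ ≤ K * (δ / (K + 1)) := by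
          gcongr
          · exact norm_integral_le_integral_norm _
          · simpa using norm_integral_le_of_norm_le_const (μ := AddCircle.haarAddCircle (T := T))
              (f := fun s => η s - η' s) (Eventually.of_forall hb)
      _ ≤ δ := hKδ

/-- Average over a period. -/
def periodMean (η : C(AddCircle T, ℝ)) : ℝ := (1 / T) * ∫ s in (0 : ℝ)..T, η (s : AddCircle T)

lemma periodMean_eq_integral (η : C(AddCircle T, ℝ)) :
    periodMean η = ∫ s, η s ∂AddCircle.haarAddCircle := by
  have := AddCircle.intervalIntegral_preimage T 0 (fun s => η s)
  rw [zero_add] at this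
  rw [periodMean, this, AddCircle.integral_haarAddCircle, one_div, smul_eq_mul]

lemma tendsto_integral_mul_eval {εs : ℕ → ℝ} (hpos : ∀ n, 0 < εs n)
    (hlim : Tendsto εs atTop (𝓝 0)) (v : ℝ → ℝ) (hv : Integrable v) (η : C(AddCircle T, ℝ)) :
    Tendsto (fun n => ∫ t, v t * η ((t / εs n : ℝ) : AddCircle T)) atTop
      (𝓝 ((∫ t, v t) * periodMean η)) := by
  let η' : C(AddCircle T, ℂ) := ⟨fun s => (η s : ℂ), by fun_prop⟩
  have h := tendsto_integral_mul_eval_complex hpos hlim (fun t => (v t : ℂ)) hv.ofReal η'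
  have e1 : ∫ s, η' s ∂AddCircle.haarAddCircle = ((periodMean η : ℝ) : ℂ) := by
    rw [periodMean_eq_integral, ← integral_complex_ofReal]; rfl
  rw [e1, integral_complex_ofReal, ← Complex.ofReal_mul] at h
  have h2 := (Complex.continuous_re.tendsto _).comp h
  rw [Complex.ofReal_re] at h2
  refine h2.congr fun n => ?_
  have : ∀ t, (v t : ℂ) * η' ((t / εs n : ℝ) : AddCircle T) =
      ((v t * η ((t / εs n : ℝ) : AddCircle T) : ℝ) : ℂ) := fun t => by
    rw [Complex.ofReal_mul]; rfl
  simp only [Function.comp_apply, this]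
  rw [integral_complex_ofReal, Complex.ofReal_re]

lemma norm_periodMean_le (η : C(AddCircle T, ℝ)) : ‖periodMean η‖ ≤ ‖η‖ := by
  rw [periodMean_eq_integral]
  simpa using norm_integral_le_of_norm_le_const (μ := AddCircle.haarAddCircle (T := T))
    (f := fun s => η s) (Eventually.of_forall η.norm_coe_le_norm)

lemma periodMean_add (η η' : C(AddCircle T, ℝ)) :
    periodMean (η + η') = periodMean η + periodMean η' := by
  have hi : ∀ η : C(AddCircle T, ℝ), Integrable η (AddCircle.haarAddCircle (T := T)) :=
    fun η => η.continuous.integrable_of_hasCompactSupport (HasCompactSupport.of_compactSpace _)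
  simp only [periodMean_eq_integral, ContinuousMap.add_apply]
  exact integral_add (hi η) (hi η')

lemma periodMean_sub (η η' : C(AddCircle T, ℝ)) :
    periodMean (η - η') = periodMean η - periodMean η' := by
  have := periodMean_add (η - η') η'
  rw [sub_add_cancel] at this
  linarith

lemma continuous_periodMean : Continuous (periodMean (T := T)) := by
  refine LipschitzWith.continuous (K := 1) (LipschitzWith.of_dist_le_mul fun η η' => ?_)
  rw [dist_eq_norm, dist_eq_norm, ← periodMean_sub]
  simpa using norm_periodMean_le (η - η')

lemma integrable_eval {h : ℝ → C(AddCircle T, ℝ)} (hh : Integrable h) (ε : ℝ) :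
    Integrable fun t => h t ((t / ε : ℝ) : AddCircle T) := by
  refine hh.norm.mono' ?_ (Eventually.of_forall fun t => (h t).norm_coe_le_norm _)
  have hc : Continuous fun q : C(AddCircle T, ℝ) × AddCircle T => q.1 q.2 := by fun_prop
  have hm : AEStronglyMeasurable (fun t : ℝ => ((t / ε : ℝ) : AddCircle T)) volume :=
    (AddCircle.continuous_mk' T |>.comp (by fun_prop)).aestronglyMeasurable
  exact hc.comp_aestronglyMeasurable (hh.1.prodMk hm)

lemma integrable_periodMean {h : ℝ → C(AddCircle T, ℝ)} (hh : Integrable h) :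
    Integrable fun t => periodMean (h t) :=
  hh.norm.mono' (continuous_periodMean.comp_aestronglyMeasurable hh.1)
    (Eventually.of_forall fun _ => norm_periodMean_le _)

/-- Oscillating functions `t ↦ h(t, t/ε)` with `h` continuous and periodic in the second variable
converge weakly to their averages. -/
lemma tendsto_integral_eval {εs : ℕ → ℝ} (hpos : ∀ n, 0 < εs n)
    (hlim : Tendsto εs atTop (𝓝 0)) {h : ℝ → C(AddCircle T, ℝ)} (hh : Integrable h) :
    Tendsto (fun n => ∫ t, h t ((t / εs n : ℝ) : AddCircle T)) atTop
      (𝓝 (∫ t, periodMean (h t))) := by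
  -- Density in `L¹(ℝ; C(AddCircle T))`: an indicator times a fixed `c` is the separated case
  -- already treated, and both sides are contractions for the `L¹` norm, uniformly in `n`.
  refine Integrable.induction (P := fun h : ℝ → C(AddCircle T, ℝ) =>
    Tendsto (fun n => ∫ t, h t ((t / εs n : ℝ) : AddCircle T)) atTop
      (𝓝 (∫ t, periodMean (h t)))) ?_ ?_ ?_ ?_ hh
  · intro c s hs hμ
    have hv : Integrable (s.indicator fun _ : ℝ => (1 : ℝ)) :=
      (integrable_indicator_iff hs).2 (integrableOn_const hμ.ne)
    have := tendsto_integral_mul_eval hpos hlim _ hv c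
    rw [← integral_mul_const] at this
    have e : ∀ t : ℝ, periodMean (s.indicator (fun _ => c) t) =
        s.indicator (fun _ : ℝ => (1 : ℝ)) t * periodMean c := fun t => by
      by_cases ht : t ∈ s
      · simp [ht]
      · simp [ht, periodMean]
    simp only [e]
    refine this.congr fun n => integral_congr_ae (Eventually.of_forall fun t => ?_)
    by_cases ht : t ∈ s <;> simp [ht]
  · intro f g _ hf hg h1 h2
    have := h1.add h2
    rw [← integral_add (integrable_periodMean hf) (integrable_periodMean hg)] at this
    simp only [Pi.add_apply, periodMean_add]
    refine this.congr fun n => ?_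
    rw [← integral_add (integrable_eval hf _) (integrable_eval hg _)]
    rfl
  · refine isClosed_of_closure_subset fun f hf => ?_
    refine tendsto_of_forall_exists_approx fun δ hδ => ?_
    obtain ⟨g, hg, hdist⟩ := Metric.mem_closure_iff.1 hf δ hδ
    rw [dist_eq_norm, L1.norm_eq_integral_norm] at hdist
    have e : ∫ t, ‖(f - g) t‖ = ∫ t, ‖f t - g t‖ := by
      refine integral_congr_ae ?_
      filter_upwards [Lp.coeFn_sub f g] with t ht
      rw [ht, Pi.sub_apply]
    rw [e] at hdist
    have hf1 := L1.integrable_coeFn f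
    have hg1 := L1.integrable_coeFn g
    refine ⟨_, _, hg, fun n => ?_, ?_⟩
    · rw [← integral_sub (integrable_eval hf1 _) (integrable_eval hg1 _)]
      exact (norm_integral_le_of_norm_le (hf1.sub hg1).norm (Eventually.of_forall fun t =>
        (f t - g t).norm_coe_le_norm _)).trans hdist.le
    · rw [← integral_sub (integrable_periodMean hf1) (integrable_periodMean hg1)]
      refine (norm_integral_le_of_norm_le (hf1.sub hg1).norm (Eventually.of_forall fun t => ?_)).trans
        hdist.le
      rw [← periodMean_sub]
      exact norm_periodMean_le _
  · intro f g hfg _ hf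
    have e1 : ∫ t, periodMean (g t) = ∫ t, periodMean (f t) :=
      integral_congr_ae (hfg.mono fun t ht => by simp only [ht])
    rw [e1]
    exact hf.congr fun n => integral_congr_ae (hfg.mono fun t ht => by simp only [ht])

end Oscillation

/-! ### Weak solutions of `u' = a` on the half-line. -/

section DuBoisReymond

/-- A weak solution of `u' = a` on `(0, ∞)` with initial value `u₀` is the primitive of `a`. -/
lemma ae_eq_primitive_of_weak {u a : ℝ → ℝ} (hu : LocallyIntegrable u) (ha : LocallyIntegrable a)
    {u₀ : ℝ} (h : ∀ η : ℝ → ℝ, ContDiff ℝ 1 η → HasCompactSupport η →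
      η 0 * u₀ + ∫ t in Ioi (0 : ℝ), (deriv η t * u t + η t * a t) = 0) :
    ∀ᵐ t, 0 < t → u t = u₀ + ∫ τ in (0 : ℝ)..t, a τ := by
  have hai : ∀ x y, IntervalIntegrable a volume x y := fun x y =>
    (ha.integrableOn_isCompact isCompact_uIcc).intervalIntegrable
  set G : ℝ → ℝ := fun t => u₀ + ∫ τ in (0 : ℝ)..t, a τ with hG
  have hGc : Continuous G := continuous_const.add
    (intervalIntegral.continuous_primitive hai 0)
  have hloc : LocallyIntegrable (fun t => u t - G t) := hu.sub hGc.locallyIntegrable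
  have key := isOpen_Ioi.ae_eq_zero_of_integral_contDiff_smul_eq_zero (U := Ioi (0 : ℝ))
    (μ := volume) (hloc.locallyIntegrableOn _) ?_
  · filter_upwards [key] with t ht h0
    have := ht h0
    linarith
  intro g hg hgc hgs
  obtain ⟨R₀, hR₀⟩ := hgc.isCompact.isBounded.subset_closedBall 0
  set R : ℝ := max R₀ 1 with hR
  have hRpos : 0 < R := lt_of_lt_of_le one_pos (le_max_right _ _)
  have hgz : ∀ t, t ≤ 0 ∨ R < t → g t = 0 := by
    intro t ht
    refine image_eq_zero_of_notMem_tsupport fun hm => ?_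
    rcases ht with ht | ht
    · exact absurd (hgs hm) (not_lt.2 ht)
    · have := hR₀ hm
      rw [Metric.mem_closedBall, Real.dist_eq, sub_zero] at this
      have h2 := le_abs_self t
      have h3 := le_max_left R₀ 1
      linarith
  have hgcont : Continuous g := hg.continuous
  -- The test function is the primitive of `g` that vanishes for `t ≥ R`, so that the weak equation
  -- contains `∫ g u` and the initial term `η₀(0) u₀`.
  set η₀ : ℝ → ℝ := fun t => ∫ τ in R..t, g τ with hη₀
  have hη₀d : ∀ t, HasDerivAt η₀ (g t) t := fun t =>
    intervalIntegral.integral_hasDerivAt_right (hgcont.intervalIntegrable _ _)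
      (hgcont.stronglyMeasurableAtFilter _ _) hgcont.continuousAt
  have hη₀C : ContDiff ℝ 1 η₀ := by
    rw [contDiff_one_iff_deriv]
    refine ⟨fun t => (hη₀d t).differentiableAt, ?_⟩
    have : deriv η₀ = g := funext fun t => (hη₀d t).deriv
    rw [this]; exact hgcont
  have hη₀z : ∀ t, R ≤ t → η₀ t = 0 := by
    intro t ht
    refine intervalIntegral.integral_zero_ae (Eventually.of_forall fun x hx => ?_)
    rw [uIoc_of_le ht] at hx
    exact hgz x (Or.inr hx.1)
  -- `η₀` is constant, possibly nonzero, on `t ≤ 0`. The cut-off restores compact support without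
  -- changing `η₀` on a neighbourhood of `[0, ∞)`.
  let κ : ContDiffBump (0 : ℝ) := ⟨R + 1, R + 2, by linarith, by linarith⟩
  set η : ℝ → ℝ := fun t => κ t * η₀ t with hη
  have hηC : ContDiff ℝ 1 η := κ.contDiff.mul hη₀C
  have hηc : HasCompactSupport η := κ.hasCompactSupport.mul_right
  have hηe : ∀ t, -1 < t → η t = η₀ t := by
    intro t ht
    by_cases h1 : t ≤ R
    · have : κ t = 1 := κ.one_of_mem_closedBall (by
        rw [Metric.mem_closedBall, Real.dist_eq, sub_zero, abs_le]
        change -(R + 1) ≤ t ∧ t ≤ R + 1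
        constructor <;> linarith)
      rw [hη]; simp only [this, one_mul]
    · rw [hη]; simp only [hη₀z t (not_le.1 h1).le, mul_zero]
  have hηd : ∀ t, 0 < t → deriv η t = g t := by
    intro t ht
    have : η =ᶠ[𝓝 t] η₀ := by
      filter_upwards [Ioi_mem_nhds (by linarith : -1 < t)] with x hx using hηe x hx
    rw [this.deriv_eq, (hη₀d t).deriv]
  have H := h η hηC hηc
  rw [hηe 0 (by norm_num)] at H
  have H2 : ∫ t in Ioi (0 : ℝ), (deriv η t * u t + η t * a t) =
      ∫ t in (0 : ℝ)..R, (g t * u t + η₀ t * a t) := by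
    rw [intervalIntegral.integral_of_le hRpos.le]
    rw [← integral_indicator measurableSet_Ioi, ← integral_indicator measurableSet_Ioc]
    congr 1
    ext t
    by_cases h0 : 0 < t
    · rw [indicator_of_mem (show t ∈ Ioi (0 : ℝ) from h0), hηd t h0, hηe t (by linarith)]
      by_cases h1 : t ≤ R
      · rw [indicator_of_mem (show t ∈ Ioc 0 R from ⟨h0, h1⟩)]
      · rw [indicator_of_notMem (fun hm => h1 hm.2), hη₀z t (not_le.1 h1).le,
          hgz t (Or.inr (not_le.1 h1))]
        simp
    · rw [indicator_of_notMem (by simpa using h0), indicator_of_notMem (fun hm => h0 hm.1)]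
  rw [H2] at H
  have i1 : IntervalIntegrable (fun t => g t * u t) volume 0 R :=
    (hu.integrableOn_isCompact isCompact_uIcc).intervalIntegrable.continuousOn_mul hgcont.continuousOn
  have hη₀cont : Continuous η₀ := hη₀C.continuous
  have i2 : IntervalIntegrable (fun t => η₀ t * a t) volume 0 R :=
    (hai 0 R).continuousOn_mul hη₀cont.continuousOn
  rw [intervalIntegral.integral_add i1 i2] at H
  have hGac : AbsolutelyContinuousOnInterval G 0 R := by
    have c : AbsolutelyContinuousOnInterval (fun _ : ℝ => u₀) 0 R :=
      (contDiff_const (c := u₀) (n := 1)).contDiffOn.absolutelyContinuousOnInterval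
    exact c.add ((hai 0 R).absolutelyContinuousOnInterval_intervalIntegral (by simp))
  -- Integration by parts gives `∫ η₀ a = -η₀(0) u₀ - ∫ g G`. Inserted into the weak equation it
  -- leaves `∫ g (u - G) = 0`.
  have hIBP := AbsolutelyContinuousOnInterval.integral_mul_deriv_eq_deriv_mul
    (f := η₀) (g := G) (a := 0) (b := R) hη₀C.contDiffOn.absolutelyContinuousOnInterval hGac
  have e1 : ∫ t in (0 : ℝ)..R, η₀ t * deriv G t = ∫ t in (0 : ℝ)..R, η₀ t * a t := by
    refine intervalIntegral.integral_congr_ae ?_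
    filter_upwards [LocallyIntegrable.ae_hasDerivAt_integral ha] with t ht _
    rw [((ht 0).const_add u₀).deriv]
  have e2 : ∫ t in (0 : ℝ)..R, deriv η₀ t * G t = ∫ t in (0 : ℝ)..R, g t * G t :=
    intervalIntegral.integral_congr fun t _ => by simp only [(hη₀d t).deriv]
  rw [e1, e2, hη₀z R le_rfl] at hIBP
  have hG0 : G 0 = u₀ := by simp [hG]
  rw [hG0] at hIBP
  have i3 : IntervalIntegrable (fun t => g t * G t) volume 0 R :=
    (hgcont.mul hGc).intervalIntegrable _ _
  have e3 : ∫ t, g t • (u t - G t) = ∫ t in (0 : ℝ)..R, (g t * u t - g t * G t) := by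
    rw [intervalIntegral.integral_of_le hRpos.le, ← integral_indicator measurableSet_Ioc]
    congr 1
    ext t
    by_cases hm : t ∈ Ioc 0 R
    · rw [indicator_of_mem hm]; simp [mul_sub]
    · rw [indicator_of_notMem hm, hgz t]
      · simp
      · by_contra hc
        push Not at hc
        exact hm ⟨hc.1, hc.2⟩
  rw [e3, intervalIntegral.integral_sub i1 i3]
  linarith

end DuBoisReymond

/-! ### Mollification of `W^{1,∞}` potentials. -/

/-- A bounded continuous field `A` with a bounded measurable field `DA` of matrices such that
`(A, DA)` is the almost everywhere limit of a sequence `(Aₖ, ∂Aₖ)` of bounded `C¹` fields. -/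
structure IsSmoothLimit (A : E3 → E3) (DA : E3 → E3 →L[ℝ] E3) (C : ℝ) : Prop where
  continuous : Continuous A
  measurable : Measurable DA
  norm_le : ∀ x, ‖A x‖ ≤ C
  norm_deriv_le : ∀ x, ‖DA x‖ ≤ C
  exists_approx : ∃ Ak : ℕ → E3 → E3, (∀ k, ContDiff ℝ 1 (Ak k)) ∧ (∀ k x, ‖Ak k x‖ ≤ C) ∧
    (∀ k x, ‖fderiv ℝ (Ak k) x‖ ≤ C) ∧
    (∀ᵐ x, Tendsto (fun k => Ak k x) atTop (𝓝 (A x))) ∧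
    (∀ᵐ x, Tendsto (fun k => fderiv ℝ (Ak k) x) atTop (𝓝 (DA x)))

lemma ae_norm_le_of_memLp_top {X V : Type*} [MeasurableSpace X] [NormedAddCommGroup V]
    {μ : Measure X} {g : X → V} (hg : MemLp g ⊤ μ) :
    ∀ᵐ x ∂μ, ‖g x‖ ≤ (eLpNorm g ⊤ μ).toReal := by
  filter_upwards [ae_le_eLpNormEssSup (f := g) (μ := μ)] with x hx
  rw [eLpNorm_exponent_top]
  have h2 := hg.2.ne
  rw [eLpNorm_exponent_top] at h2
  rw [← toReal_enorm]
  exact ENNReal.toReal_mono h2 hx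

lemma locallyIntegrable_of_memLp_top {V : Type*} [NormedAddCommGroup V]
    {g : E3 → V} (hg : MemLp g ⊤ (volume : Measure E3)) : LocallyIntegrable g :=
  hg.locallyIntegrable le_top

lemma norm_convolution_normed_le {V : Type*} [NormedAddCommGroup V] [NormedSpace ℝ V]
    (φ : ContDiffBump (0 : E3)) {g : E3 → V} {C : ℝ} (hg : ∀ᵐ x, ‖g x‖ ≤ C) (x : E3) :
    ‖convolution (φ.normed volume) g (ContinuousLinearMap.lsmul ℝ ℝ) volume x‖ ≤ C := by
  rw [convolution_lsmul_swap]
  have hint : Integrable fun y => φ.normed volume (x - y) :=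
    (φ.integrable_normed (μ := (volume : Measure E3))).comp_sub_left x
  calc _ ≤ ∫ y, φ.normed volume (x - y) * C := by
        refine norm_integral_le_of_norm_le (hint.mul_const C) ?_
        filter_upwards [hg] with y hy
        rw [norm_smul, Real.norm_of_nonneg (φ.nonneg_normed _)]
        exact mul_le_mul_of_nonneg_left hy (φ.nonneg_normed _)
    _ = C := by
        rw [integral_mul_const, integral_sub_left_eq_self (fun y => φ.normed volume y),
          φ.integral_normed (μ := (volume : Measure E3)), one_mul]

/-- The derivative falls on the mollifier; the weak Jacobian identity tested with `y ↦ φ(x - y)`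
moves it onto `A`. The sign from differentiating in `y` cancels the sign of the weak derivative. -/
lemma hasFDerivAt_convolution_normed {A : E3 → E3} {DA : E3 → E3 →L[ℝ] E3} (hA : IsW1inf A DA)
    (φ : ContDiffBump (0 : E3)) (x : E3) :
    HasFDerivAt (convolution (φ.normed volume) A (ContinuousLinearMap.lsmul ℝ ℝ) volume)
      (convolution (φ.normed volume) DA (ContinuousLinearMap.lsmul ℝ ℝ) volume x) x := by
  have hlA := locallyIntegrable_of_memLp_top hA.bounded
  have hlD := locallyIntegrable_of_memLp_top hA.bounded_deriv
  have h := (φ.hasCompactSupport_normed (μ := volume)).hasFDerivAt_convolution_left (μ := volume)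
    (ContinuousLinearMap.lsmul ℝ ℝ) (φ.contDiff_normed (n := 1)) hlA x
  refine h.congr_fderiv (ContinuousLinearMap.ext fun v => ?_)
  have hc : HasCompactSupport (fderiv ℝ (φ.normed (volume : Measure E3))) :=
    φ.hasCompactSupport_normed.fderiv ℝ
  have hcf : Continuous (fderiv ℝ (φ.normed (volume : Measure E3))) :=
    (φ.contDiff_normed (n := 1)).continuous_fderiv (by simp)
  have ex1 := hc.convolutionExists_left
    (ContinuousLinearMap.precompL E3 (ContinuousLinearMap.lsmul ℝ ℝ)) hcf hlA x
  have ex2 := (φ.hasCompactSupport_normed (μ := volume)).convolutionExists_left (μ := volume)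
    (ContinuousLinearMap.lsmul ℝ ℝ) φ.continuous_normed hlD x
  have hw := hA.weak_deriv (fun y => φ.normed volume (x - y))
    (φ.contDiff_normed.comp (contDiff_const.sub contDiff_id))
    (φ.hasCompactSupport_normed.comp_homeomorph (Homeomorph.subLeft x)) v
  have hd : ∀ y, fderiv ℝ (fun y => φ.normed volume (x - y)) y v =
      - fderiv ℝ (φ.normed volume) (x - y) v := fun y => by
    have h1 := ((φ.contDiff_normed (n := 1) (μ := volume)).differentiable (by simp)
      (x - y)).hasFDerivAt.comp y ((hasFDerivAt_id y).const_sub x)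
    have h2 : (φ.normed volume ∘ HSub.hSub x) = fun y => φ.normed volume (x - y) := rfl
    rw [h2] at h1
    rw [h1.fderiv]; simp
  simp only [hd, neg_smul, integral_neg, neg_inj] at hw
  rw [convolution_eq_swap, convolution_eq_swap,
    ContinuousLinearMap.integral_apply, ContinuousLinearMap.integral_apply]
  · simpa using hw
  · exact ex2.integrable_swap
  · exact ex1.integrable_swap

/-- Mollification is an average, so it preserves the essential bounds, and it commutes with the weak
derivative. Lebesgue differentiation gives almost everywhere convergence of both the field and its
Jacobian; the bounded ratio of outer to inner radius is what it requires. -/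
lemma IsW1inf.exists_approx {A : E3 → E3} {DA : E3 → E3 →L[ℝ] E3} (hA : IsW1inf A DA) :
    ∃ C : ℝ, ∃ Ak : ℕ → E3 → E3, (∀ᵐ x, ‖A x‖ ≤ C) ∧ (∀ᵐ x, ‖DA x‖ ≤ C) ∧
      (∀ k, ContDiff ℝ 1 (Ak k)) ∧ (∀ k x, ‖Ak k x‖ ≤ C) ∧
      (∀ k x, ‖fderiv ℝ (Ak k) x‖ ≤ C) ∧
      (∀ᵐ x, Tendsto (fun k => Ak k x) atTop (𝓝 (A x))) ∧
      (∀ᵐ x, Tendsto (fun k => fderiv ℝ (Ak k) x) atTop (𝓝 (DA x))) := by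
  set C := max (eLpNorm A ⊤ volume).toReal (eLpNorm DA ⊤ volume).toReal with hC
  have h1 : ∀ᵐ x, ‖A x‖ ≤ C := (ae_norm_le_of_memLp_top hA.bounded).mono fun x hx =>
    hx.trans (le_max_left _ _)
  have h2 : ∀ᵐ x, ‖DA x‖ ≤ C := (ae_norm_le_of_memLp_top hA.bounded_deriv).mono fun x hx =>
    hx.trans (le_max_right _ _)
  have hlA := locallyIntegrable_of_memLp_top hA.bounded
  have hlD := locallyIntegrable_of_memLp_top hA.bounded_deriv
  let φ : ℕ → ContDiffBump (0 : E3) := fun k =>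
    ⟨1 / ((k : ℝ) + 1), 2 * (1 / ((k : ℝ) + 1)), by positivity, by
      have : 0 < 1 / ((k : ℝ) + 1) := by positivity
      linarith⟩
  have hφ : Tendsto (fun k => (φ k).rOut) atTop (𝓝 0) := by
    have := (tendsto_one_div_add_atTop_nhds_zero_nat (𝕜 := ℝ)).const_mul 2
    rwa [mul_zero] at this
  have hφ2 : ∀ᶠ k in atTop, (φ k).rOut ≤ 2 * (φ k).rIn := Eventually.of_forall fun k => le_rfl
  refine ⟨C, fun k => convolution ((φ k).normed volume) A (ContinuousLinearMap.lsmul ℝ ℝ) volume,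
    h1, h2, fun k => ?_, fun k => norm_convolution_normed_le _ h1, fun k x => ?_,
    ContDiffBump.ae_convolution_tendsto_right_of_locallyIntegrable hφ hφ2 hlA, ?_⟩
  · exact (φ k).hasCompactSupport_normed.contDiff_convolution_left _
      ((φ k).contDiff_normed (n := 1)) hlA
  · rw [(hasFDerivAt_convolution_normed hA (φ k) x).fderiv]
    exact norm_convolution_normed_le _ h2 x
  · simp only [(hasFDerivAt_convolution_normed hA (φ _) _).fderiv]
    exact ContDiffBump.ae_convolution_tendsto_right_of_locallyIntegrable hφ hφ2 hlD

/-- Replacing the values above the bound by zero turns an almost everywhere bound into one valid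
everywhere. -/
lemma exists_measurable_bounded_rep {X V : Type*} [MeasurableSpace X] [NormedAddCommGroup V]
    {μ : Measure X} {g : X → V} (hg : AEStronglyMeasurable g μ)
    {C : ℝ} (hC : 0 ≤ C) (hb : ∀ᵐ x ∂μ, ‖g x‖ ≤ C) :
    ∃ g' : X → V, StronglyMeasurable g' ∧ g' =ᵐ[μ] g ∧ ∀ x, ‖g' x‖ ≤ C := by
  have hs : MeasurableSet {x | ‖hg.mk g x‖ ≤ C} :=
    measurableSet_le hg.stronglyMeasurable_mk.norm.measurable measurable_const
  refine ⟨{x | ‖hg.mk g x‖ ≤ C}.indicator (hg.mk g), hg.stronglyMeasurable_mk.indicator hs, ?_, ?_⟩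
  · filter_upwards [hb, hg.ae_eq_mk] with x hx he
    rw [indicator_of_mem (show x ∈ {x | ‖hg.mk g x‖ ≤ C} by rw [mem_ofPred_eq, ← he]; exact hx), he]
  · intro x
    by_cases hx : x ∈ {x | ‖hg.mk g x‖ ≤ C}
    · rw [indicator_of_mem hx]; exact hx
    · rw [indicator_of_notMem hx]; simpa using hC

/-- A field in `W^{1,∞}` has a continuous representative that is a limit of smooth fields. -/
lemma IsW1inf.exists_isSmoothLimit {A : E3 → E3} {DA : E3 → E3 →L[ℝ] E3} (hA : IsW1inf A DA) :
    ∃ (A' : E3 → E3) (DA' : E3 → E3 →L[ℝ] E3) (C : ℝ), A' =ᵐ[volume] A ∧ DA' =ᵐ[volume] DA ∧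
      IsSmoothLimit A' DA' C := by
  obtain ⟨C, Ak, hb, hbD, hC1, hk, hkD, hl, hlD⟩ := hA.exists_approx
  have hC0 : 0 ≤ C := (norm_nonneg _).trans (hk 0 0)
  -- The mollified fields share the Lipschitz constant `C`, so `A` is Lipschitz on the set `S` where
  -- they converge. `S` has full measure, hence is dense, and the Lipschitz extension from `S` is
  -- the continuous representative.
  set S : Set E3 := {x | Tendsto (fun k => Ak k x) atTop (𝓝 (A x))} with hS
  have hlip : LipschitzOnWith ⟨C, hC0⟩ A S := by
    refine LipschitzOnWith.of_dist_le_mul fun x hx y hy => ?_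
    refine le_of_tendsto (hx.dist hy) (Eventually.of_forall fun k => ?_)
    exact (lipschitzWith_of_nnnorm_fderiv_le (C := ⟨C, hC0⟩)
      ((hC1 k).differentiable (by simp)) (fun x => hkD k x)).dist_le_mul x y
  obtain ⟨A', hA'l, hA'e⟩ := hlip.extend_finite_dimension
  have hd : Dense S := Measure.dense_of_ae hl
  have hae : A' =ᵐ[volume] A := hl.mono fun x hx => (hA'e hx).symm
  obtain ⟨DA', hDm, hDe, hDb⟩ := exists_measurable_bounded_rep hA.bounded_deriv.1 hC0 hbD
  refine ⟨A', DA', C, hae, hDe, hA'l.continuous, hDm.measurable, fun x => ?_, hDb, Ak, hC1, hk, hkD,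
    ?_, ?_⟩
  · have hcl : IsClosed {x | ‖A' x‖ ≤ C} := isClosed_le hA'l.continuous.norm continuous_const
    have : closure S ⊆ {x | ‖A' x‖ ≤ C} := hcl.closure_subset_iff.2 fun x hx => by
      rw [mem_ofPred_eq, ← hA'e hx]
      exact le_of_tendsto hx.norm (Eventually.of_forall fun k => hk k x)
    rw [hd.closure_eq] at this
    exact this (mem_univ x)
  · filter_upwards [hl, hae] with x hx he
    rwa [he]
  · filter_upwards [hlD, hDe] with x hx he
    rwa [he]

/-! ### Shears of phase space and their action on `L²`. -/

section Shear

variable {A : E3 → E3}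

/-- The shear `(x, p) ↦ (x, p + c A(x))`. -/
def shearMap (hA : Continuous A) (c : ℝ) : C(Phase, Phase) :=
  ⟨fun z => (z.1, z.2 + c • A z.1), by fun_prop⟩

lemma shearMap_apply (hA : Continuous A) (c : ℝ) (z : Phase) :
    shearMap hA c z = (z.1, z.2 + c • A z.1) := rfl

lemma shearMap_shearMap (hA : Continuous A) (c d : ℝ) (z : Phase) :
    shearMap hA c (shearMap hA d z) = shearMap hA (c + d) z := by
  simp only [shearMap_apply]
  rw [add_assoc, ← add_smul, add_comm d c]

lemma shearMap_zero (hA : Continuous A) (z : Phase) : shearMap hA 0 z = z := by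
  simp [shearMap_apply]

/-- The shear as a homeomorphism of the phase space. -/
def shearHomeomorph (hA : Continuous A) (c : ℝ) : Phase ≃ₜ Phase where
  toFun := shearMap hA c
  invFun := shearMap hA (-c)
  left_inv z := by rw [shearMap_shearMap, neg_add_cancel, shearMap_zero]
  right_inv z := by rw [shearMap_shearMap, add_neg_cancel, shearMap_zero]
  continuous_toFun := (shearMap hA c).continuous
  continuous_invFun := (shearMap hA (-c)).continuous

lemma continuous_shearMap (hA : Continuous A) : Continuous (shearMap hA) :=
  ContinuousMap.continuous_of_continuous_uncurry _ (by
    change Continuous fun q : ℝ × Phase => (q.2.1, q.2.2 + q.1 • A q.2.1)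
    fun_prop)

/-- For fixed `x` the shear translates `p`, which preserves Lebesgue measure; no regularity of `A`
beyond measurability matters for this. -/
lemma measurePreserving_shearMap (hA : Continuous A) (c : ℝ) :
    MeasurePreserving (shearMap hA c) (volume : Measure Phase) volume := by
  refine MeasurePreserving.skew_product (μa := (volume : Measure E3)) (μb := volume)
    (μc := (volume : Measure E3)) (μd := volume) (f := id)
    (g := fun x p => p + c • A x) (MeasurePreserving.id _) ?_ ?_
  · exact (by fun_prop : Continuous fun q : E3 × E3 => q.2 + c • A q.1).measurable
  · exact Eventually.of_forall fun x => (measurePreserving_add_right volume (c • A x)).map_eq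

lemma integral_shearMap (hA : Continuous A) (c : ℝ) (g : Phase → ℝ) :
    ∫ z, g (shearMap hA c z) = ∫ z, g z :=
  (measurePreserving_shearMap hA c).integral_comp
    (shearHomeomorph hA c).measurableEmbedding g

/-- The action of the shear `(x, p) ↦ (x, p + c A(x))` on `L²(ℝ³ × ℝ³)`. -/
def shearOp (hA : Continuous A) (c : ℝ) (g : L2Phase) : L2Phase :=
  Lp.compMeasurePreserving (shearMap hA c) (measurePreserving_shearMap hA c) g

lemma coeFn_shearOp (hA : Continuous A) (c : ℝ) (g : L2Phase) :
    shearOp hA c g =ᵐ[volume] fun z => g (shearMap hA c z) :=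
  Lp.coeFn_compMeasurePreserving g _

lemma norm_shearOp (hA : Continuous A) (c : ℝ) (g : L2Phase) : ‖shearOp hA c g‖ = ‖g‖ :=
  Lp.norm_compMeasurePreserving g _

lemma continuous_shearOp (hA : Continuous A) :
    Continuous fun q : ℝ × L2Phase => shearOp hA q.1 q.2 :=
  continuous_snd.compMeasurePreservingLp ((continuous_shearMap hA).comp continuous_fst) _ (by simp)

lemma shearOp_shearOp (hA : Continuous A) (c d : ℝ) (g : L2Phase) :
    shearOp hA c (shearOp hA d g) = shearOp hA (c + d) g := by
  apply Lp.ext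
  have h1 := (measurePreserving_shearMap hA c).quasiMeasurePreserving.ae_eq_comp
    (coeFn_shearOp hA d g)
  filter_upwards [coeFn_shearOp hA c (shearOp hA d g), coeFn_shearOp hA (c + d) g, h1]
    with z h2 h3 h4
  rw [h2, h3]
  simp only [Function.comp_apply] at h4
  rw [h4, shearMap_shearMap, add_comm]

lemma shearOp_zero (hA : Continuous A) (g : L2Phase) : shearOp hA 0 g = g := by
  apply Lp.ext
  filter_upwards [coeFn_shearOp hA 0 g] with z hz
  rw [hz, shearMap_zero]

lemma integral_shearOp_mul (hA : Continuous A) (c : ℝ) (g : L2Phase) (G : Phase → ℝ) :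
    ∫ z, shearOp hA c g z * G z = ∫ z, g z * G (shearMap hA (-c) z) := by
  rw [← integral_shearMap hA c (fun z => g z * G (shearMap hA (-c) z))]
  refine integral_congr_ae ?_
  filter_upwards [coeFn_shearOp hA c g] with z hz
  rw [hz, shearMap_shearMap, neg_add_cancel, shearMap_zero]

/-- The shears act as unitary operators, so the adjoint is the inverse shear. It serves to move an
oscillating shear from the solution to the test function. -/
lemma inner_shearOp (hA : Continuous A) (c : ℝ) (g h : L2Phase) :
    inner ℝ (shearOp hA c g) h = (inner ℝ g (shearOp hA (-c) h) : ℝ) := by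
  have e : ∀ g h : L2Phase, inner ℝ g h = ∫ z, g z * h z := fun g h => by
    rw [L2.inner_def]; simp [mul_comm]
  rw [e, e, integral_shearOp_mul]
  refine integral_congr_ae ?_
  filter_upwards [coeFn_shearOp hA (-c) h] with z hz
  rw [hz]

end Shear

/-! ### Compactly supported densities and dominated convergence. -/

section TestDensity

/-- The `L²` norm of the indicator function of a ball of the phase space. -/
def ballNorm (R : ℝ) : ℝ :=
  ‖indicatorConstLp 2 (μ := (volume : Measure Phase)) (s := Metric.closedBall 0 R)
    Metric.isClosed_closedBall.measurableSet (isCompact_closedBall 0 R).measure_lt_top.ne (1 : ℝ)‖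

lemma ballNorm_nonneg (R : ℝ) : 0 ≤ ballNorm R := norm_nonneg _

lemma memLp_of_bounded_support {g : Phase → ℝ} (hg : Measurable g) {κ R : ℝ}
    (hb : ∀ z, |g z| ≤ κ) (hs : ∀ z, R < ‖z‖ → g z = 0) : MemLp g 2 volume := by
  refine (memLp_indicator_const (μ := (volume : Measure Phase)) 2 (s := Metric.closedBall 0 R)
    Metric.isClosed_closedBall.measurableSet κ
    (Or.inr (isCompact_closedBall 0 R).measure_lt_top.ne)).mono hg.aestronglyMeasurable
    (Eventually.of_forall fun z => ?_)
  by_cases hz : z ∈ Metric.closedBall (0 : Phase) R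
  · rw [indicator_of_mem hz]
    exact (hb z).trans (le_abs_self κ)
  · rw [hs z (by simpa using hz)]; simp

lemma abs_integral_mul_le {g : Phase → ℝ} (hg : Measurable g) {κ R : ℝ}
    (hb : ∀ z, |g z| ≤ κ) (hs : ∀ z, R < ‖z‖ → g z = 0) (f : L2Phase) :
    |∫ z, f z * g z| ≤ ‖f‖ * (κ * ballNorm R) := by
  have hκ : 0 ≤ κ := (abs_nonneg _).trans (hb 0)
  have hm := memLp_of_bounded_support hg hb hs
  rw [integral_mul_eq_inner f hm]
  refine (abs_real_inner_le_norm _ _).trans ?_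
  gcongr
  rw [ballNorm]
  refine Lp.norm_le_mul_norm_of_ae_le_mul ?_
  filter_upwards [hm.coeFn_toLp, indicatorConstLp_coeFn (μ := (volume : Measure Phase)) (p := 2)
    (s := Metric.closedBall 0 R) (hs := Metric.isClosed_closedBall.measurableSet)
    (hμs := (isCompact_closedBall 0 R).measure_lt_top.ne) (c := (1 : ℝ))] with z h1 h2
  rw [h1, h2]
  by_cases hz : z ∈ Metric.closedBall (0 : Phase) R
  · rw [indicator_of_mem hz]
    simpa using hb z
  · rw [hs z (by simpa using hz), norm_zero]; positivity

/-- A measurable density `G(t, z)`, supported in a bounded set and bounded by a multiple of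
`H(t)`. -/
structure IsTestDensity (H : ℝ → ℝ) (R κ : ℝ) (G : ℝ → Phase → ℝ) : Prop where
  measurable : Measurable (Function.uncurry G)
  bound : ∀ t z, |G t z| ≤ κ * H t
  support_time : ∀ t z, R < |t| → G t z = 0
  support : ∀ t z, R < ‖z‖ → G t z = 0

variable {H : ℝ → ℝ} {R κ : ℝ} {G : ℝ → Phase → ℝ}

namespace IsTestDensity

lemma measurable_right (hG : IsTestDensity H R κ G) (t : ℝ) : Measurable (G t) :=
  hG.measurable.comp measurable_prodMk_left

lemma memLp (hG : IsTestDensity H R κ G) (t : ℝ) : MemLp (G t) 2 volume :=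
  memLp_of_bounded_support (hG.measurable_right t) (hG.bound t) (hG.support t)

lemma abs_pairing_le (hG : IsTestDensity H R κ G) (f : L2Phase) {M : ℝ} (hf : ‖f‖ ≤ M) (t : ℝ) :
    |∫ z, f z * G t z| ≤ (Icc (-R) R).indicator (fun t => M * (κ * H t * ballNorm R)) t := by
  by_cases ht : t ∈ Icc (-R) R
  · rw [indicator_of_mem ht]
    refine (abs_integral_mul_le (hG.measurable_right t) (hG.bound t) (hG.support t) f).trans ?_
    have := (abs_nonneg _).trans (hG.bound t 0)
    have := ballNorm_nonneg R
    gcongr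
  · rw [indicator_of_notMem ht]
    have h0 : ∀ z, G t z = 0 := fun z => hG.support_time t z (by
      rw [mem_Icc, ← abs_le, not_le] at ht; exact ht)
    simp [h0]

lemma integrable_bound (hH : LocallyIntegrable H) (R M κ : ℝ) :
    Integrable ((Icc (-R) R).indicator fun t => M * (κ * H t * ballNorm R)) := by
  rw [integrable_indicator_iff measurableSet_Icc]
  exact (((hH.integrableOn_isCompact isCompact_Icc).const_mul κ).mul_const _).const_mul M

lemma stronglyMeasurable_pairing (hG : IsTestDensity H R κ G) {F : ℝ → L2Phase}
    (hF : StronglyMeasurable F) : StronglyMeasurable fun t => ∫ z, F t z * G t z :=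
  stronglyMeasurable_integral_mul hF hG.measurable hG.memLp

lemma integrable_pairing (hG : IsTestDensity H R κ G) (hH : LocallyIntegrable H) {F : ℝ → L2Phase}
    (hF : StronglyMeasurable F) {M : ℝ} (hM : ∀ t, ‖F t‖ ≤ M) :
    Integrable fun t => ∫ z, F t z * G t z :=
  (integrable_bound hH R M κ).mono' (hG.stronglyMeasurable_pairing hF).aestronglyMeasurable
    (Eventually.of_forall fun t => hG.abs_pairing_le (F t) (hM t) t)

/-- Dominated convergence for the pairing with a sequence of test densities. -/
lemma tendsto_integral_pairing {Gk : ℕ → ℝ → Phase → ℝ} (hG : ∀ k, IsTestDensity H R κ (Gk k))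
    (hH : LocallyIntegrable H) {F : ℝ → L2Phase}
    (hF : StronglyMeasurable F) {M : ℝ} (hM : ∀ t, ‖F t‖ ≤ M) {G : ℝ → Phase → ℝ}
    (hlim : ∀ t, ∀ᵐ z, Tendsto (fun k => Gk k t z) atTop (𝓝 (G t z))) :
    Tendsto (fun k => ∫ t in Ioi (0 : ℝ), ∫ z, F t z * Gk k t z) atTop
      (𝓝 (∫ t in Ioi (0 : ℝ), ∫ z, F t z * G t z)) := by
  -- Dominated convergence is used twice: in `t` with an envelope proportional to `H`, and at fixed
  -- `t` in `z` with `|F|` times a constant on a ball.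
  refine tendsto_integral_of_dominated_convergence _
    (fun k => ((hG k).stronglyMeasurable_pairing hF).aestronglyMeasurable)
    (integrable_bound hH R M κ).integrableOn
    (fun k => Eventually.of_forall fun t => (hG k).abs_pairing_le (F t) (hM t) t)
    (Eventually.of_forall fun t => ?_)
  have hint : Integrable fun z => ‖F t z‖ *
      (Metric.closedBall (0 : Phase) R).indicator (fun _ => κ * H t) z :=
    (Lp.memLp (F t)).norm.integrable_mul (memLp_indicator_const (μ := (volume : Measure Phase)) 2
      Metric.isClosed_closedBall.measurableSet (κ * H t)
      (Or.inr (isCompact_closedBall 0 R).measure_lt_top.ne))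
  refine tendsto_integral_of_dominated_convergence _ (fun k => ?_) hint
    (fun k => Eventually.of_forall fun z => ?_) ?_
  · exact (Lp.aestronglyMeasurable _).mul ((hG k).measurable_right t).aestronglyMeasurable
  · rw [norm_mul]
    gcongr
    by_cases hz : z ∈ Metric.closedBall (0 : Phase) R
    · rw [indicator_of_mem hz]; exact (hG k).bound t z
    · rw [(hG k).support t z (by simpa using hz), norm_zero]
      exact indicator_nonneg (fun _ _ => (abs_nonneg _).trans ((hG k).bound t 0)) _
  · filter_upwards [hlim t] with z hz
    exact hz.const_mul _

end IsTestDensity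

end TestDensity

/-! ### Transport equations and their behaviour under shears. -/

/-- A measurable time-dependent vector field on the phase space, bounded by a multiple of `H(t)` on
bounded sets. -/
structure IsBoundedField (H : ℝ → ℝ) (K : ℝ → ℝ) (W : ℝ → Phase → Phase) : Prop where
  measurable : Measurable (Function.uncurry W)
  bound : ∀ R t z, ‖z‖ ≤ R → ‖W t z‖ ≤ K R * H t

/-- `f` is a weak solution of `∂ₜ f + W · ∇ f = 0` with initial value `fin`, for a divergence free
field `W`. -/
def IsTransportSolution (W : ℝ → Phase → Phase) (fin : Phase → ℝ) (f : ℝ → L2Phase) : Prop :=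
  ∀ φ : ℝ × Phase → ℝ, ContDiff ℝ 1 φ → HasCompactSupport φ →
    (∫ z : Phase, fin z * φ (0, z)) +
      ∫ t in Ioi (0 : ℝ), ∫ z : Phase, f t z * fderiv ℝ φ (t, z) (1, W t z) = 0

/-- The transport of the field `W` by the shears `(x, p) ↦ (x, p + c(t) A(x))`, in the old
variables. -/
def shearField (A : E3 → E3) (DA : E3 → E3 →L[ℝ] E3) (c : ℝ → ℝ) (W : ℝ → Phase → Phase)
    (t : ℝ) (z : Phase) : Phase :=
  ((W t z).1, (W t z).2 + deriv c t • A z.1 + c t • DA z.1 (W t z).1)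

lemma exists_closedBall_support {φ : ℝ × Phase → ℝ} (hφ : ContDiff ℝ 1 φ)
    (hc : HasCompactSupport φ) : ∃ R M : ℝ, 0 ≤ R ∧ 0 ≤ M ∧ (∀ q, R < ‖q‖ → φ q = 0) ∧
      (∀ q, R < ‖q‖ → fderiv ℝ φ q = 0) ∧ (∀ q, |φ q| ≤ M) ∧ ∀ q, ‖fderiv ℝ φ q‖ ≤ M := by
  obtain ⟨R, hR⟩ := hc.isCompact.isBounded.subset_closedBall 0
  have hcf : Continuous (fderiv ℝ φ) := hφ.continuous_fderiv (by simp)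
  obtain ⟨M, hM⟩ := hcf.bounded_above_of_compact_support (hc.fderiv ℝ)
  obtain ⟨M', hM'⟩ := hφ.continuous.bounded_above_of_compact_support hc
  have h0 : ∀ q, max R 0 < ‖q‖ → q ∉ tsupport φ := fun q hq hm => by
    have := hR hm
    rw [mem_closedBall_zero_iff] at this
    exact absurd ((le_max_left R 0).trans_lt hq) (not_lt.2 this)
  refine ⟨max R 0, max M' M, le_max_right _ _, ((norm_nonneg _).trans (hM 0)).trans (le_max_right _ _),
    fun q hq => image_eq_zero_of_notMem_tsupport (h0 q hq), fun q hq => ?_,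
    fun q => (hM' q).trans (le_max_left _ _), fun q => (hM q).trans (le_max_right _ _)⟩
  exact image_eq_zero_of_notMem_tsupport fun hm => h0 q hq (tsupport_fderiv_subset ℝ hm)

lemma tendsto_clm_apply {ι V V' : Type*} [NormedAddCommGroup V] [NormedSpace ℝ V]
    [NormedAddCommGroup V'] [NormedSpace ℝ V'] {l : Filter ι} {L : ι → V →L[ℝ] V'}
    {L₀ : V →L[ℝ] V'} {v : ι → V} {v₀ : V} (hL : Tendsto L l (𝓝 L₀)) (hv : Tendsto v l (𝓝 v₀)) :
    Tendsto (fun i => L i (v i)) l (𝓝 (L₀ v₀)) :=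
  (isBoundedBilinearMap_apply.continuous.tendsto (L₀, v₀)).comp (hL.prodMk_nhds hv)

section

variable {A : E3 → E3} {DA : E3 → E3 →L[ℝ] E3} {C : ℝ} {c : ℝ → ℝ} {W : ℝ → Phase → Phase}
  {H K : ℝ → ℝ}

lemma shearField_measurable (hAm : Measurable A) (hDm : Measurable DA) (hc : ContDiff ℝ 1 c)
    (hW : Measurable (Function.uncurry W)) :
    Measurable (Function.uncurry (shearField A DA c W)) := by
  have hcd : Continuous (deriv c) := hc.continuous_deriv le_rfl
  have h1 : Measurable fun q : ℝ × Phase => (W q.1 q.2).1 := hW.fst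
  have h2 : Measurable fun q : ℝ × Phase => (W q.1 q.2).2 := hW.snd
  have h3 : Measurable fun q : ℝ × Phase => A q.2.1 := hAm.comp (by fun_prop)
  have h4 : Measurable fun q : ℝ × Phase => DA q.2.1 := hDm.comp (by fun_prop)
  have h5 : Measurable fun q : ℝ × Phase => DA q.2.1 (W q.1 q.2).1 :=
    (by fun_prop : Continuous fun r : (E3 →L[ℝ] E3) × E3 => r.1 r.2).measurable.comp (h4.prodMk h1)
  have h6 : Measurable fun q : ℝ × Phase => deriv c q.1 := (hcd.comp continuous_fst).measurable
  have h7 : Measurable fun q : ℝ × Phase => c q.1 :=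
    (hc.continuous.comp continuous_fst).measurable
  exact h1.prodMk ((h2.add (h6.smul h3)).add (h7.smul h5))

lemma norm_shearField_le (hA : ∀ x, ‖A x‖ ≤ C) (hD : ∀ x, ‖DA x‖ ≤ C) {c₀ c₁ t : ℝ}
    (h0 : |c t| ≤ c₀) (h1 : |deriv c t| ≤ c₁) {z : Phase} {w : ℝ} (hw : ‖W t z‖ ≤ w) :
    ‖shearField A DA c W t z‖ ≤ w + c₁ * C + c₀ * (C * w) := by
  have hC : 0 ≤ C := (norm_nonneg _).trans (hA 0)
  have hc0 := (abs_nonneg _).trans h0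
  have hc1 := (abs_nonneg _).trans h1
  have hw0 := (norm_nonneg _).trans hw
  have a1 : ‖(W t z).1‖ ≤ w := (norm_fst_le _).trans hw
  have a2 : ‖(W t z).2‖ ≤ w := (norm_snd_le _).trans hw
  have a3 : ‖deriv c t • A z.1‖ ≤ c₁ * C := by
    rw [norm_smul]; exact mul_le_mul h1 (hA _) (norm_nonneg _) hc1
  have a4 : ‖c t • DA z.1 (W t z).1‖ ≤ c₀ * (C * w) := by
    rw [norm_smul]
    refine mul_le_mul h0 ?_ (norm_nonneg _) hc0
    exact (ContinuousLinearMap.le_opNorm _ _).trans (mul_le_mul (hD _) a1 (norm_nonneg _) hC)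
  refine (Prod.norm_def _).trans_le (max_le ?_ ?_)
  · refine a1.trans ?_
    have : 0 ≤ c₁ * C := by positivity
    have : 0 ≤ c₀ * (C * w) := by positivity
    linarith
  · exact (norm_add₃_le).trans (by linarith)

/-- Bounds on compact intervals for a `C¹` function and its derivative. -/
lemma exists_bound_C1 (hc : ContDiff ℝ 1 c) (R : ℝ) :
    ∃ c₀, 0 ≤ c₀ ∧ ∀ t, |t| ≤ R → |c t| ≤ c₀ ∧ |deriv c t| ≤ c₀ := by
  have hcd : Continuous (deriv c) := hc.continuous_deriv le_rfl
  obtain ⟨a, ha⟩ := (isCompact_Icc (a := -R) (b := R)).exists_bound_of_continuousOn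
    hc.continuous.continuousOn
  obtain ⟨b, hb⟩ := (isCompact_Icc (a := -R) (b := R)).exists_bound_of_continuousOn
    hcd.continuousOn
  refine ⟨max (max a b) 0, le_max_right _ _, fun t ht => ?_⟩
  have ht' : t ∈ Icc (-R) R := abs_le.1 ht
  exact ⟨(ha t ht').trans ((le_max_left a b).trans (le_max_left _ _)),
    (hb t ht').trans ((le_max_right a b).trans (le_max_left _ _))⟩

/-- A shear displaces the momentum by at most `c₀ C`, so test functions composed with shears have
supports in one ball for all potentials bounded by `C`. -/
lemma norm_le_of_shear (hA : ∀ x, ‖A x‖ ≤ C) {c₀ R t : ℝ} (h0 : |c t| ≤ c₀)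
    {z : Phase} (hz : ‖((t, z.1, z.2 + c t • A z.1) : ℝ × Phase)‖ ≤ R) : ‖z‖ ≤ R + c₀ * C := by
  have hC : 0 ≤ C := (norm_nonneg _).trans (hA 0)
  have hc0 := (abs_nonneg _).trans h0
  have hp : 0 ≤ c₀ * C := by positivity
  have h1 : ‖z.1‖ ≤ R := ((norm_fst_le _).trans (norm_snd_le _)).trans hz
  have h2 : ‖z.2 + c t • A z.1‖ ≤ R := ((norm_snd_le _).trans (norm_snd_le _)).trans hz
  have h3 : ‖c t • A z.1‖ ≤ c₀ * C := by
    rw [norm_smul]; exact mul_le_mul h0 (hA _) (norm_nonneg _) hc0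
  refine (Prod.norm_def _).trans_le (max_le (by linarith) ?_)
  calc ‖z.2‖ = ‖(z.2 + c t • A z.1) - c t • A z.1‖ := by rw [add_sub_cancel_right]
    _ ≤ _ := norm_sub_le _ _
    _ ≤ _ := by linarith

/-- The density appearing in the weak formulation, after a shear. The constants depend only on
bounds of the data. -/
lemma exists_isTestDensity_shear (hH : ∀ t, 1 ≤ H t) (hc : ContDiff ℝ 1 c) (hW : IsBoundedField H K W)
    (hC : 0 ≤ C) {φ : ℝ × Phase → ℝ} (hφ : ContDiff ℝ 1 φ) (hφc : HasCompactSupport φ) :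
    ∃ R κ : ℝ, 0 ≤ R ∧ ∀ (A : E3 → E3) (DA : E3 → E3 →L[ℝ] E3), Measurable A → Measurable DA →
      (∀ x, ‖A x‖ ≤ C) → (∀ x, ‖DA x‖ ≤ C) →
      (∀ t (z : Phase), φ (t, z.1, z.2 + c t • A z.1) ≠ 0 → |t| ≤ R ∧ ‖z‖ ≤ R) ∧
      IsTestDensity H R κ fun t z =>
        fderiv ℝ φ (t, z.1, z.2 + c t • A z.1) (1, shearField A DA c W t z) := by
  obtain ⟨R, M, hR, hM, hs, hsd, -, hMd⟩ := exists_closedBall_support hφ hφc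
  obtain ⟨c₀, hc₀, hcb⟩ := exists_bound_C1 hc R
  set R' := R + c₀ * C with hR'
  have hp : 0 ≤ c₀ * C := by positivity
  -- The summands bound the time component, `W`, `c' A` and `c DA W`. The terms without a factor `H`
  -- are absorbed because `H ≥ 1`.
  set κ := M * (1 + |K R'| + c₀ * C + c₀ * (C * |K R'|)) with hκ
  have hκ0 : 0 ≤ κ := by positivity
  refine ⟨R', κ, by positivity, fun A DA hAm hDm hA hD => ?_⟩
  have hsupp : ∀ t (z : Phase), ‖((t, z.1, z.2 + c t • A z.1) : ℝ × Phase)‖ ≤ R →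
      |t| ≤ R ∧ ‖z‖ ≤ R' := fun t z hz => by
    have ht : |t| ≤ R := (norm_fst_le _).trans hz
    exact ⟨ht, norm_le_of_shear hA (hcb t ht).1 hz⟩
  have hzero : ∀ t (z : Phase), ¬ (|t| ≤ R ∧ ‖z‖ ≤ R') →
      fderiv ℝ φ (t, z.1, z.2 + c t • A z.1) = 0 := fun t z hz =>
    hsd _ (not_le.1 fun h => hz (hsupp t z h))
  refine ⟨fun t z hz => ?_, ?_, fun t z => ?_, fun t z ht => ?_, fun t z hz => ?_⟩
  · have := hsupp t z (not_lt.1 fun h => hz (hs _ h))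
    exact ⟨this.1.trans (by linarith), this.2⟩
  · have hm := shearField_measurable hAm hDm hc hW.measurable
    have hcf : Continuous (fderiv ℝ φ) := hφ.continuous_fderiv (by simp)
    have hcc := hc.continuous
    have hm1 : Measurable fun q : ℝ × Phase => ((q.1, q.2.1, q.2.2 + c q.1 • A q.2.1) : ℝ × Phase) := by
      have h3 : Measurable fun q : ℝ × Phase => A q.2.1 := hAm.comp (by fun_prop)
      have h7 : Measurable fun q : ℝ × Phase => c q.1 := (hcc.comp continuous_fst).measurable
      exact measurable_fst.prodMk ((by fun_prop : Measurable fun q : ℝ × Phase => q.2.1).prodMk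
        ((by fun_prop : Measurable fun q : ℝ × Phase => q.2.2).add (h7.smul h3)))
    exact (by fun_prop : Continuous fun r : (ℝ × Phase →L[ℝ] ℝ) × (ℝ × Phase) =>
      r.1 r.2).measurable.comp ((hcf.measurable.comp hm1).prodMk (measurable_const.prodMk hm))
  · have hHt := hH t
    by_cases hz : |t| ≤ R ∧ ‖z‖ ≤ R'
    · obtain ⟨ht, hz⟩ := hz
      have hw : ‖W t z‖ ≤ |K R'| * H t := (hW.bound R' t z hz).trans (by gcongr; exact le_abs_self _)
      have hsf := norm_shearField_le hA hD (hcb t ht).1 (hcb t ht).2 hw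
      rw [← Real.norm_eq_abs]
      refine (ContinuousLinearMap.le_opNorm _ _).trans ?_
      rw [hκ, mul_assoc]
      refine mul_le_mul (hMd _) ?_ (norm_nonneg _) hM
      refine (Prod.norm_def _).trans_le (max_le ?_ (hsf.trans ?_))
      · rw [norm_one]
        have : 0 ≤ |K R'| + c₀ * C + c₀ * (C * |K R'|) := by positivity
        nlinarith
      · have : (0 : ℝ) ≤ c₀ * C * (H t - 1) := mul_nonneg hp (by linarith)
        nlinarith
    · rw [hzero t z hz]
      simp only [zero_apply, abs_zero]
      positivity
  · rw [hzero t z (fun h => by linarith [h.1])]; rfl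
  · rw [hzero t z (fun h => by linarith [h.2])]; rfl

/-- The chain rule, which is the origin of `shearField`: moving with velocity `(1, W)` changes `p +
c B` by `W₂ + c' B + c ∂B W₁`. -/
lemma hasFDerivAt_comp_shear {B : E3 → E3} (hB : ContDiff ℝ 1 B) (hc : ContDiff ℝ 1 c)
    {φ : ℝ × Phase → ℝ} (hφ : ContDiff ℝ 1 φ) (t : ℝ) (z : Phase) :
    fderiv ℝ (fun q : ℝ × Phase => φ (q.1, q.2.1, q.2.2 + c q.1 • B q.2.1)) (t, z) (1, W t z) =
      fderiv ℝ φ (t, z.1, z.2 + c t • B z.1)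
        (1, shearField B (fun x => fderiv ℝ B x) c W t z) := by
  have d1 : HasFDerivAt (fun q : ℝ × Phase => q.1) (ContinuousLinearMap.fst ℝ ℝ Phase) (t, z) :=
    hasFDerivAt_fst
  have d2 : HasFDerivAt (fun q : ℝ × Phase => q.2) (ContinuousLinearMap.snd ℝ ℝ Phase) (t, z) :=
    hasFDerivAt_snd
  have dB := ((hB.differentiable (by simp) z.1).hasFDerivAt).comp (t, z) d2.fst
  have dc := ((hc.differentiable (by simp) t).hasDerivAt).comp_hasFDerivAt (t, z) d1
  have dφ := ((hφ.differentiable (by simp) (t, z.1, z.2 + c t • B z.1)).hasFDerivAt).comp (t, z)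
    (d1.prodMk (d2.fst.prodMk (d2.snd.add (dc.smul dB))))
  have e : (fun q : ℝ × Phase => φ (q.1, q.2.1, q.2.2 + c q.1 • B q.2.1)) =
    φ ∘ (fun q : ℝ × Phase => (q.1, q.2.1, q.2.2 + c q.1 • B q.2.1)) := rfl
  rw [e]
  erw [dφ.fderiv]
  simp only [shearField, Function.comp_apply, ContinuousLinearMap.comp_apply,
    ContinuousLinearMap.prod_apply, ContinuousLinearMap.coe_fst', ContinuousLinearMap.coe_snd',
    add_apply, smul_apply, ContinuousLinearMap.smulRight_apply, smul_eq_mul, mul_one]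
  rw [add_assoc, add_comm (deriv c t • _)]

variable {f : ℝ → L2Phase} {fin : Phase → ℝ} {M : ℝ}

/-- A weak solution may be tested against the composition of a `C¹` function with the shears
`(x, p) ↦ (x, p + c(t) A(x))`. -/
lemma IsTransportSolution.integral_shear (h : IsTransportSolution W fin f)
    (hS : IsSmoothLimit A DA C) (hc : ContDiff ℝ 1 c) (hW : IsBoundedField H K W)
    (hH : ∀ t, 1 ≤ H t) (hHl : LocallyIntegrable H) (hf : StronglyMeasurable f)
    (hM : ∀ t, ‖f t‖ ≤ M) (hfin : MemLp fin 2 volume) {φ : ℝ × Phase → ℝ} (hφ : ContDiff ℝ 1 φ)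
    (hφc : HasCompactSupport φ) :
    (∫ z : Phase, fin z * φ (0, shearMap hS.continuous (c 0) z)) +
      ∫ t in Ioi (0 : ℝ), ∫ z : Phase, f t z *
        fderiv ℝ φ (t, shearMap hS.continuous (c t) z) (1, shearField A DA c W t z) = 0 := by
  have hC : 0 ≤ C := (norm_nonneg _).trans (hS.norm_le 0)
  obtain ⟨R, κ, hR, hG⟩ := exists_isTestDensity_shear hH hc hW hC hφ hφc
  obtain ⟨Ak, hk1, hkb, hkd, hkl, hkdl⟩ := hS.exists_approx
  have hkm : ∀ k, Measurable (Ak k) := fun k => (hk1 k).continuous.measurable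
  have hkdm : ∀ k, Measurable fun x => fderiv ℝ (Ak k) x := fun k =>
    ((hk1 k).continuous_fderiv (by simp)).measurable
  have hGk := fun k => hG (Ak k) _ (hkm k) (hkdm k) (hkb k) (hkd k)
  have hzl : ∀ᵐ z : Phase, Tendsto (fun k => Ak k z.1) atTop (𝓝 (A z.1)) :=
    Measure.quasiMeasurePreserving_fst.ae hkl
  have hzdl : ∀ᵐ z : Phase, Tendsto (fun k => fderiv ℝ (Ak k) z.1) atTop (𝓝 (DA z.1)) :=
    Measure.quasiMeasurePreserving_fst.ae hkdl
  -- With the smooth field `Ak k` the sheared `φ` is an admissible `C¹` test function. The constants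
  -- `R` and `κ` were fixed before the potential, so they dominate uniformly as `k → ∞`.
  have key : ∀ k, (∫ z : Phase, fin z * φ (0, z.1, z.2 + c 0 • Ak k z.1)) +
      ∫ t in Ioi (0 : ℝ), ∫ z : Phase, f t z * fderiv ℝ φ (t, z.1, z.2 + c t • Ak k z.1)
        (1, shearField (Ak k) (fun x => fderiv ℝ (Ak k) x) c W t z) = 0 := by
    intro k
    have hAk := hk1 k
    have := h (fun q : ℝ × Phase => φ (q.1, q.2.1, q.2.2 + c q.1 • Ak k q.2.1)) ?_ ?_
    · simpa only [hasFDerivAt_comp_shear hAk hc hφ] using this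
    · exact hφ.comp (contDiff_fst.prodMk ((contDiff_fst.comp contDiff_snd).prodMk
        ((contDiff_snd.comp contDiff_snd).add ((hc.comp contDiff_fst).smul
          (hAk.comp (contDiff_fst.comp contDiff_snd))))))
    · refine HasCompactSupport.intro (isCompact_closedBall 0 R) fun q hq => ?_
      by_contra hne
      have := (hGk k).1 q.1 q.2 hne
      refine hq ?_
      rw [mem_closedBall_zero_iff]
      exact (Prod.norm_def _).trans_le (max_le this.1 this.2)
  have hl2 := IsTestDensity.tendsto_integral_pairing (fun k => (hGk k).2) hHl hf hM
    (G := fun t z => fderiv ℝ φ (t, shearMap hS.continuous (c t) z) (1, shearField A DA c W t z)) (by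
      intro t
      filter_upwards [hzl, hzdl] with z h1 h2
      have hcf : Continuous (fderiv ℝ φ) := hφ.continuous_fderiv (by simp)
      have a1 : Tendsto (fun k => z.2 + c t • Ak k z.1) atTop (𝓝 (z.2 + c t • A z.1)) :=
        (h1.const_smul _).const_add _
      have a2 : Tendsto (fun k => shearField (Ak k) (fun x => fderiv ℝ (Ak k) x) c W t z) atTop
          (𝓝 (shearField A DA c W t z)) := by
        refine Tendsto.prodMk_nhds tendsto_const_nhds (Tendsto.add ((h1.const_smul _).const_add _) ?_)
        exact (tendsto_clm_apply h2 tendsto_const_nhds).const_smul _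
      have a3 := (hcf.tendsto _).comp
        ((tendsto_const_nhds (x := t)).prodMk_nhds ((tendsto_const_nhds (x := z.1)).prodMk_nhds a1))
      exact tendsto_clm_apply a3 (tendsto_const_nhds.prodMk_nhds a2))
  have hl1 : Tendsto (fun k => ∫ z : Phase, fin z * φ (0, z.1, z.2 + c 0 • Ak k z.1)) atTop
      (𝓝 (∫ z : Phase, fin z * φ (0, shearMap hS.continuous (c 0) z))) := by
    obtain ⟨-, M', -, hM', -, -, hφM, -⟩ := exists_closedBall_support hφ hφc
    have hint : Integrable fun z => ‖fin z‖ *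
        (Metric.closedBall (0 : Phase) R).indicator (fun _ => M') z :=
      hfin.norm.integrable_mul (memLp_indicator_const (μ := (volume : Measure Phase)) 2
        Metric.isClosed_closedBall.measurableSet M'
        (Or.inr (isCompact_closedBall 0 R).measure_lt_top.ne))
    refine tendsto_integral_of_dominated_convergence _ (fun k => ?_) hint
      (fun k => Eventually.of_forall fun z => ?_) ?_
    · refine hfin.1.mul (Continuous.aestronglyMeasurable ?_)
      have := (hk1 k).continuous
      have := hφ.continuous
      fun_prop
    · rw [norm_mul]
      gcongr
      by_cases hz : z ∈ Metric.closedBall (0 : Phase) R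
      · rw [indicator_of_mem hz]; exact hφM _
      · have : φ (0, z.1, z.2 + c 0 • Ak k z.1) = 0 := by
          by_contra hne
          exact hz (by simpa using ((hGk k).1 0 z hne).2)
        rw [this, norm_zero]
        exact indicator_nonneg (fun _ _ => hM') _
    · filter_upwards [hzl] with z h1
      have a1 : Tendsto (fun k => z.2 + c 0 • Ak k z.1) atTop (𝓝 (z.2 + c 0 • A z.1)) :=
        (h1.const_smul _).const_add _
      exact ((hφ.continuous.tendsto _).comp
        ((tendsto_const_nhds (x := (0 : ℝ))).prodMk_nhds
          ((tendsto_const_nhds (x := z.1)).prodMk_nhds a1))).const_mul _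
  have := hl1.add hl2
  simp only [key] at this
  exact (tendsto_nhds_unique this tendsto_const_nhds)

/-- The shears `(x, p) ↦ (x, p + c(t) A(x))` map weak solutions to weak solutions. -/
lemma IsTransportSolution.shear (h : IsTransportSolution W fin f)
    (hS : IsSmoothLimit A DA C) (hc : ContDiff ℝ 1 c) (hW : IsBoundedField H K W)
    (hH : ∀ t, 1 ≤ H t) (hHl : LocallyIntegrable H) (hf : StronglyMeasurable f)
    (hM : ∀ t, ‖f t‖ ≤ M) (hfin : MemLp fin 2 volume) :
    IsTransportSolution (fun t z => shearField A DA c W t (shearMap hS.continuous (-c t) z))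
      (fun z => fin (shearMap hS.continuous (-c 0) z))
      (fun t => shearOp hS.continuous (-c t) (f t)) := by
  intro φ hφ hφc
  refine Eq.trans ?_ (h.integral_shear hS hc hW hH hHl hf hM hfin hφ hφc)
  congr 1
  · rw [← integral_shearMap hS.continuous (-c 0)
      (fun z => fin z * φ (0, shearMap hS.continuous (c 0) z))]
    simp only [shearMap_shearMap, add_neg_cancel, shearMap_zero]
  · simp only [integral_shearOp_mul, shearMap_shearMap, neg_neg, neg_add_cancel, shearMap_zero]

end

/-! ### Diagonal extraction with a common modulus of continuity. -/

section Extraction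

/-- Diagonal extraction for countably many sequences of functions on `[0, ∞)` with a common modulus
of continuity. -/
lemma exists_subseq_tendsto {ι : Type*} [Countable ι] {g : ℕ → ι → ℝ → ℝ} {b κ : ι → ℝ} {P : ℝ → ℝ}
    (hP : Continuous P) (h0 : ∀ n j, |g n j 0| ≤ b j)
    (hg : ∀ n j s t, 0 ≤ s → 0 ≤ t → |g n j t - g n j s| ≤ κ j * |P t - P s|) :
    ∃ ns : ℕ → ℕ, StrictMono ns ∧
      ∀ j t, 0 ≤ t → ∃ l, Tendsto (fun k => g (ns k) j t) atTop (𝓝 l) := by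
  -- The values at rational times lie in a countable product of intervals, compact by Tychonoff. The
  -- maximum with `0` keeps the rational times in `[0, ∞)`, where the modulus is assumed.
  let B : ι × ℚ → ℝ := fun q => b q.1 + κ q.1 * |P (max (q.2 : ℝ) 0) - P 0|
  have hcomp : IsCompact (Set.pi univ fun q : ι × ℚ => Icc (-B q) (B q)) :=
    isCompact_univ_pi fun _ => isCompact_Icc
  obtain ⟨l, -, ns, hns, hl⟩ := hcomp.tendsto_subseq
    (x := fun n (q : ι × ℚ) => g n q.1 (max (q.2 : ℝ) 0)) (fun n => by
      rw [mem_univ_pi]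
      intro q
      rw [mem_Icc, ← abs_le]
      have h1 := hg n q.1 0 (max (q.2 : ℝ) 0) le_rfl (le_max_right _ _)
      calc |g n q.1 (max (q.2 : ℝ) 0)|
          = |g n q.1 0 + (g n q.1 (max (q.2 : ℝ) 0) - g n q.1 0)| := by congr 1; ring
        _ ≤ _ := abs_add_le _ _
        _ ≤ _ := add_le_add (h0 n q.1) h1)
  rw [tendsto_pi_nhds] at hl
  refine ⟨ns, hns, fun j t ht => cauchySeq_tendsto_of_complete ?_⟩
  rw [Metric.cauchySeq_iff']
  intro δ hδ
  have hκ : 0 < |κ j| + 1 := by positivity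
  have hQ : Continuous fun s : ℝ => P t - P (max s 0) := by fun_prop
  have hopen : IsOpen {s : ℝ | |P t - P (max s 0)| < δ / (4 * (|κ j| + 1))} :=
    isOpen_lt hQ.abs continuous_const
  have hmem : t ∈ {s : ℝ | |P t - P (max s 0)| < δ / (4 * (|κ j| + 1))} := by
    rw [mem_ofPred_eq, max_eq_left ht, sub_self, abs_zero]; positivity
  obtain ⟨q, hq⟩ := Rat.denseRange_cast (𝕜 := ℝ).exists_mem_open hopen ⟨t, hmem⟩
  rw [mem_ofPred_eq] at hq
  have hb : ∀ n, |g n j t - g n j (max (q : ℝ) 0)| ≤ δ / 4 := by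
    intro n
    refine (hg n j _ _ (le_max_right _ _) ht).trans ?_
    calc κ j * |P t - P (max (q : ℝ) 0)| ≤ (|κ j| + 1) * (δ / (4 * (|κ j| + 1))) := by
          gcongr
          exact (le_abs_self _).trans (by linarith)
      _ = δ / 4 := by field_simp
  obtain ⟨N, hN⟩ := Metric.cauchySeq_iff'.1 (hl (j, q)).cauchySeq (δ / 4) (by linarith)
  refine ⟨N, fun n hn => ?_⟩
  have h1 := hN n hn
  have h2 := hb (ns n)
  have h3 := hb (ns N)
  rw [Real.dist_eq] at h1 ⊢
  simp only [Function.comp_apply] at h1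
  rw [abs_lt] at h1 ⊢
  rw [abs_le] at h2 h3
  constructor <;> linarith

end Extraction

/-! ### Weak compactness at almost every time. -/

section Compactness

variable {H K : ℝ → ℝ} {W : ℝ → Phase → Phase} {f : ℝ → L2Phase} {fin : Phase → ℝ} {M : ℝ}

lemma exists_closedBall_support_phase {χ : Phase → ℝ} (hχ : ContDiff ℝ 1 χ)
    (hc : HasCompactSupport χ) : ∃ R M : ℝ, 0 ≤ M ∧ (∀ z, R < ‖z‖ → χ z = 0) ∧
      (∀ z, R < ‖z‖ → fderiv ℝ χ z = 0) ∧ (∀ z, |χ z| ≤ M) ∧ ∀ z, ‖fderiv ℝ χ z‖ ≤ M := by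
  obtain ⟨R, hR⟩ := hc.isCompact.isBounded.subset_closedBall 0
  have hcf : Continuous (fderiv ℝ χ) := hχ.continuous_fderiv (by simp)
  obtain ⟨M, hM⟩ := hcf.bounded_above_of_compact_support (hc.fderiv ℝ)
  obtain ⟨M', hM'⟩ := hχ.continuous.bounded_above_of_compact_support hc
  have h0 : ∀ q, R < ‖q‖ → q ∉ tsupport χ := fun q hq hm => by
    have := hR hm
    rw [mem_closedBall_zero_iff] at this
    exact absurd hq (not_lt.2 this)
  refine ⟨R, max M' M, ((norm_nonneg _).trans (hM 0)).trans (le_max_right _ _),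
    fun q hq => image_eq_zero_of_notMem_tsupport (h0 q hq), fun q hq => ?_,
    fun q => (hM' q).trans (le_max_left _ _), fun q => (hM q).trans (le_max_right _ _)⟩
  exact image_eq_zero_of_notMem_tsupport fun hm => h0 q hq (tsupport_fderiv_subset ℝ hm)

lemma measurable_fderiv_field {χ : Phase → ℝ} (hχ : ContDiff ℝ 1 χ)
    (hW : Measurable (Function.uncurry W)) :
    Measurable (Function.uncurry fun t z => fderiv ℝ χ z (W t z)) := by
  have hcf : Continuous (fderiv ℝ χ) := hχ.continuous_fderiv (by simp)
  exact (by fun_prop : Continuous fun r : (Phase →L[ℝ] ℝ) × Phase => r.1 r.2).measurable.comp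
    ((hcf.measurable.comp measurable_snd).prodMk hW)

/-- The moments `t ↦ ∫ f(t) χ` of a weak solution are primitives. -/
lemma IsTransportSolution.moment_eq (h : IsTransportSolution W fin f) (hW : IsBoundedField H K W)
    (hHl : LocallyIntegrable H) (hf : StronglyMeasurable f) (hM : ∀ t, ‖f t‖ ≤ M)
    {χ : Phase → ℝ} (hχ : ContDiff ℝ 1 χ) {R κ : ℝ} (hκ : 0 ≤ κ) (hs : ∀ z, R < ‖z‖ → χ z = 0)
    (hsd : ∀ z, R < ‖z‖ → fderiv ℝ χ z = 0) (hb : ∀ z, |χ z| ≤ κ) (hbd : ∀ z, ‖fderiv ℝ χ z‖ ≤ κ) :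
    ∃ a : ℝ → ℝ, LocallyIntegrable a ∧
      (∀ t, |a t| ≤ M * (κ * (|K R| * |H t|) * ballNorm R)) ∧
      ∀ᵐ t, 0 < t → ∫ z, f t z * χ z = (∫ z, fin z * χ z) + ∫ τ in (0 : ℝ)..t, a τ := by
  have hM0 : 0 ≤ M := (norm_nonneg _).trans (hM 0)
  have hmeas := measurable_fderiv_field hχ hW.measurable
  have hGb : ∀ t z, |fderiv ℝ χ z (W t z)| ≤ κ * (|K R| * |H t|) := by
    intro t z
    by_cases hz : ‖z‖ ≤ R
    · rw [← Real.norm_eq_abs]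
      refine (ContinuousLinearMap.le_opNorm _ _).trans ?_
      refine mul_le_mul (hbd z) ?_ (norm_nonneg _) hκ
      refine (hW.bound R t z hz).trans ?_
      rw [← abs_mul]
      exact le_abs_self _
    · rw [hsd z (not_le.1 hz)]
      simp only [zero_apply, abs_zero]
      positivity
  have hGs : ∀ t z, R < ‖z‖ → fderiv ℝ χ z (W t z) = 0 := fun t z hz => by
    rw [hsd z hz]; rfl
  have hGm : ∀ t, Measurable fun z => fderiv ℝ χ z (W t z) := fun t =>
    hmeas.comp measurable_prodMk_left
  have hG2 : ∀ t, MemLp (fun z => fderiv ℝ χ z (W t z)) 2 volume := fun t =>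
    memLp_of_bounded_support (hGm t) (hGb t) (hGs t)
  have hχ2 : MemLp χ 2 volume := memLp_of_bounded_support hχ.continuous.measurable hb hs
  set a : ℝ → ℝ := fun t => ∫ z, f t z * fderiv ℝ χ z (W t z) with ha
  set u : ℝ → ℝ := fun t => ∫ z, f t z * χ z with hu
  have hab : ∀ t, |a t| ≤ M * (κ * (|K R| * |H t|) * ballNorm R) := fun t => by
    refine (abs_integral_mul_le (hGm t) (hGb t) (hGs t) (f t)).trans ?_
    have := ballNorm_nonneg R
    gcongr
    exact hM t
  have hal : LocallyIntegrable a := by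
    have h1 : LocallyIntegrable fun t => M * (κ * (|K R| * |H t|) * ballNorm R) := by
      intro x
      obtain ⟨s, hs, hi⟩ := hHl x
      exact ⟨s, hs, (((hi.norm.const_mul _).const_mul _).mul_const _).const_mul _⟩
    exact h1.mono (stronglyMeasurable_integral_mul hf hmeas hG2).aestronglyMeasurable
      (Eventually.of_forall fun t => (hab t).trans (le_abs_self _))
  have hul : LocallyIntegrable u := by
    refine (locallyIntegrable_const (M * (κ * ballNorm R))).mono
      (stronglyMeasurable_integral_mul (G := fun _ => χ) hf
        (hχ.continuous.measurable.comp measurable_snd) (fun _ => hχ2)).aestronglyMeasurable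
      (Eventually.of_forall fun t => ?_)
    refine ((abs_integral_mul_le hχ.continuous.measurable hb hs (f t)).trans ?_).trans (le_abs_self _)
    have := ballNorm_nonneg R
    gcongr
    exact hM t
  refine ⟨a, hal, hab, ae_eq_primitive_of_weak hul hal fun η hη hηc => ?_⟩
  have hfd : ∀ t z w, fderiv ℝ (fun q : ℝ × Phase => η q.1 * χ q.2) (t, z) (1, w) =
      deriv η t * χ z + η t * fderiv ℝ χ z w := by
    intro t z w
    have d1 := ((hη.differentiable (by simp) t).hasDerivAt).comp_hasFDerivAt (t, z)
      (hasFDerivAt_fst (𝕜 := ℝ) (E := ℝ) (F := Phase) (p := (t, z)))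
    have d2 := ((hχ.differentiable (by simp) z).hasFDerivAt).comp (t, z)
      (hasFDerivAt_snd (𝕜 := ℝ) (E := ℝ) (F := Phase) (p := (t, z)))
    have d3 := d1.mul d2
    have e : (fun q : ℝ × Phase => η q.1 * χ q.2) =
      (η ∘ Prod.fst) * (χ ∘ Prod.snd) := rfl
    rw [e, d3.fderiv]
    simp
    ring
  -- Testing with the product `η(t) χ(z)` says that the moment satisfies `u' = a` weakly on the
  -- half-line.
  have key := h (fun q : ℝ × Phase => η q.1 * χ q.2)
    ((hη.comp contDiff_fst).mul (hχ.comp contDiff_snd)) (by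
      obtain ⟨R', hR'⟩ := hηc.isCompact.isBounded.subset_closedBall 0
      refine HasCompactSupport.intro (isCompact_closedBall 0 (max R' R)) fun q hq => ?_
      by_contra hne
      have h1 : η q.1 ≠ 0 := left_ne_zero_of_mul hne
      have h2 : χ q.2 ≠ 0 := right_ne_zero_of_mul hne
      refine hq ?_
      rw [mem_closedBall_zero_iff]
      refine (Prod.norm_def _).trans_le (max_le_max ?_ ?_)
      · simpa using hR' (subset_tsupport _ h1)
      · exact not_lt.1 fun hlt => h2 (hs _ hlt))
  simp only [hfd] at key
  refine Eq.trans ?_ key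
  congr 1
  · rw [← integral_const_mul]
    congr 1; ext z; ring
  · congr 1
    ext t
    have i1 : Integrable fun z => f t z * (deriv η t * χ z) :=
      (Lp.memLp (f t)).integrable_mul (hχ2.const_mul _)
    have i2 : Integrable fun z => f t z * (η t * fderiv ℝ χ z (W t z)) :=
      (Lp.memLp (f t)).integrable_mul ((hG2 t).const_mul _)
    simp only [mul_add]
    rw [integral_add i1 i2, hu, ha]
    simp only [← integral_const_mul]
    congr 1 <;> (congr 1; ext z; ring)

/-- A bounded sequence of weak solutions of transport equations with uniformly bounded fields and
the same initial value has a subsequence that converges weakly at almost every time. -/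
lemma exists_subseq_weak_tendsto {F : ℕ → ℝ → L2Phase} {W : ℕ → ℝ → Phase → Phase}
    (h : ∀ n, IsTransportSolution (W n) fin (F n)) (hW : ∀ n, IsBoundedField H K (W n))
    (hHl : LocallyIntegrable H) (hF : ∀ n, StronglyMeasurable (F n)) (hM : ∀ n t, ‖F n t‖ ≤ M) :
    ∃ ns : ℕ → ℕ, StrictMono ns ∧ ∃ F₀ : ℝ → L2Phase, StronglyMeasurable F₀ ∧ (∀ t, ‖F₀ t‖ ≤ M) ∧
      ∀ᵐ t, 0 < t → ∀ x, Tendsto (fun k => (inner ℝ (F (ns k) t) x : ℝ)) atTop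
        (𝓝 (inner ℝ (F₀ t) x)) := by
  have hM0 : 0 ≤ M := (norm_nonneg _).trans (hM 0 0)
  have hdense := Lp.dense_hasCompactSupport_contDiff (E := Phase) (F := ℝ)
    (μ := (volume : Measure Phase)) (p := 2) (by simp)
  obtain ⟨D, hDs, hDc, hD⟩ := hdense.exists_countable_dense_subset
  have hDcount : Countable D := hDc.to_subtype
  have hex : ∀ d : D, ∃ χ : Phase → ℝ, ((d : L2Phase) : Phase → ℝ) =ᵐ[volume] χ ∧
      HasCompactSupport χ ∧ ContDiff ℝ 1 χ := fun d => by
    obtain ⟨χ, h1, h2, h3⟩ := hDs d.2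
    exact ⟨χ, h1, h2, h3.of_le (by exact_mod_cast le_top)⟩
  choose χ hχe hχc hχ using hex
  choose R κ hκ hs hsd hb hbd using fun d => exists_closedBall_support_phase (hχ d) (hχc d)
  choose a hal hab hae using fun n d => (h n).moment_eq (hW n) hHl (hF n) (hM n) (hχ d) (hκ d)
    (hs d) (hsd d) (hb d) (hbd d)
  have hHi : ∀ x y, IntervalIntegrable (fun t => |H t|) volume x y := fun x y =>
    (hHl.integrableOn_isCompact isCompact_uIcc).intervalIntegrable.norm
  have hai : ∀ n d x y, IntervalIntegrable (a n d) volume x y := fun n d x y =>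
    ((hal n d).integrableOn_isCompact isCompact_uIcc).intervalIntegrable
  -- Extraction is applied to the primitives, which are defined for every `t` and agree with the
  -- moments almost everywhere. They have the same initial value for all `n`, and their modulus is
  -- the primitive of `|H|`.
  obtain ⟨ns, hns, hconv⟩ := exists_subseq_tendsto
    (g := fun n d t => (∫ z, fin z * χ d z) + ∫ τ in (0 : ℝ)..t, a n d τ)
    (b := fun d => |∫ z, fin z * χ d z|) (κ := fun d => M * (κ d * |K (R d)| * ballNorm (R d)))
    (P := fun t => ∫ τ in (0 : ℝ)..t, |H τ|)
    (intervalIntegral.continuous_primitive hHi 0) (fun n d => by simp) (by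
      intro n d s t _ _
      rw [add_sub_add_left_eq_sub, intervalIntegral.integral_interval_sub_left (hai _ _ _ _)
        (hai _ _ _ _), intervalIntegral.integral_interval_sub_left (hHi _ _) (hHi _ _)]
      have e : |M * (κ d * |K (R d)| * ballNorm (R d))| = M * (κ d * |K (R d)| * ballNorm (R d)) :=
        abs_of_nonneg (by
          have := ballNorm_nonneg (R d)
          have := hκ d
          positivity)
      rw [← e, ← abs_mul, ← intervalIntegral.integral_const_mul, ← Real.norm_eq_abs]
      refine intervalIntegral.norm_integral_le_abs_of_norm_le (Eventually.of_forall fun τ => ?_)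
        ((hHi _ _).const_mul _)
      refine (hab n d τ).trans (le_of_eq ?_)
      ring)
  have hinner : ∀ n t (d : D), (inner ℝ (F n t) (d : L2Phase) : ℝ) = ∫ z, F n t z * χ d z := by
    intro n t d
    rw [L2.inner_def]
    refine integral_congr_ae ?_
    filter_upwards [hχe d] with z hz
    rw [hz]; simp [mul_comm]
  have hgood : ∀ᵐ t, 0 < t → ∀ d : D, ∃ l, Tendsto
      (fun k => (inner ℝ (F (ns k) t) (d : L2Phase) : ℝ)) atTop (𝓝 l) := by
    have : ∀ᵐ t, ∀ n d, 0 < t → ∫ z, F n t z * χ d z =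
        (∫ z, fin z * χ d z) + ∫ τ in (0 : ℝ)..t, a n d τ :=
      ae_all_iff.2 fun n => ae_all_iff.2 fun d => hae n d
    filter_upwards [this] with t ht h0 d
    obtain ⟨l, hl⟩ := hconv d t h0.le
    exact ⟨l, hl.congr fun k => by rw [hinner, ht _ _ h0]⟩
  set S : Set ℝ := {t | ∀ d : D, ∃ l, Tendsto
      (fun k => (inner ℝ (F (ns k) t) (d : L2Phase) : ℝ)) atTop (𝓝 l)} with hS
  have himeas : ∀ n x, Measurable fun t => (inner ℝ (F n t) x : ℝ) := fun n x =>
    ((hF n).inner stronglyMeasurable_const).measurable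
  have hSm : MeasurableSet S := by
    have : S = ⋂ d : D, {t | ∃ l, Tendsto
      (fun k => (inner ℝ (F (ns k) t) (d : L2Phase) : ℝ)) atTop (𝓝 l)} := by
      ext t; simp [hS]
    rw [this]
    exact MeasurableSet.iInter fun d => measurableSet_exists_tendsto fun k => himeas _ _
  -- Outside the measurable set `S` of good times the limit is set to zero, so `F₀` is the weak
  -- limit of measurable functions at every time.
  have hlim : ∀ t, ∃ w : L2Phase, ‖w‖ ≤ M ∧ ∀ x, Tendsto
      (fun k => S.indicator (fun t => (inner ℝ (F (ns k) t) x : ℝ)) t) atTop (𝓝 (inner ℝ w x)) := by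
    intro t
    by_cases ht : t ∈ S
    · obtain ⟨w, hw, hwl⟩ := exists_weakLimit hD (v := fun k => F (ns k) t) (fun k => hM _ t)
        (fun d hd => ht ⟨d, hd⟩)
      exact ⟨w, hw, fun x => by simpa only [indicator_of_mem ht] using hwl x⟩
    · exact ⟨0, by simpa using hM0, fun x => by
        simp only [indicator_of_notMem ht, inner_zero_left]; exact tendsto_const_nhds⟩
  choose F₀ hF₀ hF₀l using hlim
  refine ⟨ns, hns, F₀, ?_, hF₀, ?_⟩
  · refine stronglyMeasurable_of_inner fun x => ?_
    exact measurable_of_tendsto_metrizable (fun k => (himeas (ns k) x).indicator hSm)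
      (tendsto_pi_nhds.2 fun t => hF₀l t x)
  · filter_upwards [hgood] with t ht h0 x
    have hS' : t ∈ S := ht h0
    simpa only [indicator_of_mem hS'] using hF₀l t x

end Compactness

/-! ### Passage to the limit in equations with oscillating coefficients. -/

section Homogenization

lemma integral_add_three {X : Type*} [MeasurableSpace X] {μ : Measure X} {f g h : X → ℝ}
    (hf : Integrable f μ) (hg : Integrable g μ) (hh : Integrable h μ) :
    ∫ x, (f x + g x + h x) ∂μ = (∫ x, f x ∂μ) + (∫ x, g x ∂μ) + ∫ x, h x ∂μ := by
  have h1 := integral_add (hf.add hg) hh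
  have h2 := integral_add hf hg
  simp only [Pi.add_apply] at h1
  rw [h1, h2]

/-- A continuous periodic function, as a function on the circle. -/
def periodicLift {T : ℝ} {V : Type*} [TopologicalSpace V] {u : ℝ → V} (hu : Continuous u)
    (huT : Function.Periodic u T) : C(AddCircle T, V) :=
  ⟨huT.lift, hu.quotient_liftOn' _⟩

lemma periodicLift_coe {T : ℝ} {V : Type*} [TopologicalSpace V] {u : ℝ → V} (hu : Continuous u)
    (huT : Function.Periodic u T) (s : ℝ) : periodicLift hu huT (s : AddCircle T) = u s := rfl

lemma periodMean_periodicLift {T : ℝ} {u : ℝ → ℝ} (hu : Continuous u) (huT : Function.Periodic u T) :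
    periodMean (periodicLift hu huT) = mean T u := rfl

variable {T : ℝ} [hT : Fact (0 < T)]

variable {H K : ℝ → ℝ} {R κ M : ℝ} {G : ℝ → Phase → ℝ} {F : ℕ → ℝ → L2Phase} {F₀ : ℝ → L2Phase}
  {εs : ℕ → ℝ}

/-- The product of a pointwise weakly convergent sequence with a rapidly oscillating function
converges to the product of the limits. -/
lemma IsTestDensity.tendsto_integral_oscillating (hG : IsTestDensity H R κ G)
    (hHl : LocallyIntegrable H) (hF : ∀ n, StronglyMeasurable (F n)) (hM : ∀ n t, ‖F n t‖ ≤ M)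
    (hF₀ : StronglyMeasurable F₀) (hM₀ : ∀ t, ‖F₀ t‖ ≤ M)
    (hw : ∀ᵐ t, 0 < t → ∀ x, Tendsto (fun k => (inner ℝ (F k t) x : ℝ)) atTop
      (𝓝 (inner ℝ (F₀ t) x)))
    (hpos : ∀ n, 0 < εs n) (hlim : Tendsto εs atTop (𝓝 0)) (η : C(AddCircle T, ℝ)) :
    Tendsto (fun k => ∫ t in Ioi (0 : ℝ), η ((t / εs k : ℝ) : AddCircle T) * ∫ z, F k t z * G t z)
      atTop (𝓝 (periodMean η * ∫ t in Ioi (0 : ℝ), ∫ z, F₀ t z * G t z)) := by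
  have hi : ∀ n, Integrable fun t => ∫ z, F n t z * G t z := fun n =>
    hG.integrable_pairing hHl (hF n) (hM n)
  have hi₀ : Integrable fun t => ∫ z, F₀ t z * G t z := hG.integrable_pairing hHl hF₀ hM₀
  have hηm : ∀ k, AEStronglyMeasurable (fun t : ℝ => η ((t / εs k : ℝ) : AddCircle T))
      (volume.restrict (Ioi (0 : ℝ))) := fun k =>
    (η.continuous.comp (AddCircle.continuous_mk' T |>.comp (by fun_prop))).aestronglyMeasurable
  -- A strong times weak argument: `F k` is first replaced by `F₀` under the bounded oscillating
  -- factor, by dominated convergence. The remaining pairing is a fixed integrable function of `t`,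
  -- against which `η(t/ε)` averages.
  have h1 : Tendsto (fun k => ∫ t in Ioi (0 : ℝ), η ((t / εs k : ℝ) : AddCircle T) *
      ((∫ z, F k t z * G t z) - ∫ z, F₀ t z * G t z)) atTop (𝓝 0) := by
    suffices hsuff : Tendsto (fun k => ∫ t in Ioi (0 : ℝ), η ((t / εs k : ℝ) : AddCircle T) *
        ((∫ z, F k t z * G t z) - ∫ z, F₀ t z * G t z)) atTop
        (𝓝 (∫ _ in Ioi (0 : ℝ), (0 : ℝ))) by rwa [integral_zero] at hsuff
    refine tendsto_integral_of_dominated_convergence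
      (fun t => ‖η‖ * (2 * (Icc (-R) R).indicator (fun t => M * (κ * H t * ballNorm R)) t))
      (fun k => (hηm k).mul ((hi k).1.restrict.sub hi₀.1.restrict))
      (((IsTestDensity.integrable_bound hHl R M κ).const_mul 2).const_mul _).integrableOn
      (fun k => Eventually.of_forall fun t => ?_) ?_
    · rw [norm_mul]
      have a1 := hG.abs_pairing_le (F k t) (hM k t) t
      have a2 := hG.abs_pairing_le (F₀ t) (hM₀ t) t
      refine mul_le_mul (η.norm_coe_le_norm _) ?_ (norm_nonneg _) (norm_nonneg _)
      refine (norm_sub_le _ _).trans ?_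
      rw [Real.norm_eq_abs, Real.norm_eq_abs]
      linarith
    · refine (ae_restrict_iff' measurableSet_Ioi).2 ?_
      filter_upwards [hw] with t ht h0
      have h2 := ht h0 (hG.memLp t).toLp
      simp only [← integral_mul_eq_inner] at h2
      have h3 : Tendsto (fun k => (∫ z, F k t z * G t z) - ∫ z, F₀ t z * G t z) atTop (𝓝 0) := by
        simpa using h2.sub_const (∫ z, F₀ t z * G t z)
      refine squeeze_zero_norm (a := fun k => ‖η‖ * ‖(∫ z, F k t z * G t z) - ∫ z, F₀ t z * G t z‖)
        (fun k => ?_) (by simpa using h3.norm.const_mul ‖η‖)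
      rw [norm_mul]
      gcongr
      exact η.norm_coe_le_norm _
  have h2 : Tendsto (fun k => ∫ t in Ioi (0 : ℝ), (∫ z, F₀ t z * G t z) *
      η ((t / εs k : ℝ) : AddCircle T)) atTop
      (𝓝 ((∫ t in Ioi (0 : ℝ), ∫ z, F₀ t z * G t z) * periodMean η)) := by
    have := tendsto_integral_mul_eval hpos hlim _ (hi₀.indicator (measurableSet_Ioi (a := (0 : ℝ)))) η
    rw [integral_indicator measurableSet_Ioi] at this
    refine this.congr fun k => ?_
    rw [← integral_indicator measurableSet_Ioi]
    congr 1
    ext t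
    by_cases ht : t ∈ Ioi (0 : ℝ) <;> simp [ht]
  have h3 := h1.add h2
  rw [zero_add, mul_comm] at h3
  refine h3.congr fun k => ?_
  have hηi : ∀ v : ℝ → ℝ, Integrable v → Integrable
      (fun t => η ((t / εs k : ℝ) : AddCircle T) * v t) (volume.restrict (Ioi (0 : ℝ))) :=
    fun v hv => hv.restrict.bdd_mul (hηm k) (Eventually.of_forall fun t => η.norm_coe_le_norm _)
  rw [← integral_add]
  · congr 1; ext t; ring
  · exact hηi _ ((hi k).sub hi₀)
  · simpa only [mul_comm] using hηi _ hi₀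

/-- The parameter `a` selects whether `∂ₜφ` is included. When the field is split into three, it must
be counted only once, with the part that does not oscillate. -/
lemma exists_isTestDensity (hH : ∀ t, 1 ≤ H t) {φ : ℝ × Phase → ℝ} (hφ : ContDiff ℝ 1 φ)
    (hφc : HasCompactSupport φ) {W : ℝ → Phase → Phase} (hW : IsBoundedField H K W) {a : ℝ}
    (ha : |a| ≤ 1) : ∃ R κ : ℝ, IsTestDensity H R κ fun t z => fderiv ℝ φ (t, z) (a, W t z) := by
  obtain ⟨R, M, hR, hM, -, hsd, -, hMd⟩ := exists_closedBall_support hφ hφc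
  have hcf : Continuous (fderiv ℝ φ) := hφ.continuous_fderiv (by simp)
  have hz : ∀ t (z : Phase), ¬ (‖((t, z) : ℝ × Phase)‖ ≤ R) → fderiv ℝ φ (t, z) (a, W t z) = 0 :=
    fun t z h => by rw [hsd _ (not_le.1 h)]; rfl
  refine ⟨R, M * (1 + |K R|), ?_, fun t z => ?_, fun t z h => hz t z ?_, fun t z h => hz t z ?_⟩
  · exact (by fun_prop : Continuous fun r : (ℝ × Phase →L[ℝ] ℝ) × (ℝ × Phase) =>
      r.1 r.2).measurable.comp (hcf.measurable.prodMk (measurable_const.prodMk hW.measurable))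
  · have hHt := hH t
    by_cases h : ‖((t, z) : ℝ × Phase)‖ ≤ R
    · rw [← Real.norm_eq_abs]
      refine (ContinuousLinearMap.le_opNorm _ _).trans ?_
      rw [mul_assoc]
      refine mul_le_mul (hMd _) ?_ (norm_nonneg _) hM
      have hw : ‖W t z‖ ≤ |K R| * H t := (hW.bound R t z ((norm_snd_le _).trans h)).trans
        (by gcongr; exact le_abs_self _)
      have hk := abs_nonneg (K R)
      refine (Prod.norm_def _).trans_le (max_le ?_ (hw.trans ?_))
      · rw [Real.norm_eq_abs]; nlinarith
      · nlinarith
    · rw [hz t z h, abs_zero]; positivity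
  · exact not_le.2 (h.trans_le (norm_fst_le ((t, z) : ℝ × Phase)))
  · exact not_le.2 (h.trans_le (norm_snd_le ((t, z) : ℝ × Phase)))

/-- Averaging of the transport equations with fields `V₀ + θ(t/ε) V₁ + θ(t/ε)² V₂`. -/
lemma isTransportSolution_average {θ : ℝ → ℝ} (hθ : Continuous θ) (hθT : Function.Periodic θ T)
    {V₀ V₁ V₂ : ℝ → Phase → Phase} (hV₀ : IsBoundedField H K V₀) (hV₁ : IsBoundedField H K V₁)
    (hV₂ : IsBoundedField H K V₂) (hH : ∀ t, 1 ≤ H t)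
    (hHl : LocallyIntegrable H) (hF : ∀ n, StronglyMeasurable (F n)) (hM : ∀ n t, ‖F n t‖ ≤ M)
    (hF₀ : StronglyMeasurable F₀) (hM₀ : ∀ t, ‖F₀ t‖ ≤ M)
    (hw : ∀ᵐ t, 0 < t → ∀ x, Tendsto (fun k => (inner ℝ (F k t) x : ℝ)) atTop
      (𝓝 (inner ℝ (F₀ t) x)))
    (hpos : ∀ n, 0 < εs n) (hlim : Tendsto εs atTop (𝓝 0)) {fin : Phase → ℝ}
    (h : ∀ n, IsTransportSolution
      (fun t z => V₀ t z + θ (t / εs n) • V₁ t z + θ (t / εs n) ^ 2 • V₂ t z) fin (F n)) :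
    IsTransportSolution (fun t z => V₀ t z + mean T θ • V₁ t z +
      mean T (fun τ => θ τ ^ 2) • V₂ t z) fin F₀ := by
  intro φ hφ hφc
  obtain ⟨R₀, κ₀, hG₀⟩ := exists_isTestDensity hH hφ hφc hV₀ (a := 1) (by simp)
  obtain ⟨R₁, κ₁, hG₁⟩ := exists_isTestDensity hH hφ hφc hV₁ (a := 0) (by simp)
  obtain ⟨R₂, κ₂, hG₂⟩ := exists_isTestDensity hH hφ hφc hV₂ (a := 0) (by simp)
  have hlin : ∀ t z (c d : ℝ), fderiv ℝ φ (t, z) (1, V₀ t z + c • V₁ t z + d • V₂ t z) =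
      fderiv ℝ φ (t, z) (1, V₀ t z) + c * fderiv ℝ φ (t, z) (0, V₁ t z) +
        d * fderiv ℝ φ (t, z) (0, V₂ t z) := by
    intro t z c d
    have : ((1, V₀ t z + c • V₁ t z + d • V₂ t z) : ℝ × Phase) =
        (1, V₀ t z) + c • (0, V₁ t z) + d • (0, V₂ t z) := by
      ext <;> simp
    rw [this, map_add, map_add, map_smul, map_smul, smul_eq_mul, smul_eq_mul]
  have hinner : ∀ (g : L2Phase) t (c d : ℝ),
      ∫ z, g z * fderiv ℝ φ (t, z) (1, V₀ t z + c • V₁ t z + d • V₂ t z) =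
      (∫ z, g z * fderiv ℝ φ (t, z) (1, V₀ t z)) + c * (∫ z, g z * fderiv ℝ φ (t, z) (0, V₁ t z)) +
        d * ∫ z, g z * fderiv ℝ φ (t, z) (0, V₂ t z) := by
    intro g t c d
    have i₀ : Integrable fun z => g z * fderiv ℝ φ (t, z) (1, V₀ t z) :=
      (Lp.memLp g).integrable_mul (hG₀.memLp t)
    have i₁ : Integrable fun z => g z * fderiv ℝ φ (t, z) (0, V₁ t z) :=
      (Lp.memLp g).integrable_mul (hG₁.memLp t)
    have i₂ : Integrable fun z => g z * fderiv ℝ φ (t, z) (0, V₂ t z) :=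
      (Lp.memLp g).integrable_mul (hG₂.memLp t)
    rw [← integral_const_mul, ← integral_const_mul,
      ← integral_add_three i₀ (i₁.const_mul c) (i₂.const_mul d)]
    congr 1
    ext z
    rw [hlin]
    ring
  have hθ2 : Continuous fun τ => θ τ ^ 2 := hθ.pow 2
  have hθ2T : Function.Periodic (fun τ => θ τ ^ 2) T := fun x => by simp only [hθT x]
  -- The three terms are the same limit with the periodic factors `1`, `θ` and `θ²`.
  have l₀ := hG₀.tendsto_integral_oscillating hHl hF hM hF₀ hM₀ hw hpos hlim
    (1 : C(AddCircle T, ℝ))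
  have l₁ := hG₁.tendsto_integral_oscillating hHl hF hM hF₀ hM₀ hw hpos hlim (periodicLift hθ hθT)
  have l₂ := hG₂.tendsto_integral_oscillating hHl hF hM hF₀ hM₀ hw hpos hlim
    (periodicLift hθ2 hθ2T)
  have e1 : periodMean (1 : C(AddCircle T, ℝ)) = 1 := by
    rw [periodMean_eq_integral]; simp
  rw [e1] at l₀
  simp only [periodicLift_coe, periodMean_periodicLift, ContinuousMap.one_apply, one_mul]
    at l₀ l₁ l₂
  have hosc : ∀ (η : C(AddCircle T, ℝ)) k (v : ℝ → ℝ), Integrable v → Integrable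
      (fun t => η ((t / εs k : ℝ) : AddCircle T) * v t) (volume.restrict (Ioi (0 : ℝ))) :=
    fun η k v hv => hv.restrict.bdd_mul
      (η.continuous.comp (AddCircle.continuous_mk' T |>.comp (by fun_prop))).aestronglyMeasurable
      (Eventually.of_forall fun t => η.norm_coe_le_norm _)
  have hsum := ((l₀.add l₁).add l₂).const_add (∫ z, fin z * φ (0, z))
  have hk : ∀ k, (∫ z, fin z * φ (0, z)) +
      ((∫ t in Ioi (0 : ℝ), ∫ z, F k t z * fderiv ℝ φ (t, z) (1, V₀ t z)) +
      (∫ t in Ioi (0 : ℝ), θ (t / εs k) * ∫ z, F k t z * fderiv ℝ φ (t, z) (0, V₁ t z)) +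
      ∫ t in Ioi (0 : ℝ), θ (t / εs k) ^ 2 * ∫ z, F k t z * fderiv ℝ φ (t, z) (0, V₂ t z)) = 0 := by
    intro k
    have i₀ := (hG₀.integrable_pairing hHl (hF k) (hM k)).restrict (s := Ioi (0 : ℝ))
    have i₁ := hosc (periodicLift hθ hθT) k _ (hG₁.integrable_pairing hHl (hF k) (hM k))
    have i₂ := hosc (periodicLift hθ2 hθ2T) k _
      (hG₂.integrable_pairing hHl (hF k) (hM k))
    simp only [periodicLift_coe] at i₁ i₂
    rw [← integral_add_three i₀ i₁ i₂]
    refine Eq.trans ?_ (h k φ hφ hφc)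
    simp only [hinner]
  simp only [hk] at hsum
  have hz := tendsto_nhds_unique hsum tendsto_const_nhds
  simp only [hinner]
  have j₀ := (hG₀.integrable_pairing hHl hF₀ hM₀).restrict (s := Ioi (0 : ℝ))
  have j₁ := ((hG₁.integrable_pairing hHl hF₀ hM₀).restrict (s := Ioi (0 : ℝ))).const_mul (mean T θ)
  have j₂ := ((hG₂.integrable_pairing hHl hF₀ hM₀).restrict (s := Ioi (0 : ℝ))).const_mul
    (mean T fun τ => θ τ ^ 2)
  rw [integral_add_three j₀ j₁ j₂, integral_const_mul, integral_const_mul]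
  exact hz

end Homogenization

/-! ### Measurable representatives of the electric field. -/

section Representatives

/-- The essential supremum is at most `a` exactly when the slice of `{a < |g|}` has measure zero,
and the measure of a slice is measurable in `t`. -/
lemma measurable_eLpNorm_top {g : ℝ × E3 → E3} (hg : StronglyMeasurable g) :
    Measurable fun t => eLpNorm (fun x => g (t, x)) ⊤ (volume : Measure E3) := by
  simp only [eLpNorm_exponent_top]
  refine measurable_of_Iic fun a => ?_
  have hs : MeasurableSet {q : ℝ × E3 | a < ‖g q‖ₑ} :=
    measurableSet_lt measurable_const hg.enorm
  have : (fun t => eLpNormEssSup (fun x => g (t, x)) (volume : Measure E3)) ⁻¹' Iic a =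
      (fun t => (volume : Measure E3) (Prod.mk t ⁻¹' {q : ℝ × E3 | a < ‖g q‖ₑ})) ⁻¹' {0} := by
    ext t
    simp only [mem_preimage, mem_Iic, mem_singleton_iff]
    have e : (volume : Measure E3) (Prod.mk t ⁻¹' {q : ℝ × E3 | a < ‖g q‖ₑ}) = 0 ↔
        ∀ᵐ x, ‖g (t, x)‖ₑ ≤ a := by
      rw [ae_iff]
      simp only [not_le]
      rfl
    rw [e]
    refine ⟨fun h => ?_, fun h => essSup_le_of_ae_le _ h⟩
    filter_upwards [ae_le_eLpNormEssSup (f := fun x => g (t, x)) (μ := (volume : Measure E3))]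
      with x hx using hx.trans h
  rw [this]
  exact (measurable_measure_prodMk_left hs) (measurableSet_singleton 0)

/-- A field in `L¹_loc(ℝ₊; L^∞)` has a measurable representative that is everywhere bounded by a
locally integrable function of time. -/
lemma IsL1locLinf.exists_rep {E : ℝ → E3 → E3} (hE : IsL1locLinf E) :
    ∃ (E' : ℝ → E3 → E3) (H : ℝ → ℝ), Measurable (Function.uncurry E') ∧ (∀ t, 1 ≤ H t) ∧
      LocallyIntegrable H ∧ (∀ t x, ‖E' t x‖ ≤ H t) ∧
      ∀ᵐ t, 0 < t → E' t =ᵐ[volume] E t := by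
  set Em := hE.measurable.mk _ with hEm
  have hEms : StronglyMeasurable Em := hE.measurable.stronglyMeasurable_mk
  set N : ℝ → ENNReal := fun t => eLpNorm (fun x => Em (t, x)) ⊤ (volume : Measure E3) with hN
  have hNm : Measurable N := measurable_eLpNorm_top hEms
  have hae : ∀ᵐ t ∂volume.restrict (Ici (0 : ℝ)), (fun x => Em (t, x)) =ᵐ[volume] E t := by
    filter_upwards [Measure.ae_ae_of_ae_prod hE.measurable.ae_eq_mk] with t ht
    filter_upwards [ht] with x hx using hx.symm
  have hfin : ∀ I, ∫⁻ t in Icc 0 I, N t < ⊤ := fun I => by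
    refine lt_of_le_of_lt (le_of_eq (lintegral_congr_ae ?_)) (hE.locally_integrable I)
    filter_upwards [ae_restrict_of_ae_restrict_of_subset Icc_subset_Ici_self hae] with t ht
    exact eLpNorm_congr_ae ht
  -- The added `1` lets constants be absorbed into multiples of `H`. Truncating `Em` where it
  -- exceeds `H` changes it, for almost every `t > 0`, only on a null set in `x`.
  set H : ℝ → ℝ := fun t => 1 + (Ici (0 : ℝ)).indicator (fun t => (N t).toReal) t with hH
  have hHm : Measurable H :=
    measurable_const.add (hNm.ennreal_toReal.indicator measurableSet_Ici)
  have hH1 : ∀ t, 1 ≤ H t := fun t => by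
    have : 0 ≤ (Ici (0 : ℝ)).indicator (fun t => (N t).toReal) t :=
      indicator_nonneg (fun _ _ => ENNReal.toReal_nonneg) _
    simp only [hH]; linarith
  have hHl : LocallyIntegrable H := by
    refine (locallyIntegrable_const 1).add (locallyIntegrable_iff.2 fun k hk => ?_)
    obtain ⟨R, hR⟩ := hk.isBounded.subset_closedBall 0
    refine IntegrableOn.mono_set (t := Icc (-R) R) ?_ (fun x hx => by
      have := hR hx
      rw [mem_closedBall_zero_iff] at this
      exact abs_le.1 this)
    rw [IntegrableOn, integrable_indicator_iff measurableSet_Ici, IntegrableOn,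
      Measure.restrict_restrict measurableSet_Ici]
    have h1 : IntegrableOn (fun t => (N t).toReal) (Icc 0 R) :=
      integrable_toReal_of_lintegral_ne_top hNm.aemeasurable (hfin R).ne
    exact h1.mono_set fun x hx => ⟨hx.1, hx.2.2⟩
  have hsm : MeasurableSet {q : ℝ × E3 | ‖Em q‖ ≤ H q.1} :=
    measurableSet_le hEms.norm.measurable (hHm.comp measurable_fst)
  refine ⟨fun t x => {q : ℝ × E3 | ‖Em q‖ ≤ H q.1}.indicator Em (t, x), H,
    (hEms.indicator hsm).measurable, hH1, hHl, fun t x => ?_, ?_⟩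
  · by_cases h : ((t, x) : ℝ × E3) ∈ {q : ℝ × E3 | ‖Em q‖ ≤ H q.1}
    · simp only [indicator_of_mem h]; exact h
    · simp only [indicator_of_notMem h, norm_zero]
      exact zero_le_one.trans (hH1 t)
  · have hNfin : ∀ᵐ t ∂volume.restrict (Ici (0 : ℝ)), N t < ⊤ := by
      have h1 : ∀ n : ℕ, ∀ᵐ t ∂volume.restrict (Icc (0 : ℝ) n), N t < ⊤ := fun n =>
        ae_lt_top hNm (hfin n).ne
      have h2 : Ici (0 : ℝ) = ⋃ n : ℕ, Icc (0 : ℝ) n := by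
        ext t
        simp only [mem_Ici, mem_iUnion, mem_Icc]
        refine ⟨fun h => ?_, fun ⟨n, h, _⟩ => h⟩
        obtain ⟨n, hn⟩ := exists_nat_ge t
        exact ⟨n, h, hn⟩
      rw [h2, ae_restrict_iUnion_iff]
      exact h1
    have h3 := (ae_restrict_iff' measurableSet_Ici).1 hNfin
    have h4 := (ae_restrict_iff' measurableSet_Ici).1 hae
    filter_upwards [h3, h4] with t h3 h4 h0
    have h0' : t ∈ Ici (0 : ℝ) := h0.le
    filter_upwards [h4 h0', ae_le_eLpNormEssSup (f := fun x => Em (t, x))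
      (μ := (volume : Measure E3))] with x hx hb
    have hmem : ((t, x) : ℝ × E3) ∈ {q : ℝ × E3 | ‖Em q‖ ≤ H q.1} := by
      have h5 : ‖Em (t, x)‖ ≤ (N t).toReal := by
        rw [← toReal_enorm]
        refine ENNReal.toReal_mono (h3 h0').ne ?_
        simp only [hN, eLpNorm_exponent_top]
        exact hb
      simp only [mem_ofPred_eq, hH, indicator_of_mem h0']
      linarith
    rw [indicator_of_mem hmem, hx]

end Representatives

/-! ### The vector identity for the magnetic force. -/

section Algebra

lemma apply_eq_sum_partialD (D : E3 →L[ℝ] E3) (p : E3) (i : Fin 3) :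
    D p i = ∑ j, p j * partialD D j i := by
  have h : p = ∑ j, p j • EuclideanSpace.single j (1 : ℝ) := by
    ext i; simp [Finset.sum_apply, Pi.single_apply]
  conv_lhs => rw [h]
  simp [map_sum, map_smul, partialD]

lemma adjoint_apply_eq_sum_partialD (D : E3 →L[ℝ] E3) (p : E3) (i : Fin 3) :
    ContinuousLinearMap.adjoint D p i = ∑ j, p j * partialD D i j := by
  have h1 : ContinuousLinearMap.adjoint D p i =
      inner ℝ (EuclideanSpace.single i (1 : ℝ)) (ContinuousLinearMap.adjoint D p) := by
    rw [EuclideanSpace.inner_single_left]; simp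
  rw [h1, ContinuousLinearMap.adjoint_inner_right]
  simp [PiLp.inner_apply, partialD]

/-- `p ∧ curl A = (ᵗ∂A - ∂A) p`. -/
lemma cross_curlOf (D : E3 →L[ℝ] E3) (p : E3) :
    cross p (curlOf D) = ContinuousLinearMap.adjoint D p - D p := by
  ext i
  rw [PiLp.sub_apply, adjoint_apply_eq_sum_partialD, apply_eq_sum_partialD D]
  fin_cases i <;> simp [cross, curlOf, cross_apply, Fin.sum_univ_three] <;> ring

lemma cross_smul_right (p v : E3) (c : ℝ) : cross p (c • v) = c • cross p v := by
  simp [cross]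

end Algebra

/-! ### Stability of the field bounds. -/

section Fields

variable {H K K' : ℝ → ℝ} {W W' : ℝ → Phase → Phase}

lemma IsBoundedField.add (h : IsBoundedField H K W) (h' : IsBoundedField H K' W') :
    IsBoundedField H (fun R => K R + K' R) fun t z => W t z + W' t z where
  measurable := h.measurable.add h'.measurable
  bound R t z hz := by
    refine (norm_add_le _ _).trans ?_
    rw [add_mul]
    exact add_le_add (h.bound R t z hz) (h'.bound R t z hz)

lemma IsBoundedField.smul (h : IsBoundedField H K W) {c : ℝ → ℝ} (hc : Measurable c) {c₀ : ℝ}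
    (hb : ∀ t, |c t| ≤ c₀) : IsBoundedField H (fun R => c₀ * K R) fun t z => c t • W t z where
  measurable := (hc.comp measurable_fst).smul h.measurable
  bound R t z hz := by
    rw [norm_smul, mul_assoc]
    exact mul_le_mul (hb t) (h.bound R t z hz) (norm_nonneg _) ((abs_nonneg _).trans (hb t))

lemma IsBoundedField.of_growth (hH : ∀ t, 1 ≤ H t) (hm : Measurable (Function.uncurry W)) {L : ℝ}
    (hL : 0 ≤ L) (h : ∀ t z, ‖W t z‖ ≤ L * (H t + ‖z‖)) :
    IsBoundedField H (fun R => L * (1 + |R|)) W where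
  measurable := hm
  bound R t z hz := by
    refine (h t z).trans ?_
    have h1 := hH t
    have h2 : ‖z‖ ≤ |R| := hz.trans (le_abs_self R)
    rw [mul_assoc]
    gcongr
    nlinarith [abs_nonneg R]

end Fields

/-! ### The vector fields of the problem and their growth. -/

section VlasovFields

variable (m e : ℝ) (E : ℝ → E3 → E3) (A : E3 → E3) (DA : E3 → E3 →L[ℝ] E3)

/-- The part `(p/m, e E)` of the field that does not oscillate. -/
def steadyField (t : ℝ) (z : Phase) : Phase := ((1 / m) • z.2, e • E t z.1)

/-- The field `(0, A)`. -/
def potentialField (_ : ℝ) (z : Phase) : Phase := (0, A z.1)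

/-- The field `(0, (ᵗ∂A - ∂A) p)`. -/
def magneticField (_ : ℝ) (z : Phase) : Phase :=
  (0, ContinuousLinearMap.adjoint (DA z.1) z.2 - DA z.1 z.2)

/-- The coefficient of `θ` in the sheared field. -/
def firstOrderField (_ : ℝ) (z : Phase) : Phase :=
  (-((e / m) • A z.1), (e / m) • ContinuousLinearMap.adjoint (DA z.1) z.2)

/-- The coefficient of `θ²` in the sheared field. -/
def secondOrderField (_ : ℝ) (z : Phase) : Phase :=
  (0, -((e ^ 2 / m) • ContinuousLinearMap.adjoint (DA z.1) (A z.1)))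

variable {m e E A DA} {C : ℝ} {H : ℝ → ℝ}

lemma measurable_clm_apply {X : Type*} [MeasurableSpace X] {L : X → E3 →L[ℝ] E3} {v : X → E3}
    (hL : Measurable L) (hv : Measurable v) : Measurable fun x => L x (v x) :=
  (by fun_prop : Continuous fun r : (E3 →L[ℝ] E3) × E3 => r.1 r.2).measurable.comp (hL.prodMk hv)

lemma measurable_adjoint {X : Type*} [MeasurableSpace X] {L : X → E3 →L[ℝ] E3}
    (hL : Measurable L) : Measurable fun x => ContinuousLinearMap.adjoint (L x) :=
  (ContinuousLinearMap.adjoint (𝕜 := ℝ) (E := E3) (F := E3)).continuous.measurable.comp hL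

lemma norm_adjoint_apply_le (hD : ∀ x, ‖DA x‖ ≤ C) (x v : E3) :
    ‖ContinuousLinearMap.adjoint (DA x) v‖ ≤ C * ‖v‖ := by
  refine (ContinuousLinearMap.le_opNorm _ _).trans ?_
  rw [LinearIsometryEquiv.norm_map]
  gcongr
  exact hD x

/-- A constant that bounds the growth of all the fields. -/
def growthConst (m e C : ℝ) : ℝ := 1 / m + |e| + |e| / m * C + e ^ 2 / m * C ^ 2 + 2 * C

/-- All the fields are given one and the same bound function, since `isTransportSolution_average`
takes a single `K` for its three coefficients. -/
lemma isBoundedField_steadyField (hm : 0 < m) (hC : 0 ≤ C) (hH : ∀ t, 1 ≤ H t)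
    (hE : Measurable (Function.uncurry E)) (hEb : ∀ t x, ‖E t x‖ ≤ H t) :
    IsBoundedField H (fun R => growthConst m e C * (1 + |R|)) (steadyField m e E) := by
  refine IsBoundedField.of_growth hH ?_ (by rw [growthConst]; positivity) fun t z => ?_
  · have h1 : Measurable fun q : ℝ × Phase => E q.1 q.2.1 :=
      hE.comp (by fun_prop : Measurable fun q : ℝ × Phase => (q.1, q.2.1))
    exact ((by fun_prop : Measurable fun q : ℝ × Phase => (1 / m) • q.2.2)).prodMk
      (h1.const_smul e)
  · have hHt := hH t
    have a1 : ‖(1 / m) • z.2‖ ≤ 1 / m * ‖z‖ := by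
      rw [norm_smul, Real.norm_of_nonneg (by positivity)]
      gcongr
      exact norm_snd_le z
    have a2 : ‖e • E t z.1‖ ≤ |e| * H t := by
      rw [norm_smul, Real.norm_eq_abs]
      gcongr
      exact hEb t _
    have b1 : 0 ≤ |e| + |e| / m * C + e ^ 2 / m * C ^ 2 + 2 * C := by positivity
    have b2 : 0 ≤ 1 / m + |e| / m * C + e ^ 2 / m * C ^ 2 + 2 * C := by positivity
    have b3 : 0 ≤ 1 / m := by positivity
    have b4 := abs_nonneg e
    have b5 := norm_nonneg z
    have b6 : 0 ≤ growthConst m e C := by rw [growthConst]; positivity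
    refine (Prod.norm_def _).trans_le (max_le (a1.trans ?_) (a2.trans ?_))
    · calc 1 / m * ‖z‖ ≤ growthConst m e C * ‖z‖ := by
            gcongr; rw [growthConst]; linarith
        _ ≤ _ := by gcongr; linarith
    · calc |e| * H t ≤ growthConst m e C * H t := by
            gcongr; rw [growthConst]; linarith
        _ ≤ _ := by gcongr; linarith

lemma isBoundedField_potentialField (hm : 0 < m) (hC : 0 ≤ C) (hH : ∀ t, 1 ≤ H t)
    (hA : Measurable A) (hAb : ∀ x, ‖A x‖ ≤ C) :
    IsBoundedField H (fun R => growthConst m e C * (1 + |R|)) (potentialField A) := by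
  refine IsBoundedField.of_growth hH ?_ (by rw [growthConst]; positivity) fun t z => ?_
  · exact measurable_const.prodMk (hA.comp (by fun_prop))
  · have hHt := hH t
    have b1 : C ≤ growthConst m e C := by
      have : 0 ≤ 1 / m + |e| + |e| / m * C + e ^ 2 / m * C ^ 2 := by positivity
      rw [growthConst]; linarith
    have b5 := norm_nonneg z
    refine (Prod.norm_def _).trans_le (max_le ?_ ((hAb _).trans ?_))
    · simp only [potentialField, norm_zero]
      have := hC.trans b1
      positivity
    · nlinarith

lemma isBoundedField_magneticField (hm : 0 < m) (hC : 0 ≤ C) (hH : ∀ t, 1 ≤ H t)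
    (hD : Measurable DA) (hDb : ∀ x, ‖DA x‖ ≤ C) :
    IsBoundedField H (fun R => growthConst m e C * (1 + |R|)) (magneticField DA) := by
  refine IsBoundedField.of_growth hH ?_ (by rw [growthConst]; positivity) fun t z => ?_
  · have h1 : Measurable fun q : ℝ × Phase => DA q.2.1 := hD.comp (by fun_prop)
    have h2 : Measurable fun q : ℝ × Phase => q.2.2 := by fun_prop
    exact measurable_const.prodMk
      ((measurable_clm_apply (measurable_adjoint h1) h2).sub (measurable_clm_apply h1 h2))
  · have hHt := hH t
    have b1 : 2 * C ≤ growthConst m e C := by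
      have : 0 ≤ 1 / m + |e| + |e| / m * C + e ^ 2 / m * C ^ 2 := by positivity
      rw [growthConst]; linarith
    have b5 := norm_nonneg z
    have b6 : 0 ≤ growthConst m e C := le_trans (by positivity) b1
    have a1 : ‖ContinuousLinearMap.adjoint (DA z.1) z.2‖ ≤ C * ‖z‖ :=
      (norm_adjoint_apply_le hDb _ _).trans (by gcongr; exact norm_snd_le z)
    have a2 : ‖DA z.1 z.2‖ ≤ C * ‖z‖ := (ContinuousLinearMap.le_opNorm _ _).trans
      (mul_le_mul (hDb _) (norm_snd_le z) (norm_nonneg _) hC)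
    refine (Prod.norm_def _).trans_le (max_le ?_ ((norm_sub_le _ _).trans ?_))
    · simp only [magneticField, norm_zero]
      positivity
    · nlinarith

lemma isBoundedField_firstOrderField (hm : 0 < m) (hC : 0 ≤ C) (hH : ∀ t, 1 ≤ H t)
    (hA : Measurable A) (hAb : ∀ x, ‖A x‖ ≤ C) (hD : Measurable DA) (hDb : ∀ x, ‖DA x‖ ≤ C) :
    IsBoundedField H (fun R => growthConst m e C * (1 + |R|)) (firstOrderField m e A DA) := by
  refine IsBoundedField.of_growth hH ?_ (by rw [growthConst]; positivity) fun t z => ?_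
  · have h1 : Measurable fun q : ℝ × Phase => DA q.2.1 := hD.comp (by fun_prop)
    have h2 : Measurable fun q : ℝ × Phase => q.2.2 := by fun_prop
    have h3 : Measurable fun q : ℝ × Phase => A q.2.1 := hA.comp (by fun_prop)
    exact (h3.const_smul (e / m)).neg.prodMk
      ((measurable_clm_apply (measurable_adjoint h1) h2).const_smul (e / m))
  · have hHt := hH t
    have b1 : |e| / m * C ≤ growthConst m e C := by
      have : 0 ≤ 1 / m + |e| + e ^ 2 / m * C ^ 2 + 2 * C := by positivity
      rw [growthConst]; linarith
    have b5 := norm_nonneg z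
    have b6 : 0 ≤ |e| / m * C := by positivity
    have a0 : |e / m| = |e| / m := by rw [abs_div, abs_of_pos hm]
    have a1 : ‖(e / m) • ContinuousLinearMap.adjoint (DA z.1) z.2‖ ≤ |e| / m * C * ‖z‖ := by
      rw [norm_smul, Real.norm_eq_abs, a0, mul_assoc]
      gcongr
      exact (norm_adjoint_apply_le hDb _ _).trans (by gcongr; exact norm_snd_le z)
    have a2 : ‖-((e / m) • A z.1)‖ ≤ |e| / m * C := by
      rw [norm_neg, norm_smul, Real.norm_eq_abs, a0]
      gcongr
      exact hAb _
    refine (Prod.norm_def _).trans_le (max_le (a2.trans ?_) (a1.trans ?_))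
    · nlinarith
    · nlinarith

lemma isBoundedField_secondOrderField (hm : 0 < m) (hC : 0 ≤ C) (hH : ∀ t, 1 ≤ H t)
    (hA : Measurable A) (hAb : ∀ x, ‖A x‖ ≤ C) (hD : Measurable DA) (hDb : ∀ x, ‖DA x‖ ≤ C) :
    IsBoundedField H (fun R => growthConst m e C * (1 + |R|)) (secondOrderField m e A DA) := by
  refine IsBoundedField.of_growth hH ?_ (by rw [growthConst]; positivity) fun t z => ?_
  · have h1 : Measurable fun q : ℝ × Phase => DA q.2.1 := hD.comp (by fun_prop)
    have h3 : Measurable fun q : ℝ × Phase => A q.2.1 := hA.comp (by fun_prop)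
    exact measurable_const.prodMk
      ((measurable_clm_apply (measurable_adjoint h1) h3).const_smul (e ^ 2 / m)).neg
  · have hHt := hH t
    have b1 : e ^ 2 / m * C ^ 2 ≤ growthConst m e C := by
      have : 0 ≤ 1 / m + |e| + |e| / m * C + 2 * C := by positivity
      rw [growthConst]; linarith
    have b5 := norm_nonneg z
    have b6 : 0 ≤ e ^ 2 / m * C ^ 2 := by positivity
    have a1 : ‖-((e ^ 2 / m) • ContinuousLinearMap.adjoint (DA z.1) (A z.1))‖ ≤
        e ^ 2 / m * C ^ 2 := by
      rw [norm_neg, norm_smul, Real.norm_of_nonneg (by positivity), sq C]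
      gcongr
      exact (norm_adjoint_apply_le hDb _ _).trans (by gcongr; exact hAb _)
    refine (Prod.norm_def _).trans_le (max_le ?_ (a1.trans ?_))
    · simp only [secondOrderField, norm_zero]
      have := b6.trans b1
      positivity
    · nlinarith

end VlasovFields

/-! ### Removing the singular term and recovering the limit field. -/

section Conversion

variable {T m e : ℝ} {θ : ℝ → ℝ} {E E' : ℝ → E3 → E3} {A A' : E3 → E3}
  {DA DA' : E3 → E3 →L[ℝ] E3} {B : E3 → ℝ} {b : E3 → E3} {fin : Phase → ℝ}

/-- The relation `curl A = B b` enters here: `B p ∧ b = (ᵗ∂A - ∂A) p` expresses the magnetic force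
through the Jacobian. -/
lemma vlasovForce_eq {ε t : ℝ} {x p : E3} (hE : E' t x = E t x) (hA : A' x = A x)
    (hD : DA' x = DA x) (hcurl : curlOf (DA x) = B x • b x) :
    vlasovForce m e θ E A B b ε t x p = e • E' t x + (-(e * deriv θ (t / ε) / ε)) • A' x +
      (e / m * θ (t / ε)) • (ContinuousLinearMap.adjoint (DA' x) p - DA' x p) := by
  rw [hD, ← cross_curlOf, hcurl, cross_smul_right, vlasovForce, hE, hA, smul_smul, neg_smul,
    sub_eq_add_neg]
  congr 2
  ring

/-- The Vlasov equation as a transport equation, with good representatives of the data. -/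
lemma IsWeakVlasovSolution.isTransportSolution {ε : ℝ} {f f' : ℝ → L2Phase}
    (h : IsWeakVlasovSolution m e θ E A B b ε fin f) (hA : A' =ᵐ[volume] A)
    (hD : DA' =ᵐ[volume] DA) (hE : ∀ᵐ t, 0 < t → E' t =ᵐ[volume] E t)
    (hf : ∀ᵐ t, 0 < t → f' t = f t) (hcurl : ∀ᵐ x : E3, curlOf (DA x) = B x • b x) :
    IsTransportSolution (fun t z => steadyField m e E' t z +
      (-(e * deriv θ (t / ε) / ε)) • potentialField A' t z +
      (e / m * θ (t / ε)) • magneticField DA' t z) fin f' := by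
  intro φ hφ hφc
  have h1 := h φ hφ hφc
  have h2 : ∫ t in Ioi (0 : ℝ), ∫ z : Phase, f' t z * fderiv ℝ φ (t, z)
        (1, steadyField m e E' t z + (-(e * deriv θ (t / ε) / ε)) • potentialField A' t z +
          (e / m * θ (t / ε)) • magneticField DA' t z) =
      ∫ t in Ioi (0 : ℝ), ∫ z : Phase, f t z * fderiv ℝ φ (t, z.1, z.2)
        (1, (1 / m) • z.2, vlasovForce m e θ E A B b ε t z.1 z.2) := by
    refine setIntegral_congr_ae measurableSet_Ioi ?_
    filter_upwards [hE, hf] with t hEt hft h0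
    rw [hft h0]
    refine integral_congr_ae ?_
    have hq := Measure.quasiMeasurePreserving_fst (μ := (volume : Measure E3))
      (ν := (volume : Measure E3))
    filter_upwards [hq.ae (hEt h0), hq.ae hA, hq.ae hD, hq.ae hcurl] with z z1 z2 z3 z4
    rw [vlasovForce_eq z1 z2 z3 z4]
    simp [steadyField, potentialField, magneticField]
  rw [h2]
  linarith

/-- The central cancellation, with `c(t) = e θ(t/ε)`. The term `c' A` cancels the singular force,
and `c ∂A p'/m` cancels the `∂A` half of the magnetic force, where `p' = p - e θ A` is the old
momentum. What is left, `(e/m) θ ᵗ∂A p'`, expands into the terms of order `θ` and `θ²`. -/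
lemma shearField_vlasov (hA : Continuous A) {ε : ℝ} (hθ : ContDiff ℝ 1 θ) (t : ℝ) (z : Phase) :
    shearField A DA (fun t => e * θ (t / ε)) (fun t z => steadyField m e E t z +
      (-(e * deriv θ (t / ε) / ε)) • potentialField A t z +
      (e / m * θ (t / ε)) • magneticField DA t z) t (shearMap hA (-(e * θ (t / ε))) z) =
    steadyField m e E t z + θ (t / ε) • firstOrderField m e A DA t z +
      θ (t / ε) ^ 2 • secondOrderField m e A DA t z := by
  have hd : deriv (fun t => e * θ (t / ε)) t = e * deriv θ (t / ε) / ε := by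
    have h1 := (hθ.differentiable (by simp) (t / ε)).hasDerivAt.comp t
      ((hasDerivAt_id t).div_const ε)
    have h2 := (h1.const_mul e).deriv
    simp only [Function.comp_def, id] at h2
    rw [h2]; ring
  ext1
  · simp only [shearField, steadyField, potentialField, magneticField, firstOrderField,
      secondOrderField, shearMap_apply, Prod.fst_add, Prod.smul_fst]
    module
  · simp only [shearField, steadyField, potentialField, magneticField, firstOrderField,
      secondOrderField, shearMap_apply, Prod.fst_add, Prod.smul_fst, Prod.snd_add, Prod.smul_snd,
      hd, map_add, map_smul, smul_zero, add_zero]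
    module

/-- The inverse shear has a coefficient constant in `t`, so no `c' A` term appears. The `∂A` terms
of the limit force come from differentiating `A` along the averaged velocity, and the mixed products
`θ(s)⟨θ⟩` from expanding at the shifted momentum `p + e θ(s) A`. -/
lemma shearField_average (hA : Continuous A) (s t : ℝ) (z : Phase) :
    shearField A DA (fun _ => -(e * θ s)) (fun t z => steadyField m e E t z +
      mean T θ • firstOrderField m e A DA t z +
      mean T (fun τ => θ τ ^ 2) • secondOrderField m e A DA t z) t (shearMap hA (e * θ s) z) =
    (limitVelocity T m e θ A s z.1 z.2, limitForce T m e θ E A DA t s z.1 z.2) := by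
  ext1
  · simp only [shearField, steadyField, firstOrderField,
      secondOrderField, shearMap_apply, Prod.fst_add, Prod.smul_fst, limitVelocity]
    module
  · simp only [shearField, steadyField, firstOrderField, deriv_const,
      secondOrderField, shearMap_apply, Prod.fst_add, Prod.smul_fst, Prod.snd_add, Prod.smul_snd,
      map_add, map_smul, map_neg, smul_zero, add_zero, limitForce]
    module

lemma exists_bound_of_periodic {u : ℝ → ℝ} [Fact (0 < T)] (hu : Continuous u)
    (huT : Function.Periodic u T) : ∃ C, 0 ≤ C ∧ ∀ t, |u t| ≤ C :=
  ⟨‖periodicLift hu huT‖, norm_nonneg _, fun t =>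
    (periodicLift hu huT).norm_coe_le_norm (t : AddCircle T)⟩

variable {C M : ℝ} {H : ℝ → ℝ} {f : ℝ → L2Phase}

/-- The sheared solutions of the Vlasov equation solve a transport equation without the singular
term `ε⁻¹ θ'(t/ε)`. -/
lemma IsTransportSolution.shear_vlasov [Fact (0 < T)] (hm : 0 < m) (hθ : ContDiff ℝ 1 θ)
    (hθT : Function.Periodic θ T) (hS : IsSmoothLimit A DA C) (hH : ∀ t, 1 ≤ H t)
    (hHl : LocallyIntegrable H) (hE : Measurable (Function.uncurry E))
    (hEb : ∀ t x, ‖E t x‖ ≤ H t) (hf : StronglyMeasurable f) (hM : ∀ t, ‖f t‖ ≤ M)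
    (hfin : MemLp fin 2 volume) {ε : ℝ}
    (h : IsTransportSolution (fun t z => steadyField m e E t z +
      (-(e * deriv θ (t / ε) / ε)) • potentialField A t z +
      (e / m * θ (t / ε)) • magneticField DA t z) fin f) :
    IsTransportSolution (fun t z => steadyField m e E t z +
      θ (t / ε) • firstOrderField m e A DA t z + θ (t / ε) ^ 2 • secondOrderField m e A DA t z)
      (fun z => fin (shearMap hS.continuous (-(e * θ 0)) z))
      (fun t => shearOp hS.continuous (-(e * θ (t / ε))) (f t)) := by
  have hC : 0 ≤ C := (norm_nonneg _).trans (hS.norm_le 0)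
  have hc : ContDiff ℝ 1 fun t => e * θ (t / ε) :=
    contDiff_const.mul (hθ.comp (contDiff_id.div_const ε))
  have hθd : Continuous (deriv θ) := hθ.continuous_deriv le_rfl
  have hθdT : Function.Periodic (deriv θ) T := fun x => by
    have : θ = fun y => θ (y + T) := funext fun y => (hθT y).symm
    conv_rhs => rw [this, deriv_comp_add_const]
  obtain ⟨c₀, -, hc₀⟩ := exists_bound_of_periodic hθ.continuous hθT
  obtain ⟨c₁, -, hc₁⟩ := exists_bound_of_periodic hθd hθdT
  have hθc := hθ.continuous
  have b0 := isBoundedField_steadyField (e := e) hm hC hH hE hEb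
  -- This bound degenerates as `ε → 0`. It only licenses the shear for one fixed `ε`; uniformity is
  -- needed only for the sheared field.
  have b1 := (isBoundedField_potentialField (e := e) hm hC hH hS.continuous.measurable
    hS.norm_le).smul (c := fun t => -(e * deriv θ (t / ε) / ε)) (c₀ := |e| * c₁ / |ε|)
    (by fun_prop : Continuous fun t => -(e * deriv θ (t / ε) / ε)).measurable (fun t => by
      rw [abs_neg, abs_div, abs_mul]
      gcongr
      exact hc₁ _)
  have b2 := (isBoundedField_magneticField (e := e) hm hC hH hS.measurable
    hS.norm_deriv_le).smul (c := fun t => e / m * θ (t / ε)) (c₀ := |e / m| * c₀)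
    (by fun_prop : Continuous fun t => e / m * θ (t / ε)).measurable (fun t => by
      rw [abs_mul]
      gcongr
      exact hc₀ _)
  have key := h.shear hS hc ((b0.add b1).add b2) hH hHl hf hM hfin
  simp only [shearField_vlasov hS.continuous hθ, zero_div] at key
  exact key

/-- The solution of the averaged equation, sheared back, solves the limit equation for each value
of the fast variable. -/
lemma IsTransportSolution.shear_average (hm : 0 < m)
    (hS : IsSmoothLimit A DA C) (hH : ∀ t, 1 ≤ H t)
    (hHl : LocallyIntegrable H) (hE : Measurable (Function.uncurry E))
    (hEb : ∀ t x, ‖E t x‖ ≤ H t) (hf : StronglyMeasurable f) (hM : ∀ t, ‖f t‖ ≤ M)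
    (hfin : MemLp fin 2 volume)
    (h : IsTransportSolution (fun t z => steadyField m e E t z +
      mean T θ • firstOrderField m e A DA t z +
      mean T (fun τ => θ τ ^ 2) • secondOrderField m e A DA t z) 
      (fun z => fin (shearMap hS.continuous (-(e * θ 0)) z)) f) (s : ℝ) :
    IsTransportSolution (fun t z =>
      (limitVelocity T m e θ A s z.1 z.2, limitForce T m e θ E A DA t s z.1 z.2))
      (fun z => fin (z.1, z.2 + (e * (θ s - θ 0)) • A z.1))
      (fun t => shearOp hS.continuous (e * θ s) (f t)) := by
  have hC : 0 ≤ C := (norm_nonneg _).trans (hS.norm_le 0)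
  have b0 := isBoundedField_steadyField (e := e) hm hC hH hE hEb
  have b1 := (isBoundedField_firstOrderField (e := e) hm hC hH hS.continuous.measurable
    hS.norm_le hS.measurable hS.norm_deriv_le).smul (c := fun _ => mean T θ)
    (c₀ := |mean T θ|) measurable_const (fun _ => le_rfl)
  have b2 := (isBoundedField_secondOrderField (e := e) hm hC hH hS.continuous.measurable
    hS.norm_le hS.measurable hS.norm_deriv_le).smul (c := fun _ => mean T fun τ => θ τ ^ 2)
    (c₀ := |mean T fun τ => θ τ ^ 2|) measurable_const (fun _ => le_rfl)
  have hfin' : MemLp (fun z => fin (shearMap hS.continuous (-(e * θ 0)) z)) 2 volume :=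
    hfin.comp_measurePreserving (measurePreserving_shearMap hS.continuous _)
  have key := h.shear hS (c := fun _ => -(e * θ s)) contDiff_const ((b0.add b1).add b2) hH hHl hf hM
    hfin'
  simp only [neg_neg, shearField_average, shearMap_shearMap] at key
  have e1 : ∀ z, shearMap hS.continuous (-(e * θ 0) + e * θ s) z =
      (z.1, z.2 + (e * (θ s - θ 0)) • A z.1) := fun z => by
    rw [shearMap_apply]
    congr 3
    ring
  simp only [e1] at key
  exact key

lemma measurable_limit_field (hθ : Continuous θ) (hA : Measurable A) (hD : Measurable DA)
    (hE : Measurable (Function.uncurry E)) :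
    Measurable fun q : (ℝ × ℝ) × Phase => ((limitVelocity T m e θ A q.1.2 q.2.1 q.2.2,
      limitForce T m e θ E A DA q.1.1 q.1.2 q.2.1 q.2.2) : Phase) := by
  have hp : Measurable fun q : (ℝ × ℝ) × Phase => q.2.2 := by fun_prop
  have hA' : Measurable fun q : (ℝ × ℝ) × Phase => A q.2.1 := hA.comp (by fun_prop)
  have hD' : Measurable fun q : (ℝ × ℝ) × Phase => DA q.2.1 := hD.comp (by fun_prop)
  have hθ' : Measurable fun q : (ℝ × ℝ) × Phase => θ q.1.2 := hθ.measurable.comp (by fun_prop)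
  have hE' : Measurable fun q : (ℝ × ℝ) × Phase => E q.1.1 q.2.1 :=
    hE.comp (by fun_prop : Measurable fun q : (ℝ × ℝ) × Phase => (q.1.1, q.2.1))
  have h1 := measurable_clm_apply (measurable_adjoint hD') hp
  have h2 := measurable_clm_apply hD' hp
  have h3 := measurable_clm_apply (measurable_adjoint hD') hA'
  have h4 := measurable_clm_apply hD' hA'
  unfold limitVelocity limitForce
  refine Measurable.prodMk ?_ ?_
  · exact (hp.add (((hθ'.sub_const _).const_mul e).smul hA')).const_smul (1 / m)
  · exact (((hE'.const_smul e).add (((h1.const_smul (mean T θ)).sub (hθ'.smul h2)).const_smul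
      (e / m))).add ((((hθ'.mul_const _).sub_const _).const_mul _).smul h3)).add
      ((((hθ'.const_sub _).mul hθ').const_mul _).smul h4)

/-- Growth of the limit field, uniformly in the fast variable. -/
lemma exists_isBoundedField_limit [Fact (0 < T)] (hm : 0 < m) (hθ : ContDiff ℝ 1 θ)
    (hθT : Function.Periodic θ T) (hS : IsSmoothLimit A DA C) (hH : ∀ t, 1 ≤ H t)
    (hE : Measurable (Function.uncurry E)) (hEb : ∀ t x, ‖E t x‖ ≤ H t) :
    ∃ K : ℝ → ℝ, ∀ s, IsBoundedField H K fun t z =>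
      (limitVelocity T m e θ A s z.1 z.2, limitForce T m e θ E A DA t s z.1 z.2) := by
  have hC : 0 ≤ C := (norm_nonneg _).trans (hS.norm_le 0)
  obtain ⟨c₀, hc₀, hb⟩ := exists_bound_of_periodic (T := T) (u := fun t => e * θ t)
    (continuous_const.mul hθ.continuous) (fun t => by simp only [hθT t])
  have b0 := isBoundedField_steadyField (e := e) hm hC hH hE hEb
  have b1 := (isBoundedField_firstOrderField (e := e) hm hC hH hS.continuous.measurable
    hS.norm_le hS.measurable hS.norm_deriv_le).smul (c := fun _ => mean T θ)
    (c₀ := |mean T θ|) measurable_const (fun _ => le_rfl)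
  have b2 := (isBoundedField_secondOrderField (e := e) hm hC hH hS.continuous.measurable
    hS.norm_le hS.measurable hS.norm_deriv_le).smul (c := fun _ => mean T fun τ => θ τ ^ 2)
    (c₀ := |mean T fun τ => θ τ ^ 2|) measurable_const (fun _ => le_rfl)
  -- The limit field is a shear of the averaged field, which does not depend on `s`. Its bound is
  -- therefore uniform in `s`, because `e θ` is bounded.
  obtain ⟨Wb, hWb, K, hK⟩ : ∃ Wb : ℝ → Phase → Phase, (∀ s t z,
      ((limitVelocity T m e θ A s z.1 z.2, limitForce T m e θ E A DA t s z.1 z.2) : Phase) =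
      shearField A DA (fun _ => -(e * θ s)) Wb t (shearMap hS.continuous (e * θ s) z)) ∧
      ∃ K, IsBoundedField H K Wb :=
    ⟨_, fun s t z => (shearField_average hS.continuous s t z).symm, _, (b0.add b1).add b2⟩
  refine ⟨fun R => |K (R + c₀ * C)| * (1 + c₀ * C), fun s => ⟨?_, fun R t z hz => ?_⟩⟩
  · exact (measurable_limit_field hθ.continuous hS.continuous.measurable hS.measurable hE).comp
      (by fun_prop : Measurable fun q : ℝ × Phase => (((q.1, s), q.2) : (ℝ × ℝ) × Phase))
  · rw [hWb]
    have hz' : ‖shearMap hS.continuous (e * θ s) z‖ ≤ R + c₀ * C := by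
      have a1 : ‖(e * θ s) • A z.1‖ ≤ c₀ * C := by
        rw [norm_smul]
        exact mul_le_mul (hb s) (hS.norm_le _) (norm_nonneg _) hc₀
      have a2 : 0 ≤ c₀ * C := by positivity
      have a3 : ‖z.1‖ ≤ R + c₀ * C := by linarith [(norm_fst_le z).trans hz]
      have a4 : ‖z.2 + (e * θ s) • A z.1‖ ≤ R + c₀ * C :=
        (norm_add_le _ _).trans (add_le_add ((norm_snd_le z).trans hz) a1)
      rw [shearMap_apply, Prod.norm_def]
      exact max_le a3 a4
    have hHt : 0 ≤ H t := by linarith [hH t]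
    have hw : ‖Wb t (shearMap hS.continuous (e * θ s) z)‖ ≤ |K (R + c₀ * C)| * H t :=
      (hK.bound _ t _ hz').trans (mul_le_mul_of_nonneg_right (le_abs_self _) hHt)
    refine (norm_shearField_le (c₀ := c₀) (c₁ := 0) hS.norm_le hS.norm_deriv_le
      (by rw [abs_neg]; exact hb s) (by rw [deriv_const, abs_zero]) hw).trans (le_of_eq ?_)
    ring

end Conversion

/-! ### Integration of the weak formulations over the fast variable. -/

section FastVariable

variable {T M : ℝ} {H K : ℝ → ℝ}

/-- A test function of the limit problem, frozen at a value of the fast variable. -/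
lemma fderiv_freeze {φ : ℝ × ℝ × E3 × E3 → ℝ} (hφ : ContDiff ℝ 1 φ) (s t : ℝ) (z w : Phase)
    (a : ℝ) : fderiv ℝ (fun q : ℝ × Phase => φ (q.1, s, q.2)) (t, z) (a, w) =
      fderiv ℝ φ (t, s, z) (a, 0, w) := by
  have d1 : HasFDerivAt (fun q : ℝ × Phase => q.1) (ContinuousLinearMap.fst ℝ ℝ Phase) (t, z) :=
    hasFDerivAt_fst
  have d2 : HasFDerivAt (fun q : ℝ × Phase => q.2) (ContinuousLinearMap.snd ℝ ℝ Phase) (t, z) :=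
    hasFDerivAt_snd
  have d3 := ((hφ.differentiable (by simp) (t, s, z)).hasFDerivAt).comp (t, z)
    (d1.prodMk ((hasFDerivAt_const s (t, z)).prodMk d2))
  have e : (fun q : ℝ × Phase => φ (q.1, s, q.2)) =
    φ ∘ (fun q : ℝ × Phase => (q.1, s, q.2)) := rfl
  rw [e]
  erw [d3.fderiv]
  rfl

/-- The weak formulations for all values of the fast variable may be integrated. -/
lemma integral_weak_formulation (hT : 0 < T) (hH : ∀ t, 1 ≤ H t) (hHl : LocallyIntegrable H)
    {Wl : ℝ → ℝ → Phase → Phase}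
    (hWm : Measurable fun q : (ℝ × ℝ) × Phase => Wl q.1.2 q.1.1 q.2)
    (hW : ∀ s, IsBoundedField H K (Wl s)) {g : ℝ → ℝ → L2Phase}
    (hg : StronglyMeasurable fun q : ℝ × ℝ => g q.2 q.1) (hM : ∀ s t, ‖g s t‖ ≤ M)
    {fins : ℝ → Phase → ℝ} (h : ∀ s, IsTransportSolution (Wl s) (fins s) (g s))
    {φ : ℝ × ℝ × E3 × E3 → ℝ} (hφ : ContDiff ℝ 1 φ) {Kc : Set (ℝ × E3 × E3)} (hKc : IsCompact Kc)
    (hφK : ∀ t s x p, (t, x, p) ∉ Kc → φ (t, s, x, p) = 0) :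
    (∫ s in (0 : ℝ)..T, ∫ z : Phase, fins s z * φ (0, s, z)) +
      ∫ t in Ioi (0 : ℝ), ∫ s in (0 : ℝ)..T, ∫ z : Phase, g s t z *
        fderiv ℝ φ (t, s, z) (1, 0, Wl s t z) = 0 := by
  have hM0 : 0 ≤ M := (norm_nonneg _).trans (hM 0 0)
  have hcf : Continuous (fderiv ℝ φ) := hφ.continuous_fderiv (by simp)
  obtain ⟨R₀, hR₀⟩ := hKc.isBounded.subset_closedBall 0
  set R := max R₀ 0 with hR
  have hzero : ∀ t s (z : Phase), R < ‖((t, z) : ℝ × Phase)‖ → φ (t, s, z) = 0 := fun t s z hz =>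
    hφK t s z.1 z.2 fun hm => by
      have := hR₀ hm
      rw [mem_closedBall_zero_iff] at this
      exact absurd ((le_max_left R₀ 0).trans_lt hz) (not_lt.2 this)
  have hdzero : ∀ t s (z : Phase), R < ‖((t, z) : ℝ × Phase)‖ → fderiv ℝ φ (t, s, z) = 0 := by
    intro t s z hz
    have hopen : IsOpen {q : ℝ × ℝ × E3 × E3 | R < ‖((q.1, q.2.2) : ℝ × Phase)‖} :=
      isOpen_lt continuous_const (by fun_prop)
    have he : φ =ᶠ[𝓝 (t, s, z)] fun _ => 0 := by
      filter_upwards [hopen.mem_nhds hz] with q hq using hzero q.1 q.2.1 q.2.2 hq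
    rw [he.fderiv_eq]
    simp
  -- The constant must be uniform for `s` in a bounded interval, to give joint integrability in `(t,
  -- s)` over a period.
  have hdens : ∀ S : ℝ, ∃ κ : ℝ, ∀ s, |s| ≤ S →
      IsTestDensity H R κ fun t z => fderiv ℝ φ (t, s, z) (1, 0, Wl s t z) := by
    intro S
    obtain ⟨D, hD⟩ := (isCompact_closedBall (0 : ℝ × ℝ × E3 × E3)
      (max R S)).exists_bound_of_continuousOn hcf.continuousOn
    refine ⟨|D| * (1 + |K R|), fun s hs => ⟨?_, fun t z => ?_, fun t z ht => ?_, fun t z hz => ?_⟩⟩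
    · have h1 : Continuous fun q : ℝ × Phase => fderiv ℝ φ (q.1, s, q.2) :=
        hcf.comp (by fun_prop)
      exact (by fun_prop : Continuous fun r : (ℝ × ℝ × E3 × E3 →L[ℝ] ℝ) × (ℝ × ℝ × E3 × E3) =>
        r.1 r.2).measurable.comp (h1.measurable.prodMk
          (measurable_const.prodMk (measurable_const.prodMk (hW s).measurable)))
    · have hHt := hH t
      by_cases hz : ‖((t, z) : ℝ × Phase)‖ ≤ R
      · have h1 : ‖fderiv ℝ φ (t, s, z)‖ ≤ |D| := by
          refine (hD _ ?_).trans (le_abs_self D)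
          rw [mem_closedBall_zero_iff]
          refine (Prod.norm_def _).trans_le (max_le ?_ ((Prod.norm_def _).trans_le (max_le ?_ ?_)))
          · exact ((norm_fst_le ((t, z) : ℝ × Phase)).trans hz).trans (le_max_left _ _)
          · exact hs.trans (le_max_right _ _)
          · exact ((norm_snd_le ((t, z) : ℝ × Phase)).trans hz).trans (le_max_left _ _)
        have h2 : ‖Wl s t z‖ ≤ |K R| * H t :=
          ((hW s).bound R t z ((norm_snd_le ((t, z) : ℝ × Phase)).trans hz)).trans
            (mul_le_mul_of_nonneg_right (le_abs_self _) (by linarith))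
        have hk := abs_nonneg (K R)
        have h3 : ‖((1, 0, Wl s t z) : ℝ × ℝ × E3 × E3)‖ ≤ (1 + |K R|) * H t := by
          refine (Prod.norm_def _).trans_le (max_le ?_ ((Prod.norm_def _).trans_le (max_le ?_ ?_)))
          · rw [norm_one]; nlinarith
          · rw [norm_zero]; nlinarith
          · refine h2.trans ?_; nlinarith
        rw [← Real.norm_eq_abs, mul_assoc]
        exact (ContinuousLinearMap.le_opNorm _ _).trans
          (mul_le_mul h1 h3 (norm_nonneg _) (abs_nonneg _))
      · rw [hdzero t s z (not_le.1 hz)]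
        simp only [zero_apply, abs_zero]
        have : 0 ≤ H t := by linarith
        positivity
    · rw [hdzero t s z (ht.trans_le (norm_fst_le ((t, z) : ℝ × Phase)))]; rfl
    · rw [hdzero t s z (hz.trans_le (norm_snd_le ((t, z) : ℝ × Phase)))]; rfl
  set Q : ℝ → ℝ → ℝ := fun t s => ∫ z : Phase, g s t z *
    fderiv ℝ φ (t, s, z) (1, 0, Wl s t z) with hQ
  have hQm : StronglyMeasurable (Function.uncurry Q) := by
    refine stronglyMeasurable_integral_mul (α := ℝ × ℝ) (F := fun q => g q.2 q.1)
      (G := fun q z => fderiv ℝ φ (q.1, q.2, z) (1, 0, Wl q.2 q.1 z)) hg ?_ fun q => ?_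
    · have h1 : Continuous fun q : (ℝ × ℝ) × Phase => fderiv ℝ φ (q.1.1, q.1.2, q.2) :=
        hcf.comp (by fun_prop)
      exact (by fun_prop : Continuous fun r : (ℝ × ℝ × E3 × E3 →L[ℝ] ℝ) × (ℝ × ℝ × E3 × E3) =>
        r.1 r.2).measurable.comp (h1.measurable.prodMk
          (measurable_const.prodMk (measurable_const.prodMk hWm)))
    · obtain ⟨κ, hκ⟩ := hdens |q.2|
      exact (hκ q.2 le_rfl).memLp q.1
  obtain ⟨κ, hκ⟩ := hdens T
  have hQi : Integrable (Function.uncurry Q)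
      ((volume.restrict (Ioi (0 : ℝ))).prod (volume.restrict (Ioc 0 T))) := by
    have hb : Integrable (fun q : ℝ × ℝ =>
        (Icc (-R) R).indicator (fun t => M * (κ * H t * ballNorm R)) q.1)
        ((volume.restrict (Ioi (0 : ℝ))).prod (volume.restrict (Ioc 0 T))) :=
      ((IsTestDensity.integrable_bound hHl R M κ).restrict (s := Ioi (0 : ℝ))).comp_fst _
    refine hb.mono' hQm.aestronglyMeasurable ?_
    rw [Measure.prod_restrict]
    refine (ae_restrict_iff' (measurableSet_Ioi.prod measurableSet_Ioc)).2
      (Eventually.of_forall fun q hq => ?_)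
    have hs : |q.2| ≤ T := by rw [abs_of_pos hq.2.1]; exact hq.2.2
    exact (hκ q.2 hs).abs_pairing_le (g q.2 q.1) (hM _ _) q.1
  -- After Fubini the inner time integral is the weak formulation at frozen `s`, tested with `φ(·,
  -- s, ·)`.
  have hswap : ∫ t in Ioi (0 : ℝ), ∫ s in (0 : ℝ)..T, Q t s =
      ∫ s in (0 : ℝ)..T, ∫ t in Ioi (0 : ℝ), Q t s := by
    simp only [intervalIntegral.integral_of_le hT.le]
    exact integral_integral_swap hQi
  have hs : ∀ s, ∫ t in Ioi (0 : ℝ), Q t s = - ∫ z : Phase, fins s z * φ (0, s, z) := by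
    intro s
    have h1 := h s (fun q => φ (q.1, s, q.2)) (hφ.comp (by fun_prop))
      (HasCompactSupport.intro (isCompact_closedBall 0 R) fun q hq => hzero q.1 s q.2 (by
        rw [mem_closedBall_zero_iff, not_le] at hq
        exact hq))
    simp only [fderiv_freeze hφ] at h1
    have h2 : ∫ t in Ioi (0 : ℝ), Q t s = ∫ t in Ioi (0 : ℝ), ∫ z : Phase, g s t z *
      fderiv ℝ φ (t, s, z) (1, 0, Wl s t z) := rfl
    rw [h2]
    linarith
  have hfinal : ∫ t in Ioi (0 : ℝ), ∫ s in (0 : ℝ)..T, ∫ z : Phase, g s t z *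
      fderiv ℝ φ (t, s, z) (1, 0, Wl s t z) = ∫ t in Ioi (0 : ℝ), ∫ s in (0 : ℝ)..T, Q t s := rfl
  rw [hfinal, hswap]
  simp only [hs]
  rw [intervalIntegral.integral_neg, add_neg_cancel]

end FastVariable

/-! ### Two-scale profiles and two-scale convergence. -/

section Profile

variable {T e : ℝ} {A : E3 → E3}

lemma Continuous.shearOp {X : Type*} [TopologicalSpace X] (hA : Continuous A) {c : X → ℝ}
    {v : X → L2Phase} (hc : Continuous c) (hv : Continuous v) :
    Continuous fun x => _root_.shearOp hA (c x) (v x) :=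
  (continuous_shearOp hA).comp (hc.prodMk hv)

lemma MeasureTheory.AEStronglyMeasurable.shearOp {X : Type*} [MeasurableSpace X] {μ : Measure X}
    (hA : Continuous A) {c : X → ℝ} {v : X → L2Phase} (hc : AEStronglyMeasurable c μ)
    (hv : AEStronglyMeasurable v μ) : AEStronglyMeasurable (fun x => _root_.shearOp hA (c x) (v x)) μ :=
  Continuous.comp_aestronglyMeasurable (g := fun q : ℝ × L2Phase => _root_.shearOp hA q.1 q.2)
    (f := fun x => (c x, v x)) (continuous_shearOp hA) (hc.prodMk hv)

lemma continuous_shearOp_profile (hA : Continuous A) (e : ℝ) (θc : C(AddCircle T, ℝ)) :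
    Continuous fun q : L2Phase × AddCircle T => shearOp hA (e * θc q.2) q.1 :=
  Continuous.shearOp hA (continuous_const.mul (θc.continuous.comp continuous_snd)) continuous_fst

variable [hT : Fact (0 < T)]

/-- The profile `s ↦ v(x, p + e θ(s) A(x))`. -/
def profile (hA : Continuous A) (e : ℝ) (θc : C(AddCircle T, ℝ)) (v : L2Phase) : CPer T where
  toFun σ := shearOp hA (e * θc σ) v
  continuous_toFun := Continuous.shearOp hA (continuous_const.mul θc.continuous) continuous_const

lemma continuous_profile (hA : Continuous A) (θc : C(AddCircle T, ℝ)) :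
    Continuous (profile hA e θc) :=
  ContinuousMap.continuous_of_continuous_uncurry _ (continuous_shearOp_profile hA e θc)

lemma norm_profile_le (hA : Continuous A) (θc : C(AddCircle T, ℝ)) (v : L2Phase) :
    ‖profile hA e θc v‖ ≤ ‖v‖ :=
  (ContinuousMap.norm_le _ (norm_nonneg _)).2 fun _ => (norm_shearOp hA _ v).le

/-- The pointwise inner product of two periodic `L²`-valued functions. -/
def innerPer (u v : CPer T) : C(AddCircle T, ℝ) := ⟨fun σ => inner ℝ (u σ) (v σ), by fun_prop⟩

lemma continuous_innerPer : Continuous fun q : CPer T × CPer T => innerPer q.1 q.2 :=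
  ContinuousMap.continuous_of_continuous_uncurry _ (by
    change Continuous fun q : (CPer T × CPer T) × AddCircle T =>
      (inner ℝ (q.1.1 q.2) (q.1.2 q.2) : ℝ)
    fun_prop)

lemma norm_innerPer_le (u v : CPer T) : ‖innerPer u v‖ ≤ ‖u‖ * ‖v‖ :=
  (ContinuousMap.norm_le _ (by positivity)).2 fun σ => (norm_inner_le_norm _ _).trans
    (mul_le_mul (u.norm_coe_le_norm σ) (v.norm_coe_le_norm σ) (norm_nonneg _) (norm_nonneg _))

/-- The profile as a square integrable function of the fast variable. -/
def profileLp (hA : Continuous A) (e : ℝ) (θc : C(AddCircle T, ℝ)) (v : L2Phase) : L2Per T :=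
  ContinuousMap.toLp 2 volume ℝ (profile hA e θc v)

lemma continuous_profileLp (hA : Continuous A) (θc : C(AddCircle T, ℝ)) :
    Continuous (profileLp hA e θc) :=
  (ContinuousMap.toLp 2 volume ℝ).continuous.comp (continuous_profile hA θc)

lemma norm_profileLp_le (hA : Continuous A) (θc : C(AddCircle T, ℝ)) (v : L2Phase) :
    ‖profileLp hA e θc v‖ ≤
      ‖(ContinuousMap.toLp 2 volume ℝ : CPer T →L[ℝ] L2Per T)‖ * ‖v‖ :=
  (ContinuousLinearMap.le_opNorm _ _).trans
    (mul_le_mul_of_nonneg_left (norm_profile_le hA θc v) (norm_nonneg _))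

/-- An `L²` class on the circle is known only almost everywhere; the quotient map preserves measure
on `(0, T]`, so the identity transfers to real `s`. -/
lemma ae_profileLp_eq (hA : Continuous A) (θc : C(AddCircle T, ℝ)) (v : L2Phase) :
    ∀ᵐ s : ℝ, s ∈ Ioc 0 T →
      profileLp hA e θc v (s : AddCircle T) = shearOp hA (e * θc (s : AddCircle T)) v := by
  have h1 : profileLp hA e θc v =ᵐ[volume] profile hA e θc v :=
    ContinuousMap.coeFn_toLp volume (profile hA e θc v)
  have h2 := (AddCircle.measurePreserving_mk T 0).quasiMeasurePreserving.ae h1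
  rw [zero_add] at h2
  exact (ae_restrict_iff' measurableSet_Ioc).1 h2

/-- Two-scale convergence of the sheared sequence of a sequence that converges weakly at almost
every time. -/
lemma twoScaleConverges_of_weak {M I : ℝ} (hA : Continuous A) (θc : C(AddCircle T, ℝ))
    {F : ℕ → ℝ → L2Phase} {F₀ : ℝ → L2Phase} {εs : ℕ → ℝ}
    (hF : ∀ n, StronglyMeasurable (F n)) (hM : ∀ n t, ‖F n t‖ ≤ M)
    (hF₀ : StronglyMeasurable F₀) (hM₀ : ∀ t, ‖F₀ t‖ ≤ M)
    (hw : ∀ᵐ t, 0 < t → ∀ x, Tendsto (fun k => (inner ℝ (F k t) x : ℝ)) atTop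
      (𝓝 (inner ℝ (F₀ t) x)))
    (hpos : ∀ n, 0 < εs n) (hlim : Tendsto εs atTop (𝓝 0)) {f : ℕ → ℝ → L2Phase}
    (hf : ∀ n, ∀ᵐ t, 0 < t → f n t = shearOp hA (e * θc ((t / εs n : ℝ) : AddCircle T)) (F n t)) :
    TwoScaleConverges T I εs f (fun t => profileLp hA e θc (F₀ t)) := by
  intro φ hφ
  have hM0 : 0 ≤ M := (norm_nonneg _).trans (hM₀ 0)
  have hφi : Integrable φ (volume.restrict (Icc 0 I)) := hφ.integrable (by norm_num)
  have h0 : ∀ᵐ t ∂volume.restrict (Icc 0 I), 0 < t := by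
    refine (ae_restrict_iff' measurableSet_Icc).2 ?_
    filter_upwards [Measure.ae_ne volume (0 : ℝ)] with t ht h1
    exact lt_of_le_of_ne h1.1 (Ne.symm ht)
  set P : ℝ → C(AddCircle T, ℝ) := fun t => innerPer (profile hA e θc (F₀ t)) (φ t) with hP
  have hPm : AEStronglyMeasurable P (volume.restrict (Icc 0 I)) :=
    continuous_innerPer.comp_aestronglyMeasurable
      (((continuous_profile hA θc).comp_aestronglyMeasurable
        hF₀.aestronglyMeasurable).prodMk hφ.1)
  have hPb : ∀ t, ‖P t‖ ≤ M * ‖φ t‖ := fun t => (norm_innerPer_le _ _).trans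
    (mul_le_mul_of_nonneg_right ((norm_profile_le hA θc _).trans (hM₀ t)) (norm_nonneg _))
  have hPi : Integrable P (volume.restrict (Icc 0 I)) :=
    (hφi.norm.const_mul M).mono' hPm (Eventually.of_forall hPb)
  have hmk : ∀ n, Continuous fun t : ℝ => ((t / εs n : ℝ) : AddCircle T) := fun n =>
    AddCircle.continuous_mk' T |>.comp (by fun_prop)
  -- With `F n` replaced by `F₀`, the integrand is `P(t, t/ε)` for a fixed integrable map `P` into
  -- the continuous periodic functions, and it averages.
  have hosc : Tendsto (fun n => ∫ t in Icc 0 I, P t ((t / εs n : ℝ) : AddCircle T)) atTop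
      (𝓝 (∫ t in Icc 0 I, periodMean (P t))) := by
    have := tendsto_integral_eval hpos hlim
      ((integrable_indicator_iff (f := P) measurableSet_Icc).2 hPi)
    have e1 : ∀ t, periodMean ((Icc 0 I).indicator P t) =
        (Icc 0 I).indicator (fun t => periodMean (P t)) t := fun t => by
      by_cases ht : t ∈ Icc 0 I
      · simp only [indicator_of_mem ht]
      · simp only [indicator_of_notMem ht]
        simp [periodMean]
    simp only [e1] at this
    rw [integral_indicator measurableSet_Icc] at this
    refine this.congr fun n => ?_
    rw [← integral_indicator measurableSet_Icc]
    congr 1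
    ext t
    by_cases ht : t ∈ Icc 0 I <;> simp [ht]
  have hev : ∀ n, AEStronglyMeasurable (fun t => φ t ((t / εs n : ℝ) : AddCircle T))
      (volume.restrict (Icc 0 I)) := fun n =>
    (continuous_eval (F := CPer T)).comp_aestronglyMeasurable
      (hφ.1.prodMk (hmk n).aestronglyMeasurable)
  have hPev : ∀ n, AEStronglyMeasurable (fun t => P t ((t / εs n : ℝ) : AddCircle T))
      (volume.restrict (Icc 0 I)) := fun n =>
    (continuous_eval (F := C(AddCircle T, ℝ))).comp_aestronglyMeasurable
      (hPm.prodMk (hmk n).aestronglyMeasurable)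
  have hsm : ∀ n, AEStronglyMeasurable (fun t =>
      shearOp hA (e * θc ((t / εs n : ℝ) : AddCircle T)) (F n t)) (volume.restrict (Icc 0 I)) :=
    fun n => AEStronglyMeasurable.shearOp hA
      (continuous_const.mul (θc.continuous.comp (hmk n))).aestronglyMeasurable
      (hF n).aestronglyMeasurable
  have hdiff : Tendsto (fun n => ∫ t in Icc 0 I,
      ((inner ℝ (shearOp hA (e * θc ((t / εs n : ℝ) : AddCircle T)) (F n t))
        (φ t ((t / εs n : ℝ) : AddCircle T)) : ℝ) - P t ((t / εs n : ℝ) : AddCircle T))) atTop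
      (𝓝 0) := by
    refine Eq.subst (motive := fun a => Tendsto _ atTop (𝓝 a))
      (integral_zero ℝ ℝ (μ := volume.restrict (Icc 0 I))) ?_
    refine tendsto_integral_of_dominated_convergence (fun t => M * ‖φ t‖ + M * ‖φ t‖)
      (fun n => ?_) ((hφi.norm.const_mul M).add (hφi.norm.const_mul M)) (fun n => ?_) ?_
    · exact AEStronglyMeasurable.sub (AEStronglyMeasurable.inner (hsm n) (hev n)) (hPev n)
    · refine Eventually.of_forall fun t => (norm_sub_le _ _).trans (add_le_add ?_ ?_)
      · refine (norm_inner_le_norm _ _).trans (mul_le_mul ?_ ((φ t).norm_coe_le_norm _)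
          (norm_nonneg _) hM0)
        rw [norm_shearOp]
        exact hM n t
      · exact ((P t).norm_coe_le_norm _).trans (hPb t)
    · filter_upwards [h0, ae_restrict_of_ae hw] with t ht hwt
      -- Moving the shear onto `φ` leaves `F n t - F₀ t` paired with points of a continuous image of
      -- the circle. This image is compact, so weak convergence is uniform on it although the phase
      -- `t/ε` does not converge.
      have hcont : Continuous fun σ : AddCircle T => shearOp hA (-(e * θc σ)) (φ t σ) :=
        Continuous.shearOp hA (continuous_const.mul θc.continuous).neg (φ t).continuous
      refine (tendsto_inner_of_mem_compact (fun n => hM n t) (hwt ht) (isCompact_range hcont)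
        (k := fun n => shearOp hA (-(e * θc ((t / εs n : ℝ) : AddCircle T)))
          (φ t ((t / εs n : ℝ) : AddCircle T))) fun n => mem_range_self _).congr fun n => ?_
      rw [← inner_shearOp, ← inner_shearOp]
      rfl
  have hsi : ∀ n, Integrable (fun t => P t ((t / εs n : ℝ) : AddCircle T))
      (volume.restrict (Icc 0 I)) := fun n =>
    (hφi.norm.const_mul M).mono' (hPev n)
      (Eventually.of_forall fun t => ((P t).norm_coe_le_norm _).trans (hPb t))
  have hsj : ∀ n, Integrable (fun t =>
      (inner ℝ (shearOp hA (e * θc ((t / εs n : ℝ) : AddCircle T)) (F n t))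
        (φ t ((t / εs n : ℝ) : AddCircle T)) : ℝ)) (volume.restrict (Icc 0 I)) := fun n => by
    refine (hφi.norm.const_mul M).mono' (AEStronglyMeasurable.inner ?_ (hev n))
      (Eventually.of_forall fun t => ?_)
    · exact hsm n
    · refine (norm_inner_le_norm _ _).trans (mul_le_mul ?_ ((φ t).norm_coe_le_norm _)
          (norm_nonneg _) hM0)
      rw [norm_shearOp]
      exact hM n t
  have hlimit : ∫ t in Icc 0 I, periodMean (P t) = ∫ t in Icc 0 I, (1 / T) *
      ∫ s in (0 : ℝ)..T, inner ℝ (profileLp hA e θc (F₀ t) (s : AddCircle T))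
        (φ t (s : AddCircle T)) := by
    congr 1
    ext t
    change (1 / T) * (∫ s in (0 : ℝ)..T, P t (s : AddCircle T)) = _
    congr 1
    refine intervalIntegral.integral_congr_ae ?_
    rw [uIoc_of_le hT.out.le]
    filter_upwards [ae_profileLp_eq (e := e) hA θc (F₀ t)] with s hs hsT
    rw [hs hsT]
    rfl
  rw [← hlimit]
  have hsum := hdiff.add hosc
  rw [zero_add] at hsum
  refine hsum.congr fun n => ?_
  refine (integral_add ((hsj n).sub (hsi n)) (hsi n)).symm.trans (integral_congr_ae ?_)
  filter_upwards [h0, ae_restrict_of_ae (hf n)] with t ht hft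
  rw [hft ht]
  exact sub_add_cancel _ _

end Profile

lemma MeasureTheory.StronglyMeasurable.shearOp {A : E3 → E3} {X : Type*} [MeasurableSpace X]
    (hA : Continuous A) {c : X → ℝ} {v : X → L2Phase} (hc : StronglyMeasurable c)
    (hv : StronglyMeasurable v) : StronglyMeasurable fun x => _root_.shearOp hA (c x) (v x) :=
  Continuous.comp_stronglyMeasurable (g := fun q : ℝ × L2Phase => _root_.shearOp hA q.1 q.2)
    (f := fun x => (c x, v x)) (continuous_shearOp hA) (hc.prodMk hv)

/-! ### The limit equation in terms of the original coefficients. -/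

section Limit

variable {T m e : ℝ} [hT : Fact (0 < T)] {θ : ℝ → ℝ} {E E' : ℝ → E3 → E3} {A A' : E3 → E3}
  {DA DA' : E3 → E3 →L[ℝ] E3} {fin : Phase → ℝ}

/-- The limit equation for the profiles of `F₀`, with representatives of the coefficients. -/
lemma isWeakLimitSolution_profileLp (hθ : Continuous θ) (hθT : Function.Periodic θ T)
    (hA' : Continuous A') (hA : A' =ᵐ[volume] A) (hD : DA' =ᵐ[volume] DA)
    (hE : ∀ᵐ t : ℝ, 0 < t → E' t =ᵐ[volume] E t) {F₀ : ℝ → L2Phase}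
    (h : ∀ φ : ℝ × ℝ × E3 × E3 → ℝ, ContDiff ℝ 1 φ → ∀ K : Set (ℝ × E3 × E3), IsCompact K →
      (∀ t s x p, (t, x, p) ∉ K → φ (t, s, x, p) = 0) →
      (∫ s in (0 : ℝ)..T, ∫ z : Phase,
          fin (z.1, z.2 + (e * (θ s - θ 0)) • A' z.1) * φ (0, s, z)) +
        ∫ t in Ioi (0 : ℝ), ∫ s in (0 : ℝ)..T, ∫ z : Phase, shearOp hA' (e * θ s) (F₀ t) z *
          fderiv ℝ φ (t, s, z) (1, 0, limitVelocity T m e θ A' s z.1 z.2,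
            limitForce T m e θ E' A' DA' t s z.1 z.2) = 0) :
    IsWeakLimitSolution T m e θ E A DA fin
      (fun t => profileLp hA' e (periodicLift hθ hθT) (F₀ t)) := by
  intro φ hφ _ ⟨K, hK, hφK⟩
  have hfst : ∀ {p : E3 → Prop}, (∀ᵐ x, p x) → ∀ᵐ z : Phase, p z.1 := fun hp =>
    Measure.quasiMeasurePreserving_fst.ae hp
  have h1 : ∫ s in (0 : ℝ)..T, ∫ z : Phase,
        fin (z.1, z.2 + (e * (θ s - θ 0)) • A z.1) * φ (0, s, z.1, z.2) =
      ∫ s in (0 : ℝ)..T, ∫ z : Phase,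
        fin (z.1, z.2 + (e * (θ s - θ 0)) • A' z.1) * φ (0, s, z) := by
    congr 1
    ext s
    refine integral_congr_ae ?_
    filter_upwards [hfst hA] with z hz
    rw [hz]
  have h2 : ∫ t in Ioi (0 : ℝ), ∫ s in (0 : ℝ)..T, ∫ z : Phase,
        profileLp hA' e (periodicLift hθ hθT) (F₀ t) (s : AddCircle T) z *
          fderiv ℝ φ (t, s, z.1, z.2) (1, 0, limitVelocity T m e θ A s z.1 z.2,
            limitForce T m e θ E A DA t s z.1 z.2) =
      ∫ t in Ioi (0 : ℝ), ∫ s in (0 : ℝ)..T, ∫ z : Phase, shearOp hA' (e * θ s) (F₀ t) z *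
        fderiv ℝ φ (t, s, z) (1, 0, limitVelocity T m e θ A' s z.1 z.2,
          limitForce T m e θ E' A' DA' t s z.1 z.2) := by
    refine setIntegral_congr_ae measurableSet_Ioi ?_
    filter_upwards [hE] with t hEt ht
    refine intervalIntegral.integral_congr_ae ?_
    rw [uIoc_of_le hT.out.le]
    filter_upwards [ae_profileLp_eq (e := e) hA' (periodicLift hθ hθT) (F₀ t)] with s hs hsT
    rw [hs hsT]
    refine integral_congr_ae ?_
    filter_upwards [hfst hA, hfst hD, hfst (hEt ht)] with z hz1 hz2 hz3
    simp only [limitVelocity, limitForce, hz1, hz2, hz3]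
    rfl
  rw [h1, h2]
  linarith [h φ hφ K hK hφK]

end Limit

/-! ### Proof of the theorem. -/

theorem mainTheorem5 (T m e : ℝ) [Fact (0 < T)] (hm : 0 < m)
    (θ : ℝ → ℝ) (hθ : ContDiff ℝ 1 θ) (hθT : Function.Periodic θ T)
    (E : ℝ → E3 → E3) (hE : IsL1locLinf E)
    (A : E3 → E3) (DA : E3 → E3 →L[ℝ] E3) (hA : IsW1inf A DA)
    (B : E3 → ℝ) (b : E3 → E3) (hB : ∀ x, 0 < B x) (hb : ∀ x, ‖b x‖ = 1)
    (hcurl : ∀ᵐ x : E3, curlOf (DA x) = B x • b x)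
    (hdiv : ∀ᵐ x : E3, divOf (DA x) = 0)
    (fin : Phase → ℝ) (hfin : MemLp fin 2 (volume : Measure Phase))
    (f : ℝ → ℝ → L2Phase)
    (hf : ∀ ε > 0, MemLp (f ε) ⊤ (volume.restrict (Ici (0 : ℝ))))
    (hbdd : ∃ C : ℝ, ∀ ε > 0, ∀ᵐ t ∂(volume.restrict (Ici (0 : ℝ))), ‖f ε t‖ ≤ C)
    (hsol : ∀ ε > 0, IsWeakVlasovSolution m e θ E A B b ε fin (f ε)) :
    ∃ εs : ℕ → ℝ, (∀ n, 0 < εs n) ∧ StrictAnti εs ∧ Tendsto εs atTop (𝓝 0) ∧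
      ∃ f₀ : ℝ → L2Per T,
        MemLp f₀ ⊤ (volume.restrict (Ici (0 : ℝ))) ∧
        (∀ I > 0, TwoScaleConverges T I εs (fun n => f (εs n)) f₀) ∧
        IsWeakLimitSolution T m e θ E A DA fin f₀ := by
  obtain ⟨A', DA', C, hA', hD', hS⟩ := hA.exists_isSmoothLimit
  obtain ⟨E', H, hE'm, hH, hHl, hE'b, hE'⟩ := hE.exists_rep
  obtain ⟨M₁, hM₁⟩ := hbdd
  set M := max M₁ 0 with hMdef
  have hθc := hθ.continuous
  have hC : 0 ≤ C := (norm_nonneg _).trans (hS.norm_le 0)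
  have hrep : ∀ ε : ℝ, ∃ f' : ℝ → L2Phase, 0 < ε → StronglyMeasurable f' ∧
      (∀ᵐ t, 0 < t → f' t = f ε t) ∧ ∀ t, ‖f' t‖ ≤ M := by
    intro ε
    by_cases hε : 0 < ε
    · obtain ⟨f', h1, h2, h3⟩ := exists_measurable_bounded_rep (hf ε hε).1 (le_max_right M₁ 0)
        ((hM₁ ε hε).mono fun t ht => ht.trans (le_max_left _ _))
      refine ⟨f', fun _ => ⟨h1, ?_, h3⟩⟩
      filter_upwards [(ae_restrict_iff' measurableSet_Ici).1 h2] with t ht ht0 using ht ht0.le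
    · exact ⟨0, fun h => absurd h hε⟩
  choose f' hf' using hrep
  set ε : ℕ → ℝ := fun n => 1 / ((n : ℝ) + 1) with hεdef
  have hε : ∀ n, 0 < ε n := fun n => Nat.one_div_pos_of_nat
  have hεlim : Tendsto ε atTop (𝓝 0) := tendsto_one_div_add_atTop_nhds_zero_nat
  have hεanti : StrictAnti ε := fun i j hij => Nat.one_div_lt_one_div hij
  -- The sheared densities, free of fast oscillation at leading order; they all start from the same
  -- initial value, `fin` sheared by `-e θ(0)`.
  set F : ℕ → ℝ → L2Phase := fun n t => shearOp hS.continuous (-(e * θ (t / ε n))) (f' (ε n) t)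
    with hF
  have hFm : ∀ n, StronglyMeasurable (F n) := fun n => by
    have h1 : StronglyMeasurable fun t : ℝ => -(e * θ (t / ε n)) :=
      (by fun_prop : Continuous fun t : ℝ => -(e * θ (t / ε n))).stronglyMeasurable
    exact StronglyMeasurable.shearOp hS.continuous h1 (hf' _ (hε n)).1
  have hFb : ∀ n t, ‖F n t‖ ≤ M := fun n t =>
    (norm_shearOp _ _ _).trans_le ((hf' _ (hε n)).2.2 t)
  have hFsol : ∀ n, IsTransportSolution (fun t z => steadyField m e E' t z +
      θ (t / ε n) • firstOrderField m e A' DA' t z +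
      θ (t / ε n) ^ 2 • secondOrderField m e A' DA' t z)
      (fun z => fin (shearMap hS.continuous (-(e * θ 0)) z)) (F n) := fun n =>
    ((hsol _ (hε n)).isTransportSolution hA' hD' hE' (hf' _ (hε n)).2.1 hcurl).shear_vlasov hm hθ
      hθT hS hH hHl hE'm hE'b (hf' _ (hε n)).1 (hf' _ (hε n)).2.2 hfin
  obtain ⟨c₀, hc₀, hθb⟩ := exists_bound_of_periodic hθc hθT
  have hV₀ := isBoundedField_steadyField (e := e) hm hC hH hE'm hE'b
  have hV₁ := isBoundedField_firstOrderField (e := e) hm hC hH hS.continuous.measurable hS.norm_le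
    hS.measurable hS.norm_deriv_le
  have hV₂ := isBoundedField_secondOrderField (e := e) hm hC hH hS.continuous.measurable hS.norm_le
    hS.measurable hS.norm_deriv_le
  -- The bound involves only `sup |θ|`, so it is the same for every `n`, as the compactness argument
  -- requires.
  have hW := fun n => (hV₀.add (hV₁.smul (c := fun t => θ (t / ε n)) (by fun_prop)
    (fun t => hθb _))).add (hV₂.smul (c := fun t => θ (t / ε n) ^ 2) (c₀ := c₀ ^ 2) (by fun_prop)
      (fun t => by rw [abs_pow]; exact pow_le_pow_left₀ (abs_nonneg _) (hθb _) 2))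
  obtain ⟨ns, hns, F₀, hF₀m, hF₀b, hw⟩ := exists_subseq_weak_tendsto hFsol hW hHl hFm hFb
  have hpos : ∀ n, 0 < ε (ns n) := fun n => hε _
  have hlim : Tendsto (fun n => ε (ns n)) atTop (𝓝 0) := hεlim.comp hns.tendsto_atTop
  have havg := isTransportSolution_average hθc hθT hV₀ hV₁ hV₂ hH hHl (fun n => hFm (ns n))
    (fun n => hFb (ns n)) hF₀m hF₀b hw hpos hlim fun n => hFsol (ns n)
  have hlimit := havg.shear_average hm hS hH hHl hE'm hE'b hF₀m hF₀b hfin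
  obtain ⟨K, hK⟩ := exists_isBoundedField_limit (T := T) (e := e) hm hθ hθT hS hH hE'm hE'b
  refine ⟨fun n => ε (ns n), hpos, hεanti.comp_strictMono hns, hlim,
    fun t => profileLp hS.continuous e (periodicLift hθc hθT) (F₀ t), ?_, fun I _ => ?_, ?_⟩
  · refine memLp_top_of_bound
      ((continuous_profileLp _ _).comp_stronglyMeasurable hF₀m).aestronglyMeasurable _
      (Eventually.of_forall fun t => (norm_profileLp_le _ _ _).trans
        (mul_le_mul_of_nonneg_left (hF₀b t) (norm_nonneg _)))
  · refine twoScaleConverges_of_weak hS.continuous (periodicLift hθc hθT) (fun n => hFm (ns n))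
      (fun n => hFb (ns n)) hF₀m hF₀b hw hpos hlim fun n => ?_
    -- The shears by `e θ(t/ε)` and `-e θ(t/ε)` compose to the identity, which recovers `f` from
    -- `F`.
    filter_upwards [(hf' _ (hpos n)).2.1] with t ht ht0
    rw [hF, periodicLift_coe]
    simp only [shearOp_shearOp, add_neg_cancel, shearOp_zero]
    exact (ht ht0).symm
  · refine isWeakLimitSolution_profileLp hθc hθT hS.continuous hA' hD' hE' fun φ hφ Kc hKc hφK => ?_
    refine integral_weak_formulation (Fact.out : 0 < T) hH hHl
      (Wl := fun s t z => (limitVelocity T m e θ A' s z.1 z.2,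
        limitForce T m e θ E' A' DA' t s z.1 z.2))
      (measurable_limit_field hθc hS.continuous.measurable hS.measurable hE'm) hK
      (g := fun s t => shearOp hS.continuous (e * θ s) (F₀ t)) ?_
      (fun s t => (norm_shearOp _ _ _).trans_le (hF₀b t)) hlimit hφ hKc hφK
    have h1 : StronglyMeasurable fun q : ℝ × ℝ => e * θ q.2 :=
      (by fun_prop : Continuous fun q : ℝ × ℝ => e * θ q.2).stronglyMeasurable
    exact StronglyMeasurable.shearOp hS.continuous h1 (hF₀m.comp_measurable measurable_fst)

end
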